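/- Let $p\ge 2$ be an integer, $\mathfrak q=e^{i\pi/p}$, and let $X$ be the complex vector space with basis $F_1,F_2$ and diagonal braiding $\Psi(F_i\otimes F_j)=q_{ij}\,F_j\otimes F_i$, where $q_{11}=q_{22}=\mathfrak q^{2}$ and $q_{12}=q_{21}=\mathfrak q^{-1}$. Let $\mathfrak B(X)$ be the Nichols algebra of $X$, realized as the image of the total braided symmetrizer in $T(X)$, with the quantum shuffle product $*$, the deconcatenation coproduct $\Delta(h)=h'\otimes h''$, and antipode $S$; it is a braided Hopf algebra. For integers $n_1,n_2$ let $Y^{n_1,n_2}=\mathbb C\,V^{n_1,n_2}$ be a one-dimensional space with braidings $\psi(F_i\otimes V^{n_1,n_2})=\mathfrak q^{1-n_i}\,V^{n_1,n_2}\otimes F_i$ and $\psi(V^{n_1,n_2}\otimes F_i)=\mathfrak q^{1-n_i}\,F_i\otimes V^{n_1,n_2}$. On $\mathfrak B(X)\otimes Y^{n_1,n_2}$ consider the coaction $x\otimes V\mapsto x'\otimes(x''\otimes V)$ and the left adjoint action of $\mathfrak B(X)$, in which $h$ sends $x\otimes V$ to the result of taking $h'\otimes h''\otimes x\otimes V$,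 braiding $h''$ to the right past $x\otimes V$, applying $S$ to it, braiding it back to the left past $V$, and multiplying; thus $F_i\blacktriangleright(x\otimes V)=\bigl(F_i*x-\mathfrak q^{2(1-n_i)}\chi_i(x)\,x*F_i\bigr)\otimes V$, where $\chi_i(F_{j_1}\otimes\dots\otimes F_{j_m})=q_{ij_1}\cdots q_{ij_m}$ (for $x$ of this multidegree). Then the $\mathfrak B(X)$-submodule $\mathscr Y_{n_1,n_2}\subset\mathfrak B(X)\otimes Y^{n_1,n_2}$ generated from $V^{n_1,n_2}=1\otimes V^{n_1,n_2}$ under this action is a simple Yetter–Drinfeld $\mathfrak B(X)$-module (with the restricted action and coaction), it is finite-dimensional, and its dimension is $$ d(p,n_1,n_2)=\begin{cases} d(\overline{n_1},\overline{n_2}), & \overline{n_1}+\overline{n_2}\le p,\\ d(\overline{n_1},\overline{n_2})-d(p-\overline{n_1},p-\overline{n_2}), & \overline{n_1}+\overline{n_2}\ge p+1,\end{cases} $$ where $d(m_1,m_2)=\tfrac12\,m_1m_2(m_1+m_2)$ and $\overline{x}\in\{1,\dots,p\}$ denotes the residue of $x$ modulo $p$, with $\overline{x}=p$ when $p\mid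 x$. -/

import Mathlib

open scoped TensorProduct

namespace NicholsYD

noncomputable section

/-! ### The tensor algebra of a diagonally braided vector space and its quantum shuffle structure

Throughout, `ι` indexes the preferred basis `(F i)` of a braided vector space `X` over `ℂ`, with
braiding `F i ⊗ F j ↦ c i j • F j ⊗ F i`. -/

/-- The underlying vector space of the tensor algebra `T(X)`: the basis vector indexed by the word
`[i₁, …, iₙ]` is `F i₁ ⊗ ⋯ ⊗ F iₙ`. -/
abbrev TX (ι : Type) : Type := List ι →₀ ℂ

variable {ι : Type}

/-- The tensor `F i₁ ⊗ ⋯ ⊗ F iₙ`. -/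
def word (w : List ι) : TX ι := Finsupp.single w 1

/-- Linear extension of a map given on words. -/
def lin {M : Type} [AddCommGroup M] [Module ℂ M] (f : List ι → M) : TX ι →ₗ[ℂ] M :=
  Finsupp.linearCombination ℂ f

/-- Bilinear extension of a map given on pairs of words. -/
def bilin {M : Type} [AddCommGroup M] [Module ℂ M] (f : List ι → List ι → M) :
    TX ι →ₗ[ℂ] TX ι →ₗ[ℂ] M :=
  lin fun u => lin (f u)

/-- The scalar that appears when the word `u` is braided past the word `w`. -/
def chi (c : Matrix ι ι ℂ) (u w : List ι) : ℂ :=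
  (u.map fun i => (w.map fun j => c i j).prod).prod

/-- The scalar `a i₁ ⋯ a iₙ` of the word `[i₁, …, iₙ]`. -/
def charOf (a : ι → ℂ) (w : List ι) : ℂ := (w.map a).prod

/-- The total braided symmetrizer `∑ σ, T_σ` in each tensor degree: `T_σ` permutes the tensor
factors by `σ` (the factor in position `i` moves to position `σ i`), and each pair of factors whose
order is reversed contributes its braiding coefficient. -/
def symmetrizer (c : Matrix ι ι ℂ) : TX ι →ₗ[ℂ] TX ι :=
  lin fun w => ∑ σ : Equiv.Perm (Fin w.length),
    (∏ i : Fin w.length, ∏ j : Fin w.length,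
      if i < j ∧ σ j < σ i then c (w.get i) (w.get j) else 1) •
      word (List.ofFn fun k => w.get (σ.symm k))

/-- The Nichols algebra `𝔅(X)`, as the image of the total braided symmetrizer in `T(X)`.  Its
product is the shuffle product and its coproduct is deconcatenation. -/
def nichols (c : Matrix ι ι ℂ) : Submodule ℂ (TX ι) := LinearMap.range (symmetrizer c)

/-- The shuffle product of two words: the sum over all shuffles, each letter of the second word
that passes to the left of a letter of the first one contributing the braiding coefficient. -/
def shuffle (c : Matrix ι ι ℂ) : List ι → List ι → TX ι
  | [], w => word w
  | i :: u, [] => word (i :: u)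
  | i :: u, j :: w =>
      lin (fun v => word (i :: v)) (shuffle c u (j :: w)) +
        chi c (i :: u) [j] • lin (fun v => word (j :: v)) (shuffle c (i :: u) w)
  termination_by u w => u.length + w.length

/-- The shuffle product. -/
def mul (c : Matrix ι ι ℂ) : TX ι →ₗ[ℂ] TX ι →ₗ[ℂ] TX ι := bilin (shuffle c)

/-- The coproduct: deconcatenation. -/
def comul : TX ι →ₗ[ℂ] TX ι ⊗[ℂ] TX ι :=
  lin fun w => ∑ k ∈ Finset.range (w.length + 1), word (w.take k) ⊗ₜ[ℂ] word (w.drop k)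

/-- The counit: the degree-zero coefficient. -/
def counit : TX ι →ₗ[ℂ] ℂ := Finsupp.lapply []

/-- The scalar `∏ k < l, c (i k) (i l)` of the word `[i₁, …, iₙ]`. -/
def halfTwist (c : Matrix ι ι ℂ) : List ι → ℂ
  | [] => 1
  | i :: w => chi c [i] w * halfTwist c w

/-- The antipode: `(-1)ⁿ` times the braided reversal of the tensor factors. -/
def antipode (c : Matrix ι ι ℂ) : TX ι →ₗ[ℂ] TX ι :=
  lin fun w => ((-1) ^ w.length * halfTwist c w) • word w.reverse

/-! ### One-vertex modules

Let `Y = ℂ V` be a one-dimensional space with braidings `F i ⊗ V ↦ a i • V ⊗ F i` and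
`V ⊗ F i ↦ b i • F i ⊗ V`.  The space `T(X) ⊗ Y` is identified with `T(X)`, the element `x`
standing for `x ⊗ V`; the one-vertex module is the subspace `𝔅(X) ⊗ Y`. -/

/-- The braiding `u ⊗ w ↦ w ⊗ u`, where the left (right) tensor factor may carry a vertex,
whose braiding with the letters of the other factor is given by `b` (by `a`); a factor without
a vertex corresponds to the constant function `1`. -/
def braid (c : Matrix ι ι ℂ) (a b : ι → ℂ) : TX ι ⊗[ℂ] TX ι →ₗ[ℂ] TX ι ⊗[ℂ] TX ι :=
  TensorProduct.lift <| bilin fun u w =>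
    (chi c u w * charOf a u * charOf b w) • (word w ⊗ₜ[ℂ] word u)

/-- The left adjoint action on the one-vertex module, `h ▸ (x ⊗ V)`:
`h ⊗ x ⊗ V ↦ h' ⊗ h'' ⊗ x ⊗ V ↦ h' ⊗ x ⊗ V ⊗ h''` (coproduct, then braiding of `h''` past `x ⊗ V`)
`↦ h' ⊗ x ⊗ V ⊗ S h'' ↦ h' ⊗ x ⊗ S h'' ⊗ V` (antipode, then braiding of `V` past `S h''`)
`↦ h' * x * S h'' ⊗ V` (product). -/
def act (c : Matrix ι ι ℂ) (a b : ι → ℂ) : TX ι →ₗ[ℂ] TX ι →ₗ[ℂ] TX ι :=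
  bilin fun h x => ∑ k ∈ Finset.range (h.length + 1),
    (chi c (h.drop k) x * charOf a (h.drop k) * charOf b (h.drop k)) •
      mul c (mul c (word (h.take k)) (word x)) (antipode c (word (h.drop k)))

/-- The left coaction on the one-vertex module, `x ⊗ V ↦ x' ⊗ (x'' ⊗ V)`. -/
def coact : TX ι →ₗ[ℂ] TX ι ⊗[ℂ] TX ι := comul

/-- The subspace `A ⊗ B` of `T(X) ⊗ T(X)`. -/
def tensorSub (A B : Submodule ℂ (TX ι)) : Submodule ℂ (TX ι ⊗[ℂ] TX ι) :=
  LinearMap.range (TensorProduct.mapIncl A B)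

/-- The left-hand side of the Yetter–Drinfeld axiom, as a map on `𝔅(X) ⊗ M`:
`(μ ⊗ ▸) ∘ (id ⊗ ψ ⊗ id) ∘ (Δ ⊗ δ)`. -/
def ydLeft (c : Matrix ι ι ℂ) (a b : ι → ℂ) : TX ι ⊗[ℂ] TX ι →ₗ[ℂ] TX ι ⊗[ℂ] TX ι :=
  let T := TX ι
  let swapMiddle : (T ⊗[ℂ] T) ⊗[ℂ] (T ⊗[ℂ] T) →ₗ[ℂ] (T ⊗[ℂ] T) ⊗[ℂ] (T ⊗[ℂ] T) :=
    (TensorProduct.assoc ℂ T T (T ⊗[ℂ] T)).symm.toLinearMap ∘ₗ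
    LinearMap.lTensor T
      ((TensorProduct.assoc ℂ T T T).toLinearMap ∘ₗ
        LinearMap.rTensor T (braid c 1 1) ∘ₗ
        (TensorProduct.assoc ℂ T T T).symm.toLinearMap) ∘ₗ
    (TensorProduct.assoc ℂ T T (T ⊗[ℂ] T)).toLinearMap
  TensorProduct.map (TensorProduct.lift (mul c)) (TensorProduct.lift (act c a b)) ∘ₗ
    swapMiddle ∘ₗ TensorProduct.map comul coact

/-- The right-hand side of the Yetter–Drinfeld axiom, as a map on `𝔅(X) ⊗ M`:
`(μ ⊗ id) ∘ (id ⊗ ψ) ∘ ((δ ∘ ▸) ⊗ id) ∘ (id ⊗ ψ) ∘ (Δ ⊗ id)`. -/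
def ydRight (c : Matrix ι ι ℂ) (a b : ι → ℂ) : TX ι ⊗[ℂ] TX ι →ₗ[ℂ] TX ι ⊗[ℂ] TX ι :=
  let T := TX ι
  LinearMap.rTensor T (TensorProduct.lift (mul c)) ∘ₗ
  (TensorProduct.assoc ℂ T T T).symm.toLinearMap ∘ₗ
  LinearMap.lTensor T (braid c 1 b) ∘ₗ
  (TensorProduct.assoc ℂ T T T).toLinearMap ∘ₗ
  LinearMap.rTensor T (coact ∘ₗ TensorProduct.lift (act c a b)) ∘ₗ
  (TensorProduct.assoc ℂ T T T).symm.toLinearMap ∘ₗ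
  LinearMap.lTensor T (braid c a 1) ∘ₗ
  (TensorProduct.assoc ℂ T T T).toLinearMap ∘ₗ
  LinearMap.rTensor T comul

/-- The subspace `U ⊗ V` of the one-vertex module is stable under the action and the coaction
of `𝔅(X)`. -/
structure IsStable (c : Matrix ι ι ℂ) (a b : ι → ℂ) (U : Submodule ℂ (TX ι)) : Prop where
  act_mem : ∀ h ∈ nichols c, ∀ m ∈ U, act c a b h m ∈ U
  coact_mem : ∀ m ∈ U, coact m ∈ tensorSub (nichols c) U

/-- The subspace `U ⊗ V` of the one-vertex module `𝔅(X) ⊗ Y` is a (left-left, braided)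
Yetter–Drinfeld module over the braided Hopf algebra `𝔅(X)`: it carries mutual braidings with
`𝔅(X)`, it is a module under the left adjoint action and a comodule under the coaction by
deconcatenation, and the action and the coaction satisfy the Yetter–Drinfeld axiom. -/
structure IsYetterDrinfeld (c : Matrix ι ι ℂ) (a b : ι → ℂ) (U : Submodule ℂ (TX ι)) : Prop
    extends IsStable c a b U where
  le_nichols : U ≤ nichols c
  braid_left_mem : ∀ t ∈ tensorSub (nichols c) U, braid c a 1 t ∈ tensorSub U (nichols c)
  braid_right_mem : ∀ t ∈ tensorSub U (nichols c), braid c 1 b t ∈ tensorSub (nichols c) U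
  one_act : ∀ m ∈ U, act c a b (word []) m = m
  mul_act : ∀ g ∈ nichols c, ∀ h ∈ nichols c, ∀ m ∈ U,
    act c a b (mul c g h) m = act c a b g (act c a b h m)
  counit_coact : ∀ m ∈ U, TensorProduct.lid ℂ (TX ι) (counit.rTensor (TX ι) (coact m)) = m
  coassoc : ∀ m ∈ U,
    TensorProduct.assoc ℂ (TX ι) (TX ι) (TX ι) (comul.rTensor (TX ι) (coact m)) =
      coact.lTensor (TX ι) (coact m)
  compat : ∀ h ∈ nichols c, ∀ m ∈ U, ydLeft c a b (h ⊗ₜ[ℂ] m) = ydRight c a b (h ⊗ₜ[ℂ] m)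

/-- `U ⊗ V` is a simple Yetter–Drinfeld module: it is nonzero, and its only subspaces stable under
the action and the coaction are `0` and itself. -/
structure IsSimpleYetterDrinfeld (c : Matrix ι ι ℂ) (a b : ι → ℂ) (U : Submodule ℂ (TX ι)) :
    Prop extends IsYetterDrinfeld c a b U where
  ne_bot : U ≠ ⊥
  eq_bot_or_eq : ∀ W : Submodule ℂ (TX ι), W ≤ U → IsStable c a b W → W = ⊥ ∨ W = U

/-- The submodule generated from the vertex `V = 1 ⊗ V` under the action of `𝔅(X)`: the smallest
subspace that contains `V` and is stable under the action. -/
def generatedByVertex (c : Matrix ι ι ℂ) (a b : ι → ℂ) : Submodule ℂ (TX ι) :=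
  sInf {U | word [] ∈ U ∧ ∀ h ∈ nichols c, ∀ m ∈ U, act c a b h m ∈ U}

/-! ### The rank-two case of Cartan type `A₂` -/

/-- `𝔮 = exp(iπ/p)`. -/
def q (p : ℕ) : ℂ := Complex.exp (Complex.I * Real.pi / p)

/-- The braiding matrix of `F₁`, `F₂`. -/
def qMatrix (p : ℕ) : Matrix (Fin 2) (Fin 2) ℂ :=
  !![q p ^ 2, (q p)⁻¹; (q p)⁻¹, q p ^ 2]

/-- The coefficients `𝔮 ^ (1 - nᵢ)` of both braidings of the vertex `V^{n₁, n₂}` with `Fᵢ`. -/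
def vertexBraiding (p : ℕ) (n₁ n₂ : ℤ) : Fin 2 → ℂ :=
  ![q p ^ (1 - n₁), q p ^ (1 - n₂)]

/-- The residue of `x` modulo `p`, taken in `{1, …, p}`. -/
def res (p : ℕ) (x : ℤ) : ℤ := if x % p = 0 then p else x % p

/-- `d(n₁, n₂) = ½ n₁ n₂ (n₁ + n₂)`. -/
def d (n₁ n₂ : ℤ) : ℚ := 1 / 2 * n₁ * n₂ * (n₁ + n₂)

/-- The dimension formula `d(p, n₁, n₂)`. -/
def dimFormula (p : ℕ) (n₁ n₂ : ℤ) : ℚ :=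
  if res p n₁ + res p n₂ ≤ p then d (res p n₁) (res p n₂)
  else d (res p n₁) (res p n₂) - d (p - res p n₁) (p - res p n₂)

end

end NicholsYD

namespace NicholsYD

noncomputable section

set_option linter.unusedSectionVars false

variable {ι : Type}

/-! ### Basic operators on the tensor algebra -/

/-! An element of `T(X)` is determined by its degree-zero coefficient and by its images under the
operators `leftDer k`, which delete a leading letter `k`. The shuffle product, the antipode and the
adjoint action obey twisted Leibniz rules for these operators (`leftDer_mul`, `leftDer_antipode`,
`leftDer_act`). Associativity, the module axiom (`mul_act`) and the Yetter–Drinfeld axiom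
(`ydLeft_eq_ydRight`) therefore follow by induction on the word at which coefficients are compared.

Simplicity holds for every diagonal braiding and every vertex. The generated module `U` is a
subcomodule (`comul_mem_generated`). Any subcomodule is stable under all `leftDer k`, and these
shorten words, so a nonzero one contains `V` (`word_nil_mem_of_leftDer`); if it is also stable under
the action, it contains all of `U`.

For the dimension, put `t = s ^ 2`, a primitive `p`-th root of unity, and `Aᵢ = aᵢ bᵢ = t ^ (1 -
mᵢ)`, where `mᵢ` is the residue of `nᵢ`. Besides the PBW elements `x ^ i z ^ l y ^ n`, with `z =
word [1, 0]`, the second root vector `z'`, a multiple of `word [0, 1]`, is used. On a monomial `x ^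
i z ^ l z' ^ d y ^ n`, the letter `0` either raises `i`, with factor `1 - A₀ t ^ (i + l)`, or trades
a `y` for a `z'`; the letter `1` either raises `n`, with factor `1 - A₁ t ^ (n + d)`, or trades an
`x` for a `z`. Hence the monomials with `i + l < m₁`, `n + d < m₂` span a stable space containing
`U`. Its dimension is `m₁ m₂ (m₁ + m₂) / 2`, as in the Weyl formula for `sl₃`
(`two_mul_finrank_stdSpan`): the relation expressing `x y` through `z` and `z'` gives the upper
bound, and strings under `leftDer 0`, ending at the elements `z ^ l y ^ c`, give the lower bound.

If `m₁ + m₂ ≤ p`, then `U` is this whole space. Otherwise put `k = m₁ + m₂ - p`: the step from `z ^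
(k - 1)` to `z ^ k` is obstructed, and `U` has the complement `stdSpan s k (p - m₂) (p - m₁)`, of
dimension `d(p - m₁, p - m₂)` (`generated_sup_stdSpan`, `disjoint_generated_stdSpan`). -/

@[simp] theorem lin_word {M : Type} [AddCommGroup M] [Module ℂ M] (f : List ι → M) (w : List ι) :
    lin f (word w) = f w := by
  simp [lin, word]

@[simp] theorem bilin_word {M : Type} [AddCommGroup M] [Module ℂ M] (f : List ι → List ι → M)
    (u w : List ι) : bilin f (word u) (word w) = f u w := by
  simp [bilin]

theorem word_apply [DecidableEq ι] (u w : List ι) : word u w = if u = w then (1 : ℂ) else 0 := by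
  simp [word, Finsupp.single_apply]

@[simp] theorem word_nil_apply_nil : word ([] : List ι) [] = (1 : ℂ) := by simp [word]

@[simp] theorem word_cons_apply_nil (i : ι) (u : List ι) : word (i :: u) [] = (0 : ℂ) := by
  simp [word]

theorem induction_word {P : TX ι → Prop} (x : TX ι) (hw : ∀ w, P (word w))
    (hadd : ∀ x y, P x → P y → P (x + y)) (hsmul : ∀ (r : ℂ) x, P x → P (r • x)) : P x := by
  induction x using Finsupp.induction_linear with
  | zero => simpa using hsmul 0 _ (hw [])
  | add x y hx hy => exact hadd x y hx hy
  | single w r => simpa [word] using hsmul r _ (hw w)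

/-- Removal of the first letter, if it is `i`. -/
def leftDer (i : ι) : TX ι →ₗ[ℂ] TX ι :=
  Finsupp.lcomapDomain (List.cons i) (List.cons_injective)

@[simp] theorem leftDer_apply (i : ι) (x : TX ι) (w : List ι) : leftDer i x w = x (i :: w) := rfl

theorem ext_coeff {x y : TX ι} (h : ∀ w, x w = y w) : x = y := Finsupp.ext h

/-- Prepending the letter `i`. -/
def cons (i : ι) : TX ι →ₗ[ℂ] TX ι := lin fun v => word (i :: v)

@[simp] theorem cons_word (i : ι) (w : List ι) : cons i (word w) = word (i :: w) := by simp [cons]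

/-- The diagonal operator with eigenvalue `charOf θ w` on the word `w`. -/
def diag (θ : ι → ℂ) : TX ι →ₗ[ℂ] TX ι := lin fun w => charOf θ w • word w

@[simp] theorem diag_word (θ : ι → ℂ) (w : List ι) : diag θ (word w) = charOf θ w • word w := by
  simp [diag]

@[simp] theorem charOf_nil (θ : ι → ℂ) : charOf θ [] = 1 := rfl

@[simp] theorem charOf_cons (θ : ι → ℂ) (i : ι) (w : List ι) :
    charOf θ (i :: w) = θ i * charOf θ w := by simp [charOf]

@[simp] theorem charOf_append (θ : ι → ℂ) (u w : List ι) :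
    charOf θ (u ++ w) = charOf θ u * charOf θ w := by simp [charOf]

theorem charOf_mul (θ η : ι → ℂ) (w : List ι) :
    charOf (fun i => θ i * η i) w = charOf θ w * charOf η w := by
  induction w with
  | nil => simp
  | cons i w ih => simp [ih]; ring

@[simp] theorem charOf_one (w : List ι) : charOf (1 : ι → ℂ) w = 1 := by
  induction w with
  | nil => simp
  | cons i w ih => simp [ih]

variable (c : Matrix ι ι ℂ)

@[simp] theorem chi_nil_left (w : List ι) : chi c [] w = 1 := rfl

@[simp] theorem chi_cons_left (i : ι) (u w : List ι) :
    chi c (i :: u) w = charOf (c i) w * chi c u w := by simp [chi, charOf]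

@[simp] theorem chi_append_left (u v w : List ι) :
    chi c (u ++ v) w = chi c u w * chi c v w := by simp [chi]

@[simp] theorem chi_nil_right (w : List ι) : chi c w [] = 1 := by
  induction w with
  | nil => simp
  | cons i w ih => simp [ih]

theorem chi_cons_right (i : ι) (u w : List ι) :
    chi c u (i :: w) = charOf (fun j => c j i) u * chi c u w := by
  induction u with
  | nil => simp
  | cons j u ih => simp [ih]; ring

theorem chi_singleton_right (i : ι) (u : List ι) : chi c u [i] = charOf (fun j => c j i) u := by
  simp [chi_cons_right]

theorem chi_append_right (u v w : List ι) :
    chi c u (v ++ w) = chi c u v * chi c u w := by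
  induction v with
  | nil => simp
  | cons i v ih => simp [chi_cons_right, ih]; ring

theorem chi_eq_charOf_right (u w : List ι) : chi c u w = charOf (fun j => chi c u [j]) w := by
  induction w with
  | nil => simp
  | cons i w ih => rw [chi_cons_right, ih]; simp [chi_singleton_right]

theorem chi_eq_charOf_left (u w : List ι) : chi c u w = charOf (fun j => chi c [j] w) u := by
  induction u with
  | nil => simp
  | cons i w ih => simp [ih]

theorem diag_apply (θ : ι → ℂ) (x : TX ι) (w : List ι) : diag θ x w = charOf θ w * x w := by
  classical
  induction x using induction_word with
  | hw v =>
    rw [diag_word, Finsupp.smul_apply, word_apply, smul_eq_mul]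
    split_ifs with h
    · rw [h]
    · simp
  | hadd x y hx hy => simp [hx, hy, mul_add]
  | hsmul r x hx => simp [hx]; ring

theorem diag_comm (θ η : ι → ℂ) (x : TX ι) : diag θ (diag η x) = diag η (diag θ x) := by
  ext w; simp only [diag_apply]; ring

theorem diag_diag (θ η : ι → ℂ) (x : TX ι) : diag θ (diag η x) = diag (fun i => θ i * η i) x := by
  ext w; simp only [diag_apply, charOf_mul]; ring

@[simp] theorem diag_one (x : TX ι) : diag (1 : ι → ℂ) x = x := by
  ext w; simp [diag_apply]

theorem leftDer_diag (θ : ι → ℂ) (i : ι) (x : TX ι) :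
    leftDer i (diag θ x) = θ i • diag θ (leftDer i x) := by
  ext w; simp [diag_apply, mul_assoc]

/-! ### Removal of the first and of the last letter -/

variable [DecidableEq ι]

theorem leftDer_word (i : ι) (w : List ι) :
    leftDer i (word w) = if w.head? = some i then word w.tail else 0 := by
  ext v
  cases w with
  | nil => simp [word]
  | cons j w =>
    simp only [leftDer_apply, word, List.head?_cons, Option.some.injEq, List.tail_cons,
      Finsupp.single_apply, List.cons.injEq]
    split_ifs <;> simp_all

@[simp] theorem leftDer_word_nil (i : ι) : leftDer i (word []) = 0 := by simp [leftDer_word]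

@[simp] theorem leftDer_word_cons (i j : ι) (w : List ι) :
    leftDer i (word (j :: w)) = if j = i then word w else 0 := by simp [leftDer_word]

theorem leftDer_cons (i j : ι) (x : TX ι) :
    leftDer i (cons j x) = if j = i then x else 0 := by
  induction x using induction_word with
  | hw w => simp
  | hadd x y hx hy => simp only [map_add, hx, hy]; split_ifs <;> simp
  | hsmul r x hx => simp only [map_smul, hx]; split_ifs <;> simp

theorem cons_apply_nil (j : ι) (x : TX ι) : cons j x [] = 0 := by
  induction x using induction_word with
  | hw w => simp
  | hadd x y hx hy => simp [hx, hy]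
  | hsmul r x hx => simp [hx]

/-- Removal of the last letter, if it is `i`, together with its braiding to the left end. -/
def rightDer (i : ι) : TX ι →ₗ[ℂ] TX ι :=
  lin fun w => if w.getLast? = some i then chi c w.dropLast [i] • word w.dropLast else 0

theorem rightDer_word (i : ι) (w : List ι) : rightDer c i (word w) =
    if w.getLast? = some i then chi c w.dropLast [i] • word w.dropLast else 0 := by
  simp [rightDer]

@[simp] theorem rightDer_word_nil (i : ι) : rightDer c i (word []) = 0 := by simp [rightDer]

@[simp] theorem rightDer_word_concat (i j : ι) (w : List ι) : rightDer c i (word (w ++ [j])) =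
    if j = i then chi c w [i] • word w else 0 := by
  simp [rightDer]

/-- The two ends of a word are removed independently. The factor `c k i` records whether `k` is
still there when the last letter is braided to the left end; on a one-letter word both sides vanish.
-/
theorem leftDer_rightDer (k i : ι) (x : TX ι) :
    leftDer k (rightDer c i x) = c k i • rightDer c i (leftDer k x) := by
  induction x using induction_word with
  | hw w =>
    induction w using List.reverseRecOn with
    | nil => simp
    | append_singleton w j _ =>
      cases w with
      | nil =>
        have := rightDer_word_concat c i j []
        simp only [List.nil_append] at this
        simp only [List.nil_append, this, leftDer_word_cons]
        split_ifs <;> simp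
      | cons l w =>
        have := rightDer_word_concat c i j w
        rw [rightDer_word_concat]
        simp only [List.cons_append, leftDer_word_cons]
        split_ifs with h1 h2
        · subst h2
          simp [h1, mul_smul]
        · simp [h2]
        · simp [h1]
        · simp
  | hadd x y hx hy => simp only [map_add, hx, hy, smul_add]
  | hsmul r x hx => simp only [map_smul, hx, smul_comm r]

theorem rightDer_apply_nil (i : ι) (x : TX ι) : rightDer c i x [] = leftDer i x [] := by
  induction x using induction_word with
  | hw w =>
    induction w using List.reverseRecOn with
    | nil => simp
    | append_singleton w j _ =>
      rw [rightDer_word_concat]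
      cases w with
      | nil => simp
      | cons l w =>
        simp only [List.cons_append, leftDer_word_cons]
        split_ifs <;> simp [word]
  | hadd x y hx hy => simp_all [map_add]
  | hsmul r x hx => simp_all [map_smul]

theorem rightDer_diag (θ : ι → ℂ) (i : ι) (x : TX ι) :
    rightDer c i (diag θ x) = θ i • diag θ (rightDer c i x) := by
  induction x using induction_word with
  | hw w =>
    induction w using List.reverseRecOn with
    | nil => simp
    | append_singleton w j _ =>
      simp only [diag_word, map_smul, rightDer_word_concat, charOf_append, charOf_cons, charOf_nil]
      split_ifs with h
      · subst h
        simp only [map_smul, diag_word, smul_smul]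
        congr 1; ring
      · simp
  | hadd x y hx hy => simp only [map_add, hx, hy, smul_add]
  | hsmul r x hx => simp only [map_smul, hx, smul_comm r]

/-! ### The shuffle product -/

/-- `x ↦ χ(x, F i) x`. -/
abbrev passR (i : ι) : TX ι →ₗ[ℂ] TX ι := diag fun j => c j i

/-- `x ↦ χ(x, F i) χ(F i, x) x`. -/
abbrev passRL (i : ι) : TX ι →ₗ[ℂ] TX ι := diag fun j => c j i * c i j

@[simp] theorem mul_word_nil_left (x : TX ι) : mul c (word []) x = x := by
  induction x using induction_word with
  | hw w => simp [mul, shuffle]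
  | hadd x y hx hy => simp [hx, hy]
  | hsmul r x hx => simp [hx]

@[simp] theorem mul_word_nil_right (x : TX ι) : mul c x (word []) = x := by
  induction x using induction_word with
  | hw w => cases w <;> simp [mul, shuffle]
  | hadd x y hx hy => simp [hx, hy]
  | hsmul r x hx => simp [hx]

theorem mul_word_cons (i j : ι) (u w : List ι) :
    mul c (word (i :: u)) (word (j :: w)) = cons i (mul c (word u) (word (j :: w))) +
      chi c (i :: u) [j] • cons j (mul c (word (i :: u)) (word w)) := by
  simp only [mul, bilin_word]
  rw [shuffle]
  rfl

/-- A shuffle starts with the first letter of `x` or with that of `y`; in the second case this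
letter has passed all of `x`, whence `passR`. -/
theorem leftDer_mul (k : ι) (x y : TX ι) :
    leftDer k (mul c x y) = mul c (leftDer k x) y + mul c (passR c k x) (leftDer k y) := by
  induction x using induction_word with
  | hw u =>
    induction y using induction_word with
    | hw w =>
      cases u with
      | nil => simp
      | cons i u =>
        cases w with
        | nil => simp
        | cons j w =>
          rw [mul_word_cons]
          simp only [map_add, map_smul, leftDer_cons, leftDer_word_cons, diag_word,
            LinearMap.smul_apply, chi_singleton_right]
          split_ifs with h1 h2 h2
          · subst h2; simp
          · simp
          · subst h2; simp
          · simp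
    | hadd x y hx hy => simp only [map_add, hx, hy]; abel
    | hsmul r x hx => simp only [map_smul, hx, smul_add]
  | hadd x y hx hy => simp only [map_add, LinearMap.add_apply, hx, hy]; abel
  | hsmul r x hx => simp only [map_smul, LinearMap.smul_apply, hx, smul_add]

theorem mul_apply_nil (x y : TX ι) : mul c x y [] = x [] * y [] := by
  induction x using induction_word with
  | hw u =>
    induction y using induction_word with
    | hw w =>
      cases u with
      | nil => simp
      | cons i u =>
        cases w with
        | nil => simp
        | cons j w =>
          rw [mul_word_cons]
          simp [cons_apply_nil]
    | hadd x y hx hy => simp only [map_add, Finsupp.add_apply, hx, hy]; ring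
    | hsmul r x hx => simp only [map_smul, Finsupp.smul_apply, smul_eq_mul, hx]; ring
  | hadd x y hx hy => simp only [map_add, LinearMap.add_apply, Finsupp.add_apply, hx, hy]; ring
  | hsmul r x hx =>
    simp only [map_smul, LinearMap.smul_apply, Finsupp.smul_apply, smul_eq_mul, hx]; ring

theorem diag_mul (θ : ι → ℂ) (x y : TX ι) :
    diag θ (mul c x y) = mul c (diag θ x) (diag θ y) := by
  refine ext_coeff fun w => ?_
  induction w generalizing x y with
  | nil => simp [diag_apply, mul_apply_nil]
  | cons k w ih =>
    rw [← leftDer_apply, ← leftDer_apply, leftDer_diag, leftDer_mul, leftDer_mul, map_add]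
    simp only [Finsupp.add_apply, Finsupp.smul_apply, ih, leftDer_diag, map_smul,
      LinearMap.smul_apply, smul_eq_mul, diag_comm θ (fun j => c j k)]
    ring

theorem mul_assoc' (x y z : TX ι) : mul c (mul c x y) z = mul c x (mul c y z) := by
  refine ext_coeff fun w => ?_
  induction w generalizing x y z with
  | nil => simp [mul_apply_nil, mul_assoc]
  | cons k w ih =>
    rw [← leftDer_apply, ← leftDer_apply]
    simp only [leftDer_mul, diag_mul, map_add, LinearMap.add_apply, Finsupp.add_apply, ih]
    ring

/-- Shuffles are built from the left, so the rule at the right end is obtained indirectly: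
`rightDer` commutes with `leftDer` up to a scalar, and both sides satisfy the same `leftDer`
recursion. A last letter coming from `x` crosses `y` once in the shuffle and once on its way to the
left end, whence `passRL`. -/
theorem rightDer_mul (i : ι) (x y : TX ι) : rightDer c i (mul c x y) =
    mul c (passR c i x) (rightDer c i y) + mul c (rightDer c i x) (passRL c i y) := by
  refine ext_coeff fun w => ?_
  induction w generalizing x y with
  | nil =>
    rw [rightDer_apply_nil, leftDer_mul, Finsupp.add_apply, Finsupp.add_apply]
    simp only [mul_apply_nil, diag_apply, rightDer_apply_nil, charOf_nil, one_mul]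
    ring
  | cons k w ih =>
    rw [← leftDer_apply, ← leftDer_apply]
    simp only [leftDer_mul, leftDer_rightDer, map_add,
      Finsupp.add_apply, map_smul, Finsupp.smul_apply, ih, leftDer_diag, rightDer_diag,
      LinearMap.smul_apply, smul_eq_mul, diag_comm (fun j => c j i) (fun j => c j k)]
    ring

end

end NicholsYD

namespace NicholsYD

noncomputable section

set_option linter.unusedSectionVars false

variable {ι : Type} [DecidableEq ι] (c : Matrix ι ι ℂ)

/-! ### Sums over the splittings of a word -/

section splitSum

variable {M : Type} [AddCommMonoid M] [Module ℂ M]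

/-- The sum of `Φ u v` over the decompositions `h = u ++ v`. -/
def splitSum (Φ : List ι → List ι → M) (h : List ι) : M :=
  ∑ k ∈ Finset.range (h.length + 1), Φ (h.take k) (h.drop k)

@[simp] theorem splitSum_nil (Φ : List ι → List ι → M) : splitSum Φ [] = Φ [] [] := by
  simp [splitSum]

theorem splitSum_cons (Φ : List ι → List ι → M) (i : ι) (h : List ι) :
    splitSum Φ (i :: h) = Φ [] (i :: h) + splitSum (fun u v => Φ (i :: u) v) h := by
  rw [splitSum, List.length_cons, Finset.sum_range_succ', add_comm]
  simp [splitSum]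

theorem splitSum_concat (Φ : List ι → List ι → M) (i : ι) (h : List ι) :
    splitSum Φ (h ++ [i]) = splitSum (fun u v => Φ u (v ++ [i])) h + Φ (h ++ [i]) [] := by
  simp only [splitSum, List.length_append, List.length_singleton,
    Finset.sum_range_succ _ (h.length + 1)]
  congr 1
  · refine Finset.sum_congr rfl fun k hk => ?_
    have hk' : k ≤ h.length := by simpa [Nat.lt_succ_iff] using hk
    rw [List.take_append_of_le_length hk', List.drop_append_of_le_length hk']
  · congr 1 <;> simp

theorem splitSum_congr {Φ Ψ : List ι → List ι → M} {h : List ι}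
    (H : ∀ u v, u ++ v = h → Φ u v = Ψ u v) : splitSum Φ h = splitSum Ψ h :=
  Finset.sum_congr rfl fun _ _ => H _ _ (List.take_append_drop _ _)

theorem splitSum_add (Φ Ψ : List ι → List ι → M) (h : List ι) :
    splitSum (fun u v => Φ u v + Ψ u v) h = splitSum Φ h + splitSum Ψ h :=
  Finset.sum_add_distrib

theorem splitSum_sub {M : Type} [AddCommGroup M] (Φ Ψ : List ι → List ι → M) (h : List ι) :
    splitSum (fun u v => Φ u v - Ψ u v) h = splitSum Φ h - splitSum Ψ h :=
  Finset.sum_sub_distrib _ _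

theorem splitSum_smul (r : ℂ) (Φ : List ι → List ι → M) (h : List ι) :
    splitSum (fun u v => r • Φ u v) h = r • splitSum Φ h :=
  Finset.smul_sum.symm

theorem map_splitSum {N : Type} [AddCommMonoid N] [Module ℂ N] (f : M →ₗ[ℂ] N)
    (Φ : List ι → List ι → M) (h : List ι) :
    f (splitSum Φ h) = splitSum (fun u v => f (Φ u v)) h :=
  map_sum _ _ _

/-- Moving the cut across one letter turns the last letter of the left part into the first letter of
the right part. This produces the cancellation in `rTensor_leftDer_ydRight`. -/
theorem splitSum_shift (k : ι) (Ψ : List ι → List ι → M) (h : List ι) :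
    splitSum (fun u v => if u.getLast? = some k then Ψ u.dropLast v else 0) h =
      splitSum (fun u v => if v.head? = some k then Ψ u v.tail else 0) h := by
  rw [splitSum, splitSum, Finset.sum_range_succ', Finset.sum_range_succ]
  congr 1
  · refine Finset.sum_congr rfl fun a ha => ?_
    have ha' : a < h.length := by simpa using ha
    have h1 : h.take (a + 1) = h.take a ++ [h[a]] := (List.take_concat_get' h a ha').symm
    have h2 : h.drop a = h[a] :: h.drop (a + 1) := List.drop_eq_getElem_cons ha'
    rw [h1, h2, List.tail_cons, List.head?_cons, List.getLast?_concat, List.dropLast_concat]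
  · simp

end splitSum

/-! ### The antipode and the action -/

theorem halfTwist_concat (v : List ι) (j : ι) :
    halfTwist c (v ++ [j]) = halfTwist c v * chi c v [j] := by
  induction v with
  | nil => simp [halfTwist]
  | cons i v ih =>
    simp only [List.cons_append, halfTwist, ih, chi_append_right, chi_cons_left, charOf_cons,
      charOf_nil, chi_nil_left]
    ring

/-- The antipode reverses words, so its first letter is the last letter of `x`. The scalar built
into `rightDer` is exactly the part of `halfTwist` involving that letter. -/
theorem leftDer_antipode (k : ι) (x : TX ι) :
    leftDer k (antipode c x) = - antipode c (rightDer c k x) := by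
  induction x using induction_word with
  | hw w =>
    induction w using List.reverseRecOn with
    | nil => simp [antipode]
    | append_singleton w j _ =>
      rw [rightDer_word_concat]
      simp only [antipode, lin_word, map_smul, List.reverse_append, List.reverse_singleton,
        List.singleton_append, leftDer_word_cons, List.length_append, List.length_singleton,
        halfTwist_concat]
      split_ifs with h
      · subst h
        simp only [map_smul, lin_word, smul_smul, ← neg_smul]
        congr 1; ring
      · simp
  | hadd x y hx hy => simp only [map_add, hx, hy]; abel
  | hsmul r x hx => simp only [map_smul, hx, smul_neg]

@[simp] theorem antipode_word_nil : antipode c (word []) = word [] := by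
  simp [antipode, halfTwist]

theorem antipode_apply_nil (x : TX ι) : antipode c x [] = x [] := by
  induction x using induction_word with
  | hw w =>
    induction w using List.reverseRecOn with
    | nil => simp
    | append_singleton w j _ =>
      simp only [antipode, lin_word, List.reverse_append, List.reverse_singleton,
        List.singleton_append, Finsupp.smul_apply, word_cons_apply_nil, smul_zero]
      simp [word]
  | hadd x y hx hy => simp [hx, hy]
  | hsmul r x hx => simp [hx]

variable (a b : ι → ℂ)

theorem act_word (h : List ι) (y : TX ι) : act c a b (word h) y =
    splitSum (fun u v => charOf (fun i => a i * b i) v •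
      mul c (mul c (word u) (diag (fun j => chi c v [j]) y)) (antipode c (word v))) h := by
  induction y using induction_word with
  | hw w =>
    simp only [act, bilin_word, splitSum, diag_word, map_smul, LinearMap.smul_apply, smul_smul]
    refine Finset.sum_congr rfl fun k _ => ?_
    congr 1
    rw [charOf_mul, ← chi_eq_charOf_right]
    ring
  | hadd x y hx hy =>
    simp only [map_add, hx, hy, ← splitSum_add, LinearMap.add_apply, smul_add]
  | hsmul r x hx =>
    simp only [map_smul, hx, ← splitSum_smul, LinearMap.smul_apply, smul_comm r]

@[simp] theorem act_word_nil (y : TX ι) : act c a b (word []) y = y := by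
  have : (fun j => chi c [] [j]) = (1 : ι → ℂ) := by ext; simp
  rw [act_word, splitSum_nil, this]
  simp

/-- The first letter of `h' * y * S h''` comes from one of the three factors. A letter of `S h''` is
a last letter of `h` that was braided past `V` in both directions, which costs `a k * b k`, and past
`y` twice. -/
theorem leftDer_act (k : ι) (x y : TX ι) : leftDer k (act c a b x y) =
    act c a b (leftDer k x) y + act c a b (passR c k x) (leftDer k y)
      - (a k * b k) • act c a b (rightDer c k x) (passRL c k y) := by
  induction x using induction_word with
  | hw h =>
    have key : leftDer k (act c a b (word h) y) =
        splitSum (fun u v => charOf (fun i => a i * b i) v •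
          mul c (mul c (leftDer k (word u)) (diag (fun j => chi c v [j]) y))
            (antipode c (word v))) h
        + splitSum (fun u v => charOf (fun i => a i * b i) v •
          mul c (mul c (passR c k (word u)) (leftDer k (diag (fun j => chi c v [j]) y)))
            (antipode c (word v))) h
        - splitSum (fun u v => charOf (fun i => a i * b i) v •
          mul c (mul c (passR c k (word u)) (passR c k (diag (fun j => chi c v [j]) y)))
            (antipode c (rightDer c k (word v)))) h := by
      rw [act_word, map_splitSum, ← splitSum_add, ← splitSum_sub]
      refine splitSum_congr fun u v _ => ?_
      simp only [map_smul, leftDer_mul, leftDer_antipode, diag_mul, map_add, LinearMap.add_apply,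
        map_neg, smul_add, smul_neg, sub_eq_add_neg]
    rw [key]
    congr 1
    · congr 1
      · cases h with
        | nil => simp
        | cons j h =>
          rw [splitSum_cons]
          simp only [leftDer_word_nil, leftDer_word_cons, map_zero, LinearMap.zero_apply, smul_zero,
            zero_add]
          split_ifs with hj
          · rw [act_word]
          · simp [splitSum]
      · rw [diag_word, map_smul, LinearMap.smul_apply, act_word, ← splitSum_smul]
        refine splitSum_congr fun u v huv => ?_
        subst huv
        simp only [leftDer_diag, diag_word, map_smul, LinearMap.smul_apply, smul_smul,
          charOf_append, chi_singleton_right]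
        congr 1; ring
    · induction h using List.reverseRecOn with
      | nil => simp
      | append_singleton h j _ =>
        rw [splitSum_concat, rightDer_word_concat]
        simp only [rightDer_word_nil, rightDer_word_concat, map_zero, smul_zero, add_zero]
        split_ifs with hj
        · subst hj
          rw [map_smul, LinearMap.smul_apply, act_word, ← splitSum_smul, ← splitSum_smul]
          refine splitSum_congr fun u v huv => ?_
          subst huv
          simp only [diag_word, map_smul, LinearMap.smul_apply, smul_smul, diag_diag]
          have : (fun i => c i j * chi c (v ++ [j]) [i]) =
              fun i => chi c v [i] * (c i j * c j i) := by
            ext i; simp; ring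
          rw [this]
          congr 1
          simp only [charOf_append, chi_singleton_right, charOf_cons, charOf_nil]
          ring
        · simp [splitSum]
  | hadd x y hx hy =>
    simp only [map_add, LinearMap.add_apply, hx, hy, smul_add]; abel
  | hsmul r x hx =>
    simp only [map_smul, LinearMap.smul_apply, hx, smul_sub, smul_add, smul_comm r]

theorem act_apply_nil (x y : TX ι) : act c a b x y [] = x [] * y [] := by
  induction x using induction_word with
  | hw h =>
    cases h with
    | nil => simp
    | cons i h =>
      have : ∀ z : TX ι, z [] = Finsupp.lapply (R := ℂ) [] z := fun _ => rfl
      rw [act_word, this, map_splitSum]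
      trans splitSum (fun _ _ => (0 : ℂ)) (i :: h)
      · refine splitSum_congr fun u v huv => ?_
        cases u with
        | nil =>
          obtain rfl : v = i :: h := by simpa using huv
          simp [mul_apply_nil, antipode_apply_nil]
        | cons j u => simp [mul_apply_nil]
      · simp [splitSum]
  | hadd x y hx hy => simp only [map_add, LinearMap.add_apply, Finsupp.add_apply, hx, hy]; ring
  | hsmul r x hx =>
    simp only [map_smul, LinearMap.smul_apply, Finsupp.smul_apply, smul_eq_mul, hx]; ring

theorem diag_act (θ : ι → ℂ) (x y : TX ι) :
    diag θ (act c a b x y) = act c a b (diag θ x) (diag θ y) := by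
  refine ext_coeff fun w => ?_
  induction w generalizing x y with
  | nil => simp [diag_apply, act_apply_nil]
  | cons k w ih =>
    rw [← leftDer_apply, ← leftDer_apply, leftDer_diag, leftDer_act, leftDer_act]
    simp only [map_add, map_sub, Finsupp.add_apply, Finsupp.sub_apply, Finsupp.smul_apply, ih,
      leftDer_diag, rightDer_diag, map_smul, LinearMap.smul_apply, smul_eq_mul,
      diag_comm θ (fun j => c j k), diag_comm θ (fun j => c j k * c k j)]
    ring

/-- Neither multiplicativity of the coproduct nor anti-multiplicativity of the antipode is needed:
the Leibniz rules give both sides the same recursion. -/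
theorem mul_act (x y z : TX ι) :
    act c a b (mul c x y) z = act c a b x (act c a b y z) := by
  refine ext_coeff fun w => ?_
  induction w generalizing x y z with
  | nil => simp [act_apply_nil, mul_apply_nil, mul_assoc]
  | cons k w ih =>
    rw [← leftDer_apply, ← leftDer_apply]
    simp only [leftDer_act, leftDer_mul, rightDer_mul, diag_mul, diag_act, map_add, map_sub,
      LinearMap.add_apply, Finsupp.add_apply, Finsupp.sub_apply, map_smul, Finsupp.smul_apply,
      smul_add, smul_eq_mul, ih]
    ring

end

end NicholsYD

namespace NicholsYD

noncomputable section

set_option linter.unusedSectionVars false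

variable {ι : Type} [DecidableEq ι] (c : Matrix ι ι ℂ) (a b : ι → ℂ)

/-! ### The Yetter–Drinfeld compatibility -/

/-- The coefficient of the word `w` in the left tensor factor. -/
def leftCoeff (w : List ι) : TX ι ⊗[ℂ] TX ι →ₗ[ℂ] TX ι :=
  (TensorProduct.lid ℂ (TX ι)).toLinearMap ∘ₗ LinearMap.rTensor (TX ι) (Finsupp.lapply w)

@[simp] theorem leftCoeff_tmul (w : List ι) (x y : TX ι) :
    leftCoeff w (x ⊗ₜ[ℂ] y) = x w • y := by
  simp [leftCoeff]

theorem leftCoeff_cons (k : ι) (w : List ι) (t : TX ι ⊗[ℂ] TX ι) :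
    leftCoeff (k :: w) t = leftCoeff w ((leftDer k).rTensor (TX ι) t) := by
  induction t with
  | zero => simp
  | tmul x y => simp
  | add x y hx hy => simp only [map_add, hx, hy]

theorem ext_leftCoeff {s t : TX ι ⊗[ℂ] TX ι} (h : ∀ w, leftCoeff w s = leftCoeff w t) :
    s = t := by
  apply (TensorProduct.finsuppScalarLeft ℂ (TX ι) (List ι)).injective
  ext1 w
  have key : ∀ t : TX ι ⊗[ℂ] TX ι,
      TensorProduct.finsuppScalarLeft ℂ (TX ι) (List ι) t w = leftCoeff w t := by
    intro t
    induction t with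
    | zero => simp
    | tmul x y => simp [TensorProduct.finsuppScalarLeft_apply_tmul_apply]
    | add x y hx hy => simp only [map_add, Finsupp.add_apply, hx, hy]
  rw [key, key, h]

@[simp] theorem comul_word (w : List ι) :
    comul (word w) = splitSum (fun u v => word u ⊗ₜ[ℂ] word v) w := by
  simp [comul, splitSum]

theorem rTensor_leftDer_comul (k : ι) (x : TX ι) :
    (leftDer k).rTensor (TX ι) (comul x) = comul (leftDer k x) := by
  induction x using induction_word with
  | hw w =>
    rw [comul_word, map_splitSum]
    cases w with
    | nil => simp
    | cons j w =>
      rw [splitSum_cons]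
      simp only [LinearMap.rTensor_tmul, leftDer_word_nil, TensorProduct.zero_tmul, zero_add,
        leftDer_word_cons]
      split_ifs
      · rw [comul_word]
      · simp [splitSum]
  | hadd x y hx hy => simp only [map_add, hx, hy]
  | hsmul r x hx => simp only [map_smul, hx]

theorem leftCoeff_nil_comul (x : TX ι) : leftCoeff [] (comul x) = x := by
  induction x using induction_word with
  | hw w =>
    rw [comul_word, map_splitSum]
    cases w with
    | nil => simp
    | cons j w => simp [splitSum_cons]; simp [splitSum]
  | hadd x y hx hy => simp only [map_add, hx, hy]
  | hsmul r x hx => simp only [map_smul, hx]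

theorem map_diag_comul (θ : ι → ℂ) (x : TX ι) :
    TensorProduct.map (diag θ) (diag θ) (comul x) = comul (diag θ x) := by
  induction x using induction_word with
  | hw w =>
    rw [comul_word, map_splitSum, diag_word, map_smul, comul_word, ← splitSum_smul]
    refine splitSum_congr fun u v huv => ?_
    subst huv
    simp [TensorProduct.smul_tmul, TensorProduct.tmul_smul, smul_smul, mul_comm]
  | hadd x y hx hy => simp only [map_add, hx, hy]
  | hsmul r x hx => simp only [map_smul, hx]

theorem comul_comul (x : TX ι) :
    TensorProduct.assoc ℂ (TX ι) (TX ι) (TX ι) (comul.rTensor (TX ι) (comul x)) =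
      comul.lTensor (TX ι) (comul x) := by
  induction x using induction_word with
  | hw w =>
    induction w with
    | nil => simp
    | cons i w ih =>
      have h1 : ∀ w, comul (word (i :: w)) = word [] ⊗ₜ[ℂ] word (i :: w) +
          (cons i).rTensor (TX ι) (comul (word w)) := by
        intro w
        rw [comul_word, splitSum_cons, comul_word, map_splitSum]
        simp
      have h2 : ∀ x : TX ι, comul (cons i x) = word [] ⊗ₜ[ℂ] cons i x +
          (cons i).rTensor (TX ι) (comul x) := by
        intro x
        induction x using induction_word with
        | hw w => rw [cons_word, h1]
        | hadd x y hx hy => simp only [map_add, hx, hy, TensorProduct.tmul_add]; abel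
        | hsmul r x hx => simp only [map_smul, hx, TensorProduct.tmul_smul, smul_add]
      have h3 : ∀ t : TX ι ⊗[ℂ] TX ι,
          TensorProduct.assoc ℂ (TX ι) (TX ι) (TX ι)
            (comul.rTensor (TX ι) ((cons i).rTensor (TX ι) t)) =
          word [] ⊗ₜ[ℂ] (cons i).rTensor (TX ι) t +
            (cons i).rTensor (TX ι ⊗[ℂ] TX ι) (TensorProduct.assoc ℂ (TX ι) (TX ι) (TX ι)
              (comul.rTensor (TX ι) t)) := by
        intro t
        induction t with
        | zero => simp
        | tmul x y =>
          simp only [LinearMap.rTensor_tmul, h2, TensorProduct.add_tmul, map_add,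
            TensorProduct.assoc_tmul]
          congr 1
          generalize comul x = s
          induction s with
          | zero => simp
          | tmul x y => simp
          | add x y hx hy => simp only [map_add, hx, hy, TensorProduct.add_tmul]
        | add x y hx hy => simp only [map_add, hx, hy, TensorProduct.tmul_add]; abel
      have h4 : ∀ t : TX ι ⊗[ℂ] TX ι,
          comul.lTensor (TX ι) ((cons i).rTensor (TX ι) t) =
            (cons i).rTensor (TX ι ⊗[ℂ] TX ι) (comul.lTensor (TX ι) t) := by
        intro t
        induction t with
        | zero => simp
        | tmul x y => simp
        | add x y hx hy => simp only [map_add, hx, hy]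
      rw [h1, map_add, map_add, map_add, h3, ih, h4]
      simp only [LinearMap.rTensor_tmul, LinearMap.lTensor_tmul]
      rw [h1]
      simp only [comul_word, splitSum_nil, TensorProduct.assoc_tmul, TensorProduct.tmul_add]
      abel
  | hadd x y hx hy => simp only [map_add, hx, hy]
  | hsmul r x hx => simp only [map_smul, hx]

/-- `(u ⊗ v) ⊗ (u' ⊗ v') ↦ χ(v, u') u * u' ⊗ v ▸ v'` on `(u ⊗ v) ⊗ Δ y`, for words `u`, `v`. -/
theorem ydLeft_word (h : List ι) (y : TX ι) : ydLeft c a b (word h ⊗ₜ[ℂ] y) =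
    splitSum (fun u v => TensorProduct.map (mul c (word u)) (act c a b (word v))
      ((diag fun j => chi c v [j]).rTensor (TX ι) (comul y))) h := by
  induction y using induction_word with
  | hw w =>
    simp only [ydLeft, LinearMap.comp_apply, TensorProduct.map_tmul, coact, comul_word,
      splitSum, TensorProduct.sum_tmul, TensorProduct.tmul_sum, map_sum]
    rw [Finset.sum_comm]
    refine Finset.sum_congr rfl fun k _ => Finset.sum_congr rfl fun l _ => ?_
    simp only [LinearEquiv.coe_coe, TensorProduct.assoc_tmul, LinearMap.lTensor_tmul,
      LinearMap.comp_apply, TensorProduct.assoc_symm_tmul, LinearMap.rTensor_tmul, braid,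
      TensorProduct.lift.tmul, bilin_word, charOf_one, mul_one, diag_word,
      TensorProduct.smul_tmul', map_smul, TensorProduct.map_tmul,
      ← chi_eq_charOf_right]
  | hadd x y hx hy => simp only [map_add, TensorProduct.tmul_add, hx, hy, ← splitSum_add]
  | hsmul r x hx => simp only [map_smul, TensorProduct.tmul_smul, hx, ← splitSum_smul]

theorem rTensor_leftDer_ydLeft (k : ι) (x y : TX ι) :
    (leftDer k).rTensor (TX ι) (ydLeft c a b (x ⊗ₜ[ℂ] y)) =
      ydLeft c a b (leftDer k x ⊗ₜ[ℂ] y) + ydLeft c a b (passR c k x ⊗ₜ[ℂ] leftDer k y) := by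
  induction x using induction_word with
  | hw h =>
    have key : ∀ (u v : List ι) (t : TX ι ⊗[ℂ] TX ι),
        (leftDer k).rTensor (TX ι) (TensorProduct.map (mul c (word u)) (act c a b (word v))
          ((diag fun j => chi c v [j]).rTensor (TX ι) t)) =
        TensorProduct.map (mul c (leftDer k (word u))) (act c a b (word v))
          ((diag fun j => chi c v [j]).rTensor (TX ι) t) +
        chi c (u ++ v) [k] • TensorProduct.map (mul c (word u)) (act c a b (word v))
          ((diag fun j => chi c v [j]).rTensor (TX ι) ((leftDer k).rTensor (TX ι) t)) := by
      intro u v t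
      induction t with
      | zero => simp
      | tmul x y =>
        simp only [LinearMap.rTensor_tmul, TensorProduct.map_tmul, leftDer_mul,
          TensorProduct.add_tmul, leftDer_diag, diag_word, map_smul, LinearMap.smul_apply,
          TensorProduct.smul_tmul', smul_smul, chi_singleton_right, charOf_append, mul_comm]
      | add x y hx hy => simp only [map_add, hx, hy, smul_add]; abel
    rw [ydLeft_word, map_splitSum]
    simp only [key, splitSum_add]
    congr 1
    · cases h with
      | nil => simp
      | cons j h =>
        rw [splitSum_cons]
        simp only [leftDer_word_nil, leftDer_word_cons, map_zero, TensorProduct.map_zero_left,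
          LinearMap.zero_apply, zero_add]
        split_ifs with hj
        · rw [ydLeft_word]
        · simp [splitSum]
    · rw [diag_word, ← TensorProduct.smul_tmul', map_smul, ydLeft_word, ← splitSum_smul]
      refine splitSum_congr fun u v huv => ?_
      rw [huv, rTensor_leftDer_comul, chi_singleton_right]
  | hadd x y hx hy => simp only [map_add, TensorProduct.add_tmul, hx, hy]; abel
  | hsmul r x hx =>
    simp only [map_smul, ← TensorProduct.smul_tmul', hx, smul_add]

theorem leftCoeff_nil_ydLeft (x y : TX ι) :
    leftCoeff [] (ydLeft c a b (x ⊗ₜ[ℂ] y)) = act c a b x y := by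
  induction x using induction_word with
  | hw h =>
    have key : ∀ (u v : List ι) (t : TX ι ⊗[ℂ] TX ι),
        leftCoeff [] (TensorProduct.map (mul c (word u)) (act c a b (word v))
          ((diag fun j => chi c v [j]).rTensor (TX ι) t)) =
        word u [] • act c a b (word v) (leftCoeff [] t) := by
      intro u v t
      induction t with
      | zero => simp
      | tmul x y => simp [mul_apply_nil, diag_apply, smul_smul]
      | add x y hx hy => simp only [map_add, hx, hy, smul_add]
    rw [ydLeft_word, map_splitSum]
    simp only [key, leftCoeff_nil_comul]
    cases h with
    | nil => simp
    | cons j h => simp [splitSum_cons]; simp [splitSum]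
  | hadd x y hx hy => simp only [map_add, TensorProduct.add_tmul, hx, hy, LinearMap.add_apply]
  | hsmul r x hx =>
    simp only [map_smul, ← TensorProduct.smul_tmul', hx, LinearMap.smul_apply]

/-- `x ⊗ y ↦ χ(y, v) b(v) x * v ⊗ y`. -/
def mulPast (v : TX ι) : TX ι ⊗[ℂ] TX ι →ₗ[ℂ] TX ι ⊗[ℂ] TX ι :=
  LinearMap.rTensor (TX ι) (TensorProduct.lift (mul c)) ∘ₗ
  (TensorProduct.assoc ℂ (TX ι) (TX ι) (TX ι)).symm.toLinearMap ∘ₗ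
  LinearMap.lTensor (TX ι) (braid c 1 b) ∘ₗ
  (TensorProduct.assoc ℂ (TX ι) (TX ι) (TX ι)).toLinearMap ∘ₗ
  (TensorProduct.mk ℂ (TX ι ⊗[ℂ] TX ι) (TX ι)).flip v

theorem mulPast_word (v : List ι) (x y : TX ι) : mulPast c b (word v) (x ⊗ₜ[ℂ] y) =
    charOf b v • (mul c x (word v) ⊗ₜ[ℂ] diag (fun j => chi c [j] v) y) := by
  induction y using induction_word with
  | hw w =>
    have : chi c w v = charOf (fun j => charOf (c j) v) w := by
      simpa using chi_eq_charOf_left c w v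
    simp [mulPast, braid, this, smul_smul, mul_comm, TensorProduct.tmul_smul]
  | hadd x y hx hy => simp only [map_add, TensorProduct.tmul_add, hx, hy, smul_add]
  | hsmul r x hx => simp only [map_smul, TensorProduct.tmul_smul, hx, smul_comm r]

theorem mulPast_add (x y : TX ι) : mulPast c b (x + y) = mulPast c b x + mulPast c b y := by
  exact LinearMap.ext fun t => by simp [mulPast]

theorem mulPast_smul (r : ℂ) (x : TX ι) : mulPast c b (r • x) = r • mulPast c b x := by
  exact LinearMap.ext fun t => by simp [mulPast]

theorem rTensor_leftDer_mulPast (k : ι) (v x : TX ι) :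
    (leftDer k).rTensor (TX ι) (mulPast c b v (comul x)) =
      mulPast c b v (comul (leftDer k x)) +
        b k • mulPast c b (leftDer k v) (comul (passR c k x)) := by
  induction v using induction_word with
  | hw v =>
    rw [← rTensor_leftDer_comul, ← map_diag_comul]
    generalize comul x = t
    induction t with
    | zero => simp
    | tmul x y =>
      simp only [mulPast_word, LinearMap.rTensor_tmul, map_smul, leftDer_mul,
        TensorProduct.add_tmul, smul_add, TensorProduct.map_tmul]
      congr 1
      cases v with
      | nil => simp [mulPast]
      | cons j v =>
        simp only [leftDer_word_cons]
        split_ifs with h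
        · subst h
          have : (fun i => chi c [i] (j :: v)) = fun i => chi c [i] v * c i j := by
            ext i; simp; ring
          rw [mulPast_word, diag_diag, smul_smul, charOf_cons, this]
        · simp [mulPast]
    | add x y hx hy => simp only [map_add, hx, hy, smul_add]; abel
  | hadd x y hx hy =>
    simp only [map_add, mulPast_add, LinearMap.add_apply, hx, hy, smul_add]; abel
  | hsmul r x hx =>
    simp only [map_smul, mulPast_smul, LinearMap.smul_apply, hx, smul_add, smul_comm r]

theorem ydRight_word (h : List ι) (y : TX ι) : ydRight c a b (word h ⊗ₜ[ℂ] y) =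
    splitSum (fun u v => charOf a v • mulPast c b (word v)
      (comul (act c a b (word u) (diag (fun j => chi c v [j]) y)))) h := by
  induction y using induction_word with
  | hw w =>
    simp only [ydRight, LinearMap.comp_apply, LinearMap.rTensor_tmul, comul_word,
      splitSum, TensorProduct.sum_tmul, map_sum]
    refine Finset.sum_congr rfl fun k _ => ?_
    simp only [LinearEquiv.coe_coe, TensorProduct.assoc_tmul, LinearMap.lTensor_tmul,
      LinearMap.comp_apply, TensorProduct.assoc_symm_tmul, LinearMap.rTensor_tmul, braid,
      TensorProduct.lift.tmul, bilin_word, charOf_one, mul_one, diag_word,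
      TensorProduct.smul_tmul', map_smul, TensorProduct.tmul_smul, smul_smul,
      ← chi_eq_charOf_right, mul_comm (charOf a _), mulPast, coact, LinearMap.smul_apply,
      LinearMap.flip_apply, TensorProduct.mk_apply]
    rw [← TensorProduct.smul_tmul']
    simp only [map_smul]
  | hadd x y hx hy =>
    simp only [map_add, TensorProduct.tmul_add, hx, hy, ← splitSum_add, smul_add]
  | hsmul r x hx =>
    simp only [map_smul, TensorProduct.tmul_smul, hx, ← splitSum_smul, smul_comm r]

/-- The recursion is that of `ydLeft`. The rule for the action and the rule for the final product
yield two further sums, which cancel. -/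
theorem rTensor_leftDer_ydRight (k : ι) (x y : TX ι) :
    (leftDer k).rTensor (TX ι) (ydRight c a b (x ⊗ₜ[ℂ] y)) =
      ydRight c a b (leftDer k x ⊗ₜ[ℂ] y) + ydRight c a b (passR c k x ⊗ₜ[ℂ] leftDer k y) := by
  induction x using induction_word with
  | hw h =>
    have key : (leftDer k).rTensor (TX ι) (ydRight c a b (word h ⊗ₜ[ℂ] y)) =
        splitSum (fun u v => charOf a v • mulPast c b (word v)
          (comul (act c a b (leftDer k (word u)) (diag (fun j => chi c v [j]) y)))) h +
        splitSum (fun u v => charOf a v • mulPast c b (word v)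
          (comul (act c a b (passR c k (word u))
            (leftDer k (diag (fun j => chi c v [j]) y))))) h +
        (-1 : ℂ) • splitSum (fun u v => (charOf a v * (a k * b k)) • mulPast c b (word v)
          (comul (act c a b (rightDer c k (word u))
            (passRL c k (diag (fun j => chi c v [j]) y))))) h +
        splitSum (fun u v => (charOf a v * b k) • mulPast c b (leftDer k (word v))
          (comul (act c a b (passR c k (word u))
            (passR c k (diag (fun j => chi c v [j]) y))))) h := by
      rw [ydRight_word, map_splitSum, ← splitSum_smul, ← splitSum_add, ← splitSum_add,
        ← splitSum_add]
      refine splitSum_congr fun u v _ => ?_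
      have hD : ∀ x y, leftDer k (act c a b x y) = act c a b (leftDer k x) y +
          act c a b (passR c k x) (leftDer k y) +
            (-1 * (a k * b k)) • act c a b (rightDer c k x) (passRL c k y) := by
        intro x y
        rw [leftDer_act, sub_eq_add_neg, neg_one_mul, neg_smul]
      simp only [map_smul, rTensor_leftDer_mulPast, hD, map_add, smul_add,
        diag_act, smul_smul]
      rw [mul_left_comm]
    -- In the first sum `k` is the last letter of `u`, in the second the first letter of `v`;
    -- shifting the cut across `k` identifies them, scalars included.
    have cancel : splitSum (fun u v => (charOf a v * (a k * b k)) • mulPast c b (word v)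
          (comul (act c a b (rightDer c k (word u))
            (passRL c k (diag (fun j => chi c v [j]) y))))) h =
        splitSum (fun u v => (charOf a v * b k) • mulPast c b (leftDer k (word v))
          (comul (act c a b (passR c k (word u))
            (passR c k (diag (fun j => chi c v [j]) y))))) h := by
      have := splitSum_shift k (fun u v => (charOf a v * (a k * b k) * chi c u [k]) •
        mulPast c b (word v) (comul (act c a b (word u)
          (passRL c k (diag (fun j => chi c v [j]) y))))) h
      refine (splitSum_congr fun u v _ => ?_).trans (this.trans (splitSum_congr fun u v _ => ?_))
      · rw [rightDer_word]
        split_ifs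
        · simp only [map_smul, LinearMap.smul_apply, smul_smul]
        · simp
      · symm
        rw [leftDer_word]
        split_ifs with hv
        · cases v with
          | nil => simp at hv
          | cons j v =>
            obtain rfl : j = k := by simpa using hv
            simp only [diag_word, map_smul, LinearMap.smul_apply, smul_smul, List.tail_cons,
              diag_diag, charOf_cons, ← chi_singleton_right]
            have : (fun i => c i j * chi c (j :: v) [i]) =
                fun i => c i j * c j i * chi c v [i] := by
              ext i; simp; ring
            rw [this]
            congr 1
            ring
        · simp [mulPast]
    have neg_add : ∀ t : TX ι ⊗[ℂ] TX ι, (-1 : ℂ) • t + t = 0 := fun t => by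
      have := add_smul (-1 : ℂ) 1 t
      rw [one_smul] at this
      rw [← this, neg_add_cancel, zero_smul]
    rw [key, cancel, add_assoc, neg_add, add_zero]
    refine congrArg₂ (· + ·) ?_ ?_
    · cases h with
      | nil => simp
      | cons j h =>
        rw [splitSum_cons]
        simp only [leftDer_word_nil, leftDer_word_cons, map_zero, LinearMap.zero_apply, smul_zero,
          zero_add]
        split_ifs with hj
        · rw [ydRight_word]
        · simp [splitSum]
    · rw [diag_word, ← TensorProduct.smul_tmul', map_smul, ydRight_word, ← splitSum_smul]
      refine splitSum_congr fun u v huv => ?_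
      subst huv
      simp only [leftDer_diag, diag_word, map_smul, LinearMap.smul_apply, smul_smul,
        charOf_append, chi_singleton_right]
      congr 1; ring
  | hadd x y hx hy => simp only [map_add, TensorProduct.add_tmul, hx, hy]; abel
  | hsmul r x hx =>
    simp only [map_smul, ← TensorProduct.smul_tmul', hx, smul_add]

theorem leftCoeff_nil_ydRight (x y : TX ι) :
    leftCoeff [] (ydRight c a b (x ⊗ₜ[ℂ] y)) = act c a b x y := by
  induction x using induction_word with
  | hw h =>
    have key : ∀ (v : List ι) (t : TX ι ⊗[ℂ] TX ι),
        leftCoeff [] (mulPast c b (word v) t) =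
          (charOf b v * word v []) • diag (fun j => chi c [j] v) (leftCoeff [] t) := by
      intro v t
      induction t with
      | zero => simp
      | tmul x y => simp [mulPast_word, mul_apply_nil, smul_smul]; ring_nf
      | add x y hx hy => simp only [map_add, hx, hy, smul_add]
    rw [ydRight_word, map_splitSum]
    simp only [map_smul, key, leftCoeff_nil_comul]
    have h1 : (fun _ => 1 : ι → ℂ) = 1 := rfl
    induction h using List.reverseRecOn with
    | nil => simp [h1]
    | append_singleton h j _ =>
      rw [splitSum_concat]
      have hz : ∀ v : List ι, word (v ++ [j]) [] = (0 : ℂ) := fun v => by simp [word]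
      simp only [hz, mul_zero, zero_smul, smul_zero]
      rw [splitSum, Finset.sum_const_zero, zero_add]
      simp [h1]
  | hadd x y hx hy => simp only [map_add, TensorProduct.add_tmul, hx, hy, LinearMap.add_apply]
  | hsmul r x hx =>
    simp only [map_smul, ← TensorProduct.smul_tmul', hx, LinearMap.smul_apply]

theorem ydLeft_eq_ydRight (x y : TX ι) :
    ydLeft c a b (x ⊗ₜ[ℂ] y) = ydRight c a b (x ⊗ₜ[ℂ] y) := by
  refine ext_leftCoeff fun w => ?_
  induction w generalizing x y with
  | nil => rw [leftCoeff_nil_ydLeft, leftCoeff_nil_ydRight]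
  | cons k w ih =>
    rw [leftCoeff_cons, leftCoeff_cons, rTensor_leftDer_ydLeft, rTensor_leftDer_ydRight, map_add,
      map_add, ih, ih]

end

end NicholsYD

namespace NicholsYD

noncomputable section

set_option linter.unusedSectionVars false

variable {ι : Type} [DecidableEq ι] (c : Matrix ι ι ℂ) (a b : ι → ℂ)

/-! ### The Nichols algebra is generated by the letters -/

/-- The shuffle product `F i₁ * (F i₂ * ⋯)`. -/
def letterProd : List ι → TX ι
  | [] => word []
  | i :: w => mul c (word [i]) (letterProd w)

/-- The permutation of `Fin (n + 1)` that sends `0` to `t` and acts as `σ` on the other elements,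
in their order. -/
def consPerm {n : ℕ} (t : Fin (n + 1)) (σ : Equiv.Perm (Fin n)) : Equiv.Perm (Fin (n + 1)) :=
  (finSuccEquiv' 0).trans ((Equiv.optionCongr σ).trans (finSuccEquiv' t).symm)

@[simp] theorem consPerm_zero {n : ℕ} (t : Fin (n + 1)) (σ : Equiv.Perm (Fin n)) :
    consPerm t σ 0 = t := by
  simp [consPerm]

@[simp] theorem consPerm_succ {n : ℕ} (t : Fin (n + 1)) (σ : Equiv.Perm (Fin n)) (s : Fin n) :
    consPerm t σ s.succ = t.succAbove (σ s) := by
  simp only [consPerm, Equiv.trans_apply]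
  rw [← Fin.succAbove_zero, finSuccEquiv'_succAbove]
  simp

theorem consPerm_bijective {n : ℕ} :
    Function.Bijective fun x : Fin (n + 1) × Equiv.Perm (Fin n) => consPerm x.1 x.2 := by
  rw [Fintype.bijective_iff_injective_and_card]
  constructor
  · rintro ⟨t, σ⟩ ⟨t', σ'⟩ h
    simp only at h
    have h0 : t = t' := by simpa using congrArg (fun e : Equiv.Perm (Fin (n + 1)) => e 0) h
    subst h0
    congr 1
    ext1 s
    have := congrArg (fun e : Equiv.Perm (Fin (n + 1)) => e s.succ) h
    simpa using this
  · simp [Fintype.card_perm, Nat.factorial_succ]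

/-- The braided symmetrization of the word `f 0, …, f (n - 1)`. -/
def symmetrize {n : ℕ} (f : Fin n → ι) : TX ι :=
  ∑ σ : Equiv.Perm (Fin n),
    (∏ i : Fin n, ∏ j : Fin n, if i < j ∧ σ j < σ i then c (f i) (f j) else 1) •
      word (List.ofFn fun k => f (σ.symm k))

theorem mul_letter_ofFn (i : ι) {n : ℕ} (g : Fin n → ι) :
    mul c (word [i]) (word (List.ofFn g)) = ∑ t : Fin (n + 1),
      (∏ s : Fin n, if s.castSucc < t then c i (g s) else 1) •
        word (List.ofFn (t.insertNth (α := fun _ => ι) i g)) := by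
  induction n with
  | zero => simp
  | succ n ih =>
    rw [List.ofFn_succ, mul_word_cons, mul_word_nil_left, ih, Fin.sum_univ_succ (n := n + 1),
      cons_word]
    congr 1
    · simp [List.ofFn_succ]
    · rw [map_sum, Finset.smul_sum]
      refine Finset.sum_congr rfl fun t _ => ?_
      rw [map_smul, cons_word, smul_smul, Fin.prod_univ_succ]
      have h1 : List.ofFn (t.succ.insertNth (α := fun _ => ι) i g) =
          g 0 :: List.ofFn (t.insertNth (α := fun _ => ι) i fun s => g s.succ) := by
        conv_lhs => rw [← Fin.cons_self_tail g]
        rw [Fin.insertNth_succ_cons, List.ofFn_cons]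
        rfl
      rw [h1]
      simp [Fin.succ_pos]

/-- A permutation of `n + 1` factors is the target `t` of the first factor together with a
permutation of the others. The inversions that involve the first factor give the coefficient with
which the shuffle product by `F i` inserts `i` at position `t`. -/
theorem symmetrize_cons (i : ι) {n : ℕ} (f : Fin n → ι) :
    symmetrize c (Fin.cons i f : Fin (n + 1) → ι) = mul c (word [i]) (symmetrize c f) := by
  rw [symmetrize, ← consPerm_bijective.sum_comp, Fintype.sum_prod_type_right, symmetrize, map_sum]
  refine Finset.sum_congr rfl fun σ _ => ?_
  rw [map_smul, mul_letter_ofFn, Finset.smul_sum]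
  refine Finset.sum_congr rfl fun t _ => ?_
  rw [smul_smul]
  congr 1
  · rw [Fin.prod_univ_succ, mul_comm]
    congr 1
    · refine Finset.prod_congr rfl fun s _ => ?_
      rw [Fin.prod_univ_succ]
      simp
    · rw [Fin.prod_univ_succ,
        ← Equiv.prod_comp σ fun s => if s.castSucc < t then c i (f (σ.symm s)) else 1]
      simp [Fin.succAbove_lt_iff_castSucc_lt]
  · congr 2
    ext k
    refine Fin.succAboveCases t ?_ (fun s => ?_) k
    · have : (consPerm t σ).symm t = 0 := by rw [Equiv.symm_apply_eq]; simp
      simp [this]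
    · have : (consPerm t σ).symm (t.succAbove s) = (σ.symm s).succ := by
        rw [Equiv.symm_apply_eq]; simp
      simp [this]

theorem symmetrizer_word (w : List ι) : symmetrizer c (word w) = letterProd c w := by
  have key : ∀ w : List ι, symmetrize c w.get = letterProd c w := by
    intro w
    induction w with
    | nil => simp [symmetrize, letterProd]
    | cons i w ih =>
      have : (i :: w).get = (Fin.cons i w.get : Fin (w.length + 1) → ι) := by
        ext k; refine Fin.cases ?_ (fun s => ?_) k <;> simp
      rw [letterProd, ← ih, ← symmetrize_cons, ← this]
  rw [← key, symmetrizer, lin_word]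
  rfl

theorem nichols_eq_span : nichols c = Submodule.span ℂ (Set.range (letterProd c)) := by
  apply le_antisymm
  · rintro _ ⟨x, rfl⟩
    induction x using induction_word with
    | hw w => rw [symmetrizer_word]; exact Submodule.subset_span ⟨w, rfl⟩
    | hadd x y hx hy => rw [map_add]; exact add_mem hx hy
    | hsmul r x hx => rw [map_smul]; exact Submodule.smul_mem _ _ hx
  · rw [Submodule.span_le]
    rintro _ ⟨w, rfl⟩
    exact ⟨word w, symmetrizer_word c w⟩

theorem letterProd_mem (w : List ι) : letterProd c w ∈ nichols c := by
  rw [nichols_eq_span]; exact Submodule.subset_span ⟨w, rfl⟩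

theorem word_nil_mem_nichols : word [] ∈ nichols c := letterProd_mem c []

theorem letter_mem_nichols (i : ι) : word [i] ∈ nichols c := by
  simpa [letterProd] using letterProd_mem c [i]

theorem nichols_induction {P : (x : TX ι) → x ∈ nichols c → Prop} {x : TX ι}
    (hx : x ∈ nichols c) (hw : ∀ w, P (letterProd c w) (letterProd_mem c w))
    (hadd : ∀ x y hx hy, P x hx → P y hy → P (x + y) (add_mem hx hy))
    (hsmul : ∀ (r : ℂ) x hx, P x hx → P (r • x) (Submodule.smul_mem _ r hx)) : P x hx := by
  have key : ∃ h : x ∈ nichols c, P x h := by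
    rw [nichols_eq_span] at hx
    induction hx using Submodule.span_induction with
    | mem x h => obtain ⟨w, rfl⟩ := h; exact ⟨_, hw w⟩
    | zero => exact zero_smul ℂ (word [] : TX ι) ▸ ⟨_, hsmul 0 _ _ (hw [])⟩
    | add x y _ _ hx hy => exact ⟨_, hadd x y _ _ hx.2 hy.2⟩
    | smul r x _ hx => exact ⟨_, hsmul r x _ hx.2⟩
  exact key.2

theorem diag_letterProd (θ : ι → ℂ) (w : List ι) :
    diag θ (letterProd c w) = charOf θ w • letterProd c w := by
  induction w with
  | nil => simp [letterProd]
  | cons i w ih => simp [letterProd, diag_mul, ih, smul_smul, mul_comm]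

theorem letterProd_append (u w : List ι) :
    letterProd c (u ++ w) = mul c (letterProd c u) (letterProd c w) := by
  induction u with
  | nil => simp [letterProd]
  | cons i u ih => simp [letterProd, ih, mul_assoc']

theorem mul_mem_nichols {x y : TX ι} (hx : x ∈ nichols c) (hy : y ∈ nichols c) :
    mul c x y ∈ nichols c := by
  induction hx using nichols_induction with
  | hw u =>
    induction hy using nichols_induction with
    | hw w => rw [← letterProd_append]; exact letterProd_mem c _
    | hadd x y _ _ hx hy => rw [map_add]; exact add_mem hx hy
    | hsmul r x _ hx => rw [map_smul]; exact Submodule.smul_mem _ _ hx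
  | hadd x y _ _ hx hy => rw [map_add]; exact add_mem hx hy
  | hsmul r x _ hx => rw [map_smul]; exact Submodule.smul_mem _ _ hx

theorem diag_mem_nichols (θ : ι → ℂ) {x : TX ι} (hx : x ∈ nichols c) : diag θ x ∈ nichols c := by
  induction hx using nichols_induction with
  | hw u => rw [diag_letterProd]; exact Submodule.smul_mem _ _ (letterProd_mem c u)
  | hadd x y _ _ hx hy => rw [map_add]; exact add_mem hx hy
  | hsmul r x _ hx => rw [map_smul]; exact Submodule.smul_mem _ _ hx

theorem act_letter (i : ι) (x : TX ι) : act c a b (word [i]) x =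
    mul c (word [i]) x - (a i * b i) • mul c (diag (fun j => chi c [i] [j]) x) (word [i]) := by
  have h1 : (fun _ => 1 : ι → ℂ) = 1 := rfl
  have h2 : antipode c (word [i]) = - word [i] := by simp [antipode, halfTwist]
  rw [act_word, splitSum_cons, splitSum_nil, h2]
  simp [h1]
  abel

theorem act_mem_nichols {h x : TX ι} (hh : h ∈ nichols c) (hx : x ∈ nichols c) :
    act c a b h x ∈ nichols c := by
  induction hh using nichols_induction with
  | hw w =>
    induction w with
    | nil => simpa [letterProd] using hx
    | cons i w ih =>
      rw [letterProd, mul_act, act_letter]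
      exact sub_mem (mul_mem_nichols c (letter_mem_nichols c i) ih) (Submodule.smul_mem _ _
        (mul_mem_nichols c (diag_mem_nichols c _ ih) (letter_mem_nichols c i)))
  | hadd x y _ _ hx hy => rw [map_add]; exact add_mem hx hy
  | hsmul r x _ hx => rw [map_smul]; exact Submodule.smul_mem _ _ hx

/-! ### The submodule generated by the vertex -/

/-- `F i₁ ▸ (F i₂ ▸ ⋯ V)`. -/
def actProd : List ι → TX ι
  | [] => word []
  | i :: w => act c a b (word [i]) (actProd w)

theorem actProd_append (u w : List ι) :
    actProd c a b (u ++ w) = act c a b (letterProd c u) (actProd c a b w) := by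
  induction u with
  | nil => simp [letterProd]
  | cons i u ih => simp [letterProd, actProd, ih, mul_act]

theorem word_nil_mem_generated : word [] ∈ generatedByVertex c a b := by
  rw [generatedByVertex, Submodule.mem_sInf]
  exact fun U hU => hU.1

theorem act_mem_generated {h x : TX ι} (hh : h ∈ nichols c) (hx : x ∈ generatedByVertex c a b) :
    act c a b h x ∈ generatedByVertex c a b := by
  rw [generatedByVertex, Submodule.mem_sInf] at hx ⊢
  exact fun U hU => hU.2 h hh x (hx U hU)

theorem generated_eq_span :
    generatedByVertex c a b = Submodule.span ℂ (Set.range (actProd c a b)) := by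
  apply le_antisymm
  · refine sInf_le ⟨Submodule.subset_span ⟨[], rfl⟩, fun h hh m hm => ?_⟩
    induction hh using nichols_induction with
    | hw u =>
      induction hm using Submodule.span_induction with
      | mem x h =>
        obtain ⟨w, rfl⟩ := h
        rw [← actProd_append]
        exact Submodule.subset_span ⟨_, rfl⟩
      | zero => simp
      | add x y _ _ hx hy => rw [map_add]; exact add_mem hx hy
      | smul r x _ hx => rw [map_smul]; exact Submodule.smul_mem _ _ hx
    | hadd x y _ _ hx hy => rw [map_add]; exact add_mem hx hy
    | hsmul r x _ hx => rw [map_smul]; exact Submodule.smul_mem _ _ hx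
  · rw [Submodule.span_le]
    rintro _ ⟨w, rfl⟩
    induction w with
    | nil => exact word_nil_mem_generated c a b
    | cons i w ih => exact act_mem_generated c a b (letter_mem_nichols c i) ih

theorem actProd_mem (w : List ι) : actProd c a b w ∈ generatedByVertex c a b := by
  rw [generated_eq_span]; exact Submodule.subset_span ⟨w, rfl⟩

theorem generated_induction {P : (x : TX ι) → x ∈ generatedByVertex c a b → Prop} {x : TX ι}
    (hx : x ∈ generatedByVertex c a b) (hw : ∀ w, P (actProd c a b w) (actProd_mem c a b w))
    (hadd : ∀ x y hx hy, P x hx → P y hy → P (x + y) (add_mem hx hy))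
    (hsmul : ∀ (r : ℂ) x hx, P x hx → P (r • x) (Submodule.smul_mem _ r hx)) : P x hx := by
  have key : ∃ h : x ∈ generatedByVertex c a b, P x h := by
    rw [generated_eq_span] at hx
    induction hx using Submodule.span_induction with
    | mem x h => obtain ⟨w, rfl⟩ := h; exact ⟨_, hw w⟩
    | zero => exact zero_smul ℂ (word [] : TX ι) ▸ ⟨_, hsmul 0 _ _ (hw [])⟩
    | add x y _ _ hx hy => exact ⟨_, hadd x y _ _ hx.2 hy.2⟩
    | smul r x _ hx => exact ⟨_, hsmul r x _ hx.2⟩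
  exact key.2

theorem diag_actProd (θ : ι → ℂ) (w : List ι) :
    diag θ (actProd c a b w) = charOf θ w • actProd c a b w := by
  induction w with
  | nil => simp [actProd]
  | cons i w ih => simp [actProd, diag_act, ih, smul_smul, mul_comm]

theorem diag_mem_generated (θ : ι → ℂ) {x : TX ι} (hx : x ∈ generatedByVertex c a b) :
    diag θ x ∈ generatedByVertex c a b := by
  induction hx using generated_induction with
  | hw u => rw [diag_actProd]; exact Submodule.smul_mem _ _ (actProd_mem c a b u)
  | hadd x y _ _ hx hy => rw [map_add]; exact add_mem hx hy
  | hsmul r x _ hx => rw [map_smul]; exact Submodule.smul_mem _ _ hx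

theorem generated_le_nichols : generatedByVertex c a b ≤ nichols c :=
  sInf_le ⟨word_nil_mem_nichols c, fun _ hh _ hm => act_mem_nichols c a b hh hm⟩

theorem leftDer_letter_act (k i : ι) (x : TX ι) :
    leftDer k (act c a b (word [i]) x) =
      (if i = k then x - (a k * b k) • passRL c k x else 0) +
        c i k • act c a b (word [i]) (leftDer k x) := by
  have h : rightDer c k (word [i]) = if i = k then word [] else 0 := by
    simpa using rightDer_word_concat c k i []
  rw [leftDer_act, h, leftDer_word_cons]
  split_ifs <;> simp; abel

/-- By `leftDer_letter_act`, a derivation passes `F i ▸` up to a scalar and a diagonal operator, and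
the submodule is graded, hence stable under diagonal operators. -/
theorem leftDer_mem_generated (k : ι) {x : TX ι} (hx : x ∈ generatedByVertex c a b) :
    leftDer k x ∈ generatedByVertex c a b := by
  induction hx using generated_induction with
  | hw w =>
    induction w with
    | nil => simp [actProd]
    | cons i w ih =>
      rw [actProd, leftDer_letter_act]
      refine add_mem ?_ (Submodule.smul_mem _ _
        (act_mem_generated c a b (letter_mem_nichols c i) ih))
      split_ifs
      · exact sub_mem (actProd_mem c a b w) (Submodule.smul_mem _ _
          (diag_mem_generated c a b _ (actProd_mem c a b w)))
      · exact zero_mem _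
  | hadd x y _ _ hx hy => rw [map_add]; exact add_mem hx hy
  | hsmul r x _ hx => rw [map_smul]; exact Submodule.smul_mem _ _ hx

/-! ### Tensor products of subspaces -/

theorem tensorSub_induction {A B : Submodule ℂ (TX ι)} {M : Type} [AddCommMonoid M] [Module ℂ M]
    (f : TX ι ⊗[ℂ] TX ι →ₗ[ℂ] M) (S : Submodule ℂ M)
    (h : ∀ x ∈ A, ∀ y ∈ B, f (x ⊗ₜ[ℂ] y) ∈ S) {t : TX ι ⊗[ℂ] TX ι} (ht : t ∈ tensorSub A B) :
    f t ∈ S := by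
  obtain ⟨s, rfl⟩ := ht
  induction s with
  | zero => simp
  | tmul x y => exact h x x.2 y y.2
  | add x y hx hy => rw [map_add, map_add]; exact add_mem hx hy

theorem tmul_mem_tensorSub {A B : Submodule ℂ (TX ι)} {x y : TX ι} (hx : x ∈ A) (hy : y ∈ B) :
    x ⊗ₜ[ℂ] y ∈ tensorSub A B :=
  ⟨⟨x, hx⟩ ⊗ₜ ⟨y, hy⟩, rfl⟩

theorem map_mem_tensorSub {A B : Submodule ℂ (TX ι)} {f g : TX ι →ₗ[ℂ] TX ι}
    (hf : ∀ x ∈ A, f x ∈ A) (hg : ∀ x ∈ B, g x ∈ B) {t : TX ι ⊗[ℂ] TX ι}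
    (ht : t ∈ tensorSub A B) : TensorProduct.map f g t ∈ tensorSub A B :=
  tensorSub_induction _ _ (fun x hx y hy => tmul_mem_tensorSub (hf x hx) (hg y hy)) ht

theorem leftCoeff_mem {A B : Submodule ℂ (TX ι)} (w : List ι) {t : TX ι ⊗[ℂ] TX ι}
    (ht : t ∈ tensorSub A B) : leftCoeff w t ∈ B :=
  tensorSub_induction _ _
    (fun x _ y hy => by rw [leftCoeff_tmul]; exact B.smul_mem _ hy) ht

/-- This is the Yetter–Drinfeld axiom for `h = F i`, solved for the term containing the coaction of
`F i ▸ y`. It lets stability under the coaction be proved one letter at a time. -/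
theorem comul_act_letter (i : ι) (y : TX ι) : comul (act c a b (word [i]) y) =
    TensorProduct.map (mul c (word [i])) LinearMap.id (comul y) +
    TensorProduct.map (diag fun j => chi c [i] [j]) (act c a b (word [i])) (comul y) +
    (-(a i * b i)) • TensorProduct.map ((mul c).flip (word [i])) (diag fun j => chi c [j] [i])
      (comul (diag (fun j => chi c [i] [j]) y)) := by
  have h := ydLeft_eq_ydRight c a b (word [i]) y
  have h1 : (fun _ => 1 : ι → ℂ) = 1 := rfl
  have hp : ∀ (v : List ι), mulPast c b (word v) = charOf b v •
      TensorProduct.map ((mul c).flip (word v)) (diag fun j => chi c [j] v) := by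
    intro v
    apply TensorProduct.ext'
    intro x y
    simp [mulPast_word]
  have hd : diag (1 : ι → ℂ) = LinearMap.id := LinearMap.ext diag_one
  have hm : (mul c).flip (word []) = LinearMap.id := LinearMap.ext (mul_word_nil_right c)
  have hm' : mul c (word []) = LinearMap.id := LinearMap.ext (mul_word_nil_left c)
  have ha' : act c a b (word []) = LinearMap.id := LinearMap.ext (act_word_nil c a b)
  rw [ydLeft_word, ydRight_word, splitSum_cons, splitSum_nil, splitSum_cons, splitSum_nil] at h
  simp only [hp, charOf_nil, chi_nil_left, chi_nil_right, h1, hd, hm, hm', ha',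
    TensorProduct.map_id, LinearMap.rTensor_id, LinearMap.id_apply, one_smul,
    LinearMap.smul_apply, charOf_cons, mul_one, smul_smul] at h
  have h2 : ∀ t : TX ι ⊗[ℂ] TX ι, TensorProduct.map LinearMap.id (act c a b (word [i]))
      ((diag fun j => chi c [i] [j]).rTensor (TX ι) t) =
      TensorProduct.map (diag fun j => chi c [i] [j]) (act c a b (word [i])) t := by
    intro t
    induction t with
    | zero => simp
    | tmul x y => simp
    | add x y hx hy => simp only [map_add, hx, hy]
  rw [h2] at h
  have h3 : ∀ (r : ℂ) (t : TX ι ⊗[ℂ] TX ι), r • t + (-r) • t = 0 := fun r t => by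
    rw [← add_smul, add_neg_cancel, zero_smul]
  rw [add_comm (TensorProduct.map (mul c (word [i])) LinearMap.id (comul y)), h, add_right_comm,
    h3, zero_add]

theorem comul_mem_generated {x : TX ι} (hx : x ∈ generatedByVertex c a b) :
    comul x ∈ tensorSub (nichols c) (generatedByVertex c a b) := by
  induction hx using generated_induction with
  | hw w =>
    induction w with
    | nil =>
      simp only [actProd, comul_word, splitSum_nil]
      exact tmul_mem_tensorSub (word_nil_mem_nichols c) (word_nil_mem_generated c a b)
    | cons i w ih =>
      have hd := fun (θ : ι → ℂ) (x : TX ι) (hx : x ∈ nichols c) => diag_mem_nichols c θ hx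
      have hd' := fun (θ : ι → ℂ) (x : TX ι) (hx : x ∈ generatedByVertex c a b) =>
        diag_mem_generated c a b θ hx
      have hl := letter_mem_nichols c i
      rw [actProd, comul_act_letter]
      have hr : ∀ x ∈ nichols c, (mul c).flip (word [i]) x ∈ nichols c := fun x hx => by
        rw [LinearMap.flip_apply]
        exact mul_mem_nichols c hx hl
      refine add_mem (add_mem ?_ ?_) (Submodule.smul_mem _ _ ?_)
      · exact map_mem_tensorSub (fun x hx => mul_mem_nichols c hl hx) (fun x hx => hx) ih
      · exact map_mem_tensorSub (hd _) (fun x hx => act_mem_generated c a b hl hx) ih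
      · rw [← map_diag_comul]
        have h1 := map_mem_tensorSub (hd fun j => chi c [i] [j]) (hd' fun j => chi c [i] [j]) ih
        exact map_mem_tensorSub hr (hd' fun j => chi c [j] [i]) h1
  | hadd x y _ _ hx hy => rw [map_add]; exact add_mem hx hy
  | hsmul r x _ hx => rw [map_smul]; exact Submodule.smul_mem _ _ hx

theorem braid_tmul (w w' : List ι) {x y : TX ι} (hx : ∀ θ, diag θ x = charOf θ w • x)
    (hy : ∀ θ, diag θ y = charOf θ w' • y) :
    braid c a b (x ⊗ₜ[ℂ] y) = (chi c w w' * charOf a w * charOf b w') • (y ⊗ₜ[ℂ] x) := by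
  have h1 : ∀ (u : List ι) (y : TX ι), braid c a b (word u ⊗ₜ[ℂ] y) =
      charOf a u • (diag (fun j => chi c u [j] * b j) y ⊗ₜ[ℂ] word u) := by
    intro u y
    induction y using induction_word with
    | hw v =>
      simp only [braid, TensorProduct.lift.tmul, bilin_word, diag_word, charOf_mul,
        ← chi_eq_charOf_right, ← TensorProduct.smul_tmul', smul_smul]
      congr 1; ring
    | hadd x y hx hy =>
      simp only [map_add, TensorProduct.tmul_add, TensorProduct.add_tmul, hx, hy, smul_add]
    | hsmul r x hx =>
      simp only [map_smul, TensorProduct.tmul_smul, ← TensorProduct.smul_tmul', hx, smul_comm r]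
  have h2 : ∀ x : TX ι, braid c a b (x ⊗ₜ[ℂ] y) =
      charOf b w' • (y ⊗ₜ[ℂ] diag (fun j => chi c [j] w' * a j) x) := by
    intro x
    induction x using induction_word with
    | hw u =>
      rw [h1, hy, diag_word, charOf_mul, charOf_mul, ← chi_eq_charOf_right, ← chi_eq_charOf_left,
        ← TensorProduct.smul_tmul', TensorProduct.tmul_smul, smul_smul, smul_smul]
      congr 1; ring
    | hadd x y hx hy =>
      simp only [map_add, TensorProduct.tmul_add, TensorProduct.add_tmul, hx, hy, smul_add]
    | hsmul r x hx =>
      simp only [map_smul, TensorProduct.tmul_smul, ← TensorProduct.smul_tmul', hx, smul_comm r]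
  rw [h2, hx, charOf_mul, ← chi_eq_charOf_left, TensorProduct.tmul_smul, smul_smul]
  congr 1; ring

/-! ### Simplicity -/

/-- As long as some derivative is nonzero, replace the element by it: the maximal length of its
words drops. An element all of whose derivatives vanish is a multiple of the empty word. -/
theorem word_nil_mem_of_leftDer {W : Submodule ℂ (TX ι)}
    (hW : ∀ k, ∀ m ∈ W, leftDer k m ∈ W) {m : TX ι} (hm : m ∈ W) (h0 : m ≠ 0) :
    word [] ∈ W := by
  have key : ∀ n : ℕ, ∀ m ∈ W, m ≠ 0 → (∀ w, m w ≠ 0 → w.length ≤ n) → word [] ∈ W := by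
    have const : ∀ m ∈ W, m ≠ 0 → (∀ k, leftDer k m = 0) → word [] ∈ W := by
      intro m hm h0 hk
      have h1 : m = m [] • word [] := by
        refine ext_coeff fun w => ?_
        cases w with
        | nil => simp
        | cons k w => rw [← leftDer_apply, hk]; simp [word]
      have h2 : m [] ≠ 0 := fun h => h0 (by rw [h1, h, zero_smul])
      have h3 := W.smul_mem (m [])⁻¹ hm
      rw [h1] at h3
      simpa [smul_smul, h2] using h3
    intro n
    induction n with
    | zero =>
      intro m hm h0 hs
      refine const m hm h0 fun k => ext_coeff fun w => ?_
      by_contra h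
      simpa using hs (k :: w) h
    | succ n ih =>
      intro m hm h0 hs
      by_cases hk : ∀ k, leftDer k m = 0
      · exact const m hm h0 hk
      · push Not at hk
        obtain ⟨k, hk⟩ := hk
        exact ih _ (hW k m hm) hk fun w hw => by simpa using hs (k :: w) hw
  refine key (m.support.sup List.length) m hm h0 fun w hw => ?_
  exact Finset.le_sup (f := List.length) (Finsupp.mem_support_iff.mpr hw)

theorem isSimpleYetterDrinfeld_generated :
    IsSimpleYetterDrinfeld c a b (generatedByVertex c a b) where
  act_mem _ hh _ hm := act_mem_generated c a b hh hm
  coact_mem _ hm := comul_mem_generated c a b hm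
  le_nichols := generated_le_nichols c a b
  braid_left_mem t ht := by
    refine tensorSub_induction _ _ (fun x hx y hy => ?_) ht
    induction hx using nichols_induction with
    | hw u =>
      induction hy using generated_induction with
      | hw w =>
        rw [braid_tmul c a 1 u w (diag_letterProd c · u) (diag_actProd c a b · w)]
        exact Submodule.smul_mem _ _
          (tmul_mem_tensorSub (actProd_mem c a b w) (letterProd_mem c u))
      | hadd x y _ _ hx hy => rw [TensorProduct.tmul_add, map_add]; exact add_mem hx hy
      | hsmul r x _ hx =>
        rw [TensorProduct.tmul_smul, map_smul]; exact Submodule.smul_mem _ _ hx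
    | hadd x y _ _ hx hy => rw [TensorProduct.add_tmul, map_add]; exact add_mem hx hy
    | hsmul r x _ hx =>
      rw [← TensorProduct.smul_tmul', map_smul]; exact Submodule.smul_mem _ _ hx
  braid_right_mem t ht := by
    refine tensorSub_induction _ _ (fun y hy x hx => ?_) ht
    induction hx using nichols_induction with
    | hw u =>
      induction hy using generated_induction with
      | hw w =>
        rw [braid_tmul c 1 b w u (diag_actProd c a b · w) (diag_letterProd c · u)]
        exact Submodule.smul_mem _ _
          (tmul_mem_tensorSub (letterProd_mem c u) (actProd_mem c a b w))
      | hadd x y _ _ hx hy => rw [TensorProduct.add_tmul, map_add]; exact add_mem hx hy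
      | hsmul r x _ hx =>
        rw [← TensorProduct.smul_tmul', map_smul]; exact Submodule.smul_mem _ _ hx
    | hadd x y _ _ hx hy => rw [TensorProduct.tmul_add, map_add]; exact add_mem hx hy
    | hsmul r x _ hx =>
      rw [TensorProduct.tmul_smul, map_smul]; exact Submodule.smul_mem _ _ hx
  one_act m _ := act_word_nil c a b m
  mul_act g _ h _ m _ := mul_act c a b g h m
  counit_coact m _ := leftCoeff_nil_comul m
  coassoc m _ := comul_comul m
  compat h _ m _ := ydLeft_eq_ydRight c a b h m
  ne_bot h := by
    have := word_nil_mem_generated c a b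
    rw [h, Submodule.mem_bot] at this
    simpa using congrArg (fun x : TX ι => x []) this
  eq_bot_or_eq W hW hs := by
    by_cases h : W = ⊥
    · exact Or.inl h
    · refine Or.inr (le_antisymm hW ?_)
      obtain ⟨m, hm, h0⟩ := W.ne_bot_iff.mp h
      refine sInf_le ⟨word_nil_mem_of_leftDer (fun k m hm => ?_) hm h0, hs.act_mem⟩
      -- The derivative `leftDer k m` is the coefficient of the letter `k` in the left factor of the
      -- coaction of `m`.
      have := leftCoeff_mem [k] (hs.coact_mem m hm)
      rwa [coact, leftCoeff_cons, rTensor_leftDer_comul, leftCoeff_nil_comul] at this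

end

end NicholsYD

namespace NicholsYD

noncomputable section

set_option linter.unusedSectionVars false

/-! ### A quantum PBW basis -/

/-- The braiding matrix of type `A₂` at the parameter `s`. -/
def cartanA2 (s : ℂ) : Matrix (Fin 2) (Fin 2) ℂ := !![s ^ 2, s⁻¹; s⁻¹, s ^ 2]

@[simp] theorem cartanA2_zero_zero (s : ℂ) : cartanA2 s 0 0 = s ^ 2 := rfl
@[simp] theorem cartanA2_zero_one (s : ℂ) : cartanA2 s 0 1 = s⁻¹ := rfl
@[simp] theorem cartanA2_one_zero (s : ℂ) : cartanA2 s 1 0 = s⁻¹ := rfl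
@[simp] theorem cartanA2_one_one (s : ℂ) : cartanA2 s 1 1 = s ^ 2 := rfl

/-- The elements of multidegree `(m, n)`. -/
def weightSpace (m n : ℕ) : Submodule ℂ (TX (Fin 2)) where
  carrier := {x | ∀ θ : Fin 2 → ℂ, diag θ x = (θ 0 ^ m * θ 1 ^ n) • x}
  add_mem' hx hy θ := by rw [map_add, hx θ, hy θ, smul_add]
  zero_mem' θ := by simp
  smul_mem' r x hx θ := by rw [map_smul, hx θ, smul_comm]

/-- The quantum integer `1 + t + ⋯ + t ^ (m - 1)`. -/
def qInt (t : ℂ) (m : ℕ) : ℂ := (1 - t ^ m) / (1 - t)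

@[simp] theorem qInt_zero (t : ℂ) : qInt t 0 = 0 := by simp [qInt]

/-- The elements `x ^ i z ^ l y ^ k` of a PBW basis, defined through their derivatives. -/
def pbw (s : ℂ) (i l k : ℕ) : TX (Fin 2) :=
  (if i = 0 ∧ l = 0 ∧ k = 0 then word [] else 0) +
  (if h : 0 < i then (s⁻¹ ^ (l + k) * qInt (s ^ 2) i) • cons 0 (pbw s (i - 1) l k) else 0) +
  (if h : 0 < k then (((s ^ 2) ^ i)⁻¹ * qInt (s ^ 2) k) • cons 1 (pbw s i l (k - 1)) else 0) +
  (if h : 0 < l then (((s ^ 2) ^ i)⁻¹ * qInt (s ^ 2) l) • cons 1 (pbw s (i + 1) (l - 1) k) else 0)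
termination_by i + 2 * l + k

/-- This recursion, the one for `leftDer 1` and the degree-zero coefficient determine `pbw`. The
truncated subtractions are harmless, since `qInt` vanishes at `0`. -/
theorem leftDer_zero_pbw (s : ℂ) (i l k : ℕ) :
    leftDer 0 (pbw s i l k) = (s⁻¹ ^ (l + k) * qInt (s ^ 2) i) • pbw s (i - 1) l k := by
  rw [pbw]
  simp only [map_add]
  split_ifs <;> simp_all [leftDer_cons]

theorem leftDer_one_pbw (s : ℂ) (i l k : ℕ) :
    leftDer 1 (pbw s i l k) = (((s ^ 2) ^ i)⁻¹ * qInt (s ^ 2) k) • pbw s i l (k - 1) +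
      (((s ^ 2) ^ i)⁻¹ * qInt (s ^ 2) l) • pbw s (i + 1) (l - 1) k := by
  rw [pbw]
  simp only [map_add]
  split_ifs <;> simp_all [leftDer_cons]

theorem pbw_apply_nil (s : ℂ) (i l k : ℕ) :
    pbw s i l k [] = if i = 0 ∧ l = 0 ∧ k = 0 then 1 else 0 := by
  rw [pbw]
  split_ifs <;> simp_all [cons_apply_nil]

theorem pbw_zero (s : ℂ) : pbw s 0 0 0 = word [] := by
  rw [pbw]; simp

theorem pbw_mem_weightSpace (s : ℂ) (i l k : ℕ) :
    pbw s i l k ∈ weightSpace (i + l) (l + k) := by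
  intro θ
  refine ext_coeff fun w => ?_
  induction w generalizing i l k with
  | nil =>
    rw [diag_apply, Finsupp.smul_apply, pbw_apply_nil]
    split_ifs with h
    · obtain ⟨rfl, rfl, rfl⟩ := h; simp
    · simp
  | cons j w ih =>
    rw [← leftDer_apply, ← leftDer_apply, leftDer_diag, map_smul]
    match j with
    | 0 =>
      rw [leftDer_zero_pbw]
      cases i with
      | zero => simp
      | succ i =>
        simp only [map_smul, Finsupp.smul_apply, smul_eq_mul, Nat.add_sub_cancel, ih]
        ring
    | 1 =>
      rw [leftDer_one_pbw]
      simp only [map_add, map_smul, Finsupp.add_apply, Finsupp.smul_apply, smul_eq_mul, ih]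
      cases k with
      | zero =>
        cases l with
        | zero => simp
        | succ l => simp; ring
      | succ k =>
        cases l with
        | zero => simp; ring
        | succ l => simp only [Nat.add_sub_cancel]; ring

variable {s : ℂ} (a b : Fin 2 → ℂ)

theorem diag_pbw (θ : Fin 2 → ℂ) (i l k : ℕ) :
    diag θ (pbw s i l k) = (θ 0 ^ (i + l) * θ 1 ^ (l + k)) • pbw s i l k :=
  pbw_mem_weightSpace s i l k θ

/-- No straightening relations between `x`, `z` and `y` are used: both sides satisfy the same
`leftDer` recursion. For `k = 0` the truncated exponent `k - 1` comes with the factor `1 - t ^ 0 =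
0`. -/
theorem act_zero_pbw (hs : s ≠ 0) (ht : s ^ 2 ≠ 1) (i l k : ℕ) :
    act (cartanA2 s) a b (word [0]) (pbw s i l k) =
      s ^ (l + k) • ((1 - a 0 * b 0 * (s ^ 2) ^ (i + l) * ((s ^ 2) ^ k)⁻¹) • pbw s (i + 1) l k +
        ((1 - (s ^ 2) ^ k) * (a 0 * b 0) * (s ^ 2) ^ i * ((s ^ 2) ^ k)⁻¹ * (s ^ 2)⁻¹) •
          pbw s i (l + 1) (k - 1)) := by
  have ht' : 1 - s ^ 2 ≠ 0 := sub_ne_zero.mpr (Ne.symm ht)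
  refine ext_coeff fun w => ?_
  induction w generalizing i l k with
  | nil => simp [act_apply_nil, pbw_apply_nil]
  | cons j w ih =>
    rw [← leftDer_apply, ← leftDer_apply, leftDer_letter_act]
    match j with
    | 0 =>
      simp only [if_true, leftDer_zero_pbw, diag_pbw, map_smul, map_add, Finsupp.add_apply,
        Finsupp.sub_apply, Finsupp.smul_apply, smul_eq_mul, ih, qInt, cartanA2_zero_zero,
        cartanA2_zero_one, cartanA2_one_zero]
      cases i with
      | zero => cases k <;> simp [mul_pow] <;> field_simp <;> ring
      | succ i => cases k <;> simp [mul_pow] <;> field_simp <;> ring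
    | 1 =>
      simp only [zero_ne_one, if_false, zero_add, leftDer_one_pbw, map_smul, map_add,
        Finsupp.add_apply, Finsupp.smul_apply, smul_eq_mul, ih, qInt, cartanA2_zero_one]
      cases k with
      | zero => cases l <;> simp [mul_pow] <;> field_simp <;> ring
      | succ k =>
        cases l with
        | zero => cases k <;> simp [mul_pow] <;> field_simp <;> ring
        | succ l => cases k <;> simp [mul_pow] <;> field_simp <;> ring

theorem act_one_pbw (hs : s ≠ 0) (ht : s ^ 2 ≠ 1) (i l k : ℕ) :
    act (cartanA2 s) a b (word [1]) (pbw s i l k) =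
      ((s ^ 2) ^ l * (1 - a 1 * b 1 * (s ^ 2) ^ k)) • pbw s i l (k + 1) -
        ((s ^ 2)⁻¹ * (1 - (s ^ 2) ^ i)) • pbw s (i - 1) (l + 1) k := by
  have ht' : 1 - s ^ 2 ≠ 0 := sub_ne_zero.mpr (Ne.symm ht)
  refine ext_coeff fun w => ?_
  induction w generalizing i l k with
  | nil => simp [act_apply_nil, pbw_apply_nil]
  | cons j w ih =>
    rw [← leftDer_apply, ← leftDer_apply, leftDer_letter_act]
    match j with
    | 0 =>
      simp only [one_ne_zero, if_false, zero_add, leftDer_zero_pbw, map_smul, map_sub,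
        Finsupp.sub_apply, Finsupp.smul_apply, smul_eq_mul, ih, qInt, cartanA2_one_zero]
      cases i with
      | zero => simp
      | succ i => cases i <;> simp [mul_pow] <;> field_simp <;> ring
    | 1 =>
      simp only [if_true, leftDer_one_pbw, diag_pbw, map_smul, map_add, map_sub, Finsupp.add_apply,
        Finsupp.sub_apply, Finsupp.smul_apply, smul_eq_mul, ih, qInt, cartanA2_one_one,
        cartanA2_zero_one, cartanA2_one_zero]
      cases i with
      | zero =>
        cases l with
        | zero => cases k <;> simp [mul_pow] <;> field_simp <;> ring
        | succ l => cases k <;> simp [mul_pow] <;> field_simp <;> ring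
      | succ i =>
        cases l with
        | zero => cases k <;> simp [mul_pow] <;> field_simp <;> ring
        | succ l => cases k <;> simp [mul_pow] <;> field_simp <;> ring

end

end NicholsYD

namespace NicholsYD

noncomputable section

/-! ### An invariant subspace with a standard monomial spanning set -/

/-- The elements `x ^ i z ^ l z' ^ d y ^ k`, where `z' = x y - z`. -/
def stdMon (s : ℂ) : ℕ → ℕ → ℕ → ℕ → TX (Fin 2)
  | 0, i, l, k => pbw s i l k
  | d + 1, i, l, k =>
      (s ^ 2) ^ l • stdMon s d (i + 1) l (k + 1) - (s ^ 2)⁻¹ • stdMon s d i (l + 1) k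

variable {s : ℂ} (a b : Fin 2 → ℂ)

theorem act_one_stdMon (hs : s ≠ 0) (ht : s ^ 2 ≠ 1) (d i l k : ℕ) :
    act (cartanA2 s) a b (word [1]) (stdMon s d i l k) =
      ((s ^ 2) ^ l * (1 - a 1 * b 1 * (s ^ 2) ^ (k + d))) • stdMon s d i l (k + 1) -
        ((s ^ 2)⁻¹ * (1 - (s ^ 2) ^ i)) • stdMon s d (i - 1) (l + 1) k := by
  induction d generalizing i l k with
  | zero => exact act_one_pbw a b hs ht i l k
  | succ d ih =>
    refine ext_coeff fun w => ?_
    simp only [stdMon, map_sub, map_smul, ih, Finsupp.sub_apply, Finsupp.smul_apply, smul_eq_mul]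
    cases i <;> simp <;> field_simp <;> ring

/-- With `z'` available, the correction term keeps both `i + l` and `k + d`; only the term raising
`i` leaves a box bounded in these two sums, and its factor depends on `i + l` alone. In
`act_one_stdMon` the sum `k + d` plays this role. -/
theorem act_zero_stdMon (hs : s ≠ 0) (ht : s ^ 2 ≠ 1) (d i l k : ℕ) :
    act (cartanA2 s) a b (word [0]) (stdMon s d i l k) =
      (s ^ (l + k + d) * (1 - a 0 * b 0 * (s ^ 2) ^ (i + l))) • stdMon s d (i + 1) l k -
        (s ^ (l + k + d) * ((1 - (s ^ 2) ^ k) * (a 0 * b 0) * (s ^ 2) ^ i * ((s ^ 2) ^ k)⁻¹)) •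
          stdMon s (d + 1) i l (k - 1) := by
  induction d generalizing i l k with
  | zero =>
    refine ext_coeff fun w => ?_
    simp only [stdMon, act_zero_pbw a b hs ht, Finsupp.add_apply,
      Finsupp.sub_apply, Finsupp.smul_apply, smul_eq_mul]
    cases k <;> simp <;> field_simp <;> ring
  | succ d ih =>
    refine ext_coeff fun w => ?_
    rw [stdMon, map_sub, map_smul, map_smul, ih, ih]
    cases k with
    | zero =>
      simp only [stdMon, Finsupp.sub_apply, Finsupp.smul_apply, smul_eq_mul]
      simp
      field_simp
      ring
    | succ k =>
      simp only [stdMon, Finsupp.sub_apply, Finsupp.smul_apply, smul_eq_mul]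
      simp
      field_simp
      ring

/-- The span of the elements `x ^ i z ^ l z' ^ d y ^ n` with `k ≤ l`, `i + l < k + m₁` and
`n + d < m₂`. -/
def stdSpan (s : ℂ) (k m₁ m₂ : ℕ) : Submodule ℂ (TX (Fin 2)) :=
  Submodule.span ℂ
    {x | ∃ d i l n, k ≤ l ∧ i + l < k + m₁ ∧ n + d < m₂ ∧ stdMon s d i l n = x}

theorem stdMon_mem {k m₁ m₂ d i l n : ℕ} (h : k ≤ l) (h₁ : i + l < k + m₁) (h₂ : n + d < m₂) :
    stdMon s d i l n ∈ stdSpan s k m₁ m₂ :=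
  Submodule.subset_span ⟨d, i, l, n, h, h₁, h₂, rfl⟩

theorem stdSpan_le {k m₁ m₂ : ℕ} {M : Submodule ℂ (TX (Fin 2))}
    (h : ∀ d i l n, k ≤ l → i + l < k + m₁ → n + d < m₂ → stdMon s d i l n ∈ M) :
    stdSpan s k m₁ m₂ ≤ M := by
  rw [stdSpan, Submodule.span_le]
  rintro _ ⟨d, i, l, n, h₀, h₁, h₂, rfl⟩
  exact h d i l n h₀ h₁ h₂

theorem act_zero_mem_stdSpan (hs : s ≠ 0) (ht : s ^ 2 ≠ 1) {k m₁ m₂ : ℕ}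
    (hA : a 0 * b 0 * (s ^ 2) ^ (k + m₁ - 1) = 1) :
    stdSpan s k m₁ m₂ ≤ (stdSpan s k m₁ m₂).comap (act (cartanA2 s) a b (word [0])) := by
  refine stdSpan_le fun d i l n h h₁ h₂ => ?_
  rw [Submodule.mem_comap, act_zero_stdMon a b hs ht]
  refine sub_mem ?_ ?_
  · by_cases h : i + l = k + m₁ - 1
    · rw [h, hA]; simp
    · exact Submodule.smul_mem _ _ (stdMon_mem ‹_› (by omega) h₂)
  · cases n with
    | zero => simp
    | succ n => exact Submodule.smul_mem _ _ (stdMon_mem h h₁ (by omega))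

theorem act_one_mem_stdSpan (hs : s ≠ 0) (ht : s ^ 2 ≠ 1) {k m₁ m₂ : ℕ}
    (hA : a 1 * b 1 * (s ^ 2) ^ (m₂ - 1) = 1) :
    stdSpan s k m₁ m₂ ≤ (stdSpan s k m₁ m₂).comap (act (cartanA2 s) a b (word [1])) := by
  refine stdSpan_le fun d i l n h h₁ h₂ => ?_
  rw [Submodule.mem_comap, act_one_stdMon a b hs ht]
  refine sub_mem ?_ ?_
  · by_cases h : n + d = m₂ - 1
    · rw [h, hA]; simp
    · exact Submodule.smul_mem _ _ (stdMon_mem ‹_› h₁ (by omega))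
  · cases i with
    | zero => simp
    | succ i => exact Submodule.smul_mem _ _ (stdMon_mem (by omega) (by omega) h₂)

theorem generated_le_of_stable {c : Matrix (Fin 2) (Fin 2) ℂ} {W : Submodule ℂ (TX (Fin 2))}
    (h : word [] ∈ W) (h₀ : ∀ x ∈ W, act c a b (word [0]) x ∈ W)
    (h₁ : ∀ x ∈ W, act c a b (word [1]) x ∈ W) : generatedByVertex c a b ≤ W := by
  rw [generated_eq_span, Submodule.span_le]
  rintro _ ⟨w, rfl⟩
  induction w with
  | nil => exact h
  | cons i w ih =>
    match i with
    | 0 => exact h₀ _ ih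
    | 1 => exact h₁ _ ih

theorem generated_le_stdSpan (hs : s ≠ 0) (ht : s ^ 2 ≠ 1) {m₁ m₂ : ℕ} (hm₁ : 1 ≤ m₁)
    (hm₂ : 1 ≤ m₂) (hA₀ : a 0 * b 0 * (s ^ 2) ^ (m₁ - 1) = 1)
    (hA₁ : a 1 * b 1 * (s ^ 2) ^ (m₂ - 1) = 1) :
    generatedByVertex (cartanA2 s) a b ≤ stdSpan s 0 m₁ m₂ := by
  refine generated_le_of_stable a b ?_ (act_zero_mem_stdSpan a b hs ht (by rwa [zero_add]))
    (act_one_mem_stdSpan a b hs ht hA₁)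
  rw [← pbw_zero s]
  exact stdMon_mem (d := 0) le_rfl (by omega) hm₂

/-- The standard monomials: those not divisible by `x y`. -/
def stdFinset (s : ℂ) (k m₁ m₂ : ℕ) : Finset (TX (Fin 2)) := by
  classical
  exact (Finset.range m₁ ×ˢ (Finset.range m₂).sigma fun n => Finset.range (n + 1)).image
      (fun x => stdMon s (x.2.1 - x.2.2) 0 (k + x.1) x.2.2) ∪
    (Finset.range m₂ ×ˢ (Finset.range m₁).sigma fun n => Finset.range n).image
      (fun x => stdMon s x.1 (x.2.2 + 1) (k + (x.2.1 - (x.2.2 + 1))) 0)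

/-- The relation defining `z'` rewrites a factor `x y` through `z'` and `z`. This lowers `i`, and
neither `i + l` nor `n + d` grows, so the rewriting stays inside the box. -/
theorem stdSpan_le_span_stdFinset (hs : s ≠ 0) (k m₁ m₂ : ℕ) :
    stdSpan s k m₁ m₂ ≤ Submodule.span ℂ (stdFinset s k m₁ m₂ : Set (TX (Fin 2))) := by
  classical
  refine stdSpan_le fun d i l n h h₁ h₂ => ?_
  induction i generalizing d l n with
  | zero =>
    refine Submodule.subset_span ?_
    rw [stdFinset, Finset.coe_union]
    refine Or.inl ?_
    rw [Finset.mem_coe, Finset.mem_image]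
    refine ⟨⟨l - k, ⟨n + d, n⟩⟩, ?_, ?_⟩
    · simp only [Finset.mem_product, Finset.mem_range, Finset.mem_sigma]
      omega
    · simp [Nat.add_sub_cancel' h]
  | succ i ih =>
    cases n with
    | zero =>
      refine Submodule.subset_span ?_
      rw [stdFinset, Finset.coe_union]
      refine Or.inr ?_
      rw [Finset.mem_coe, Finset.mem_image]
      refine ⟨⟨d, ⟨i + 1 + (l - k), i⟩⟩, ?_, ?_⟩
      · simp only [Finset.mem_product, Finset.mem_range, Finset.mem_sigma]
        omega
      · simp [Nat.add_sub_cancel' h]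
    | succ n =>
      have h' : stdMon s d (i + 1) l (n + 1) = ((s ^ 2) ^ l)⁻¹ •
          (stdMon s (d + 1) i l n + (s ^ 2)⁻¹ • stdMon s d i (l + 1) n) := by
        rw [stdMon, sub_add_cancel, smul_smul, inv_mul_cancel₀ (by positivity), one_smul]
      rw [h']
      exact Submodule.smul_mem _ _ (add_mem (ih _ _ _ h (by omega) (by omega))
        (Submodule.smul_mem _ _ (ih _ _ _ (by omega) (by omega) (by omega))))

theorem two_mul_card_stdFinset_le (s : ℂ) (k m₁ m₂ : ℕ) :
    2 * (stdFinset s k m₁ m₂).card ≤ m₁ * m₂ * (m₁ + m₂) := by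
  classical
  have h : (stdFinset s k m₁ m₂).card ≤ m₁ * ∑ n ∈ Finset.range m₂, (n + 1) +
      m₂ * ∑ n ∈ Finset.range m₁, n := by
    refine (Finset.card_union_le _ _).trans (add_le_add ?_ ?_)
    · refine Finset.card_image_le.trans ?_
      simp [Finset.card_product, Finset.card_sigma]
    · refine Finset.card_image_le.trans ?_
      simp [Finset.card_product, Finset.card_sigma]
  have h1 : ∀ m : ℕ, 2 * ∑ n ∈ Finset.range m, (n + 1) = m * (m + 1) := by
    intro m
    induction m with
    | zero => simp
    | succ m ih => rw [Finset.sum_range_succ, mul_add, ih]; ring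
  have h2 : ∀ m : ℕ, 2 * ∑ n ∈ Finset.range m, n + m = m * m := by
    intro m
    induction m with
    | zero => simp
    | succ m ih => rw [Finset.sum_range_succ, mul_add]; linarith
  have e1 := h1 m₂
  have e2 := h2 m₁
  generalize ∑ n ∈ Finset.range m₂, (n + 1) = X at *
  generalize ∑ n ∈ Finset.range m₁, n = Y at *
  have e3 : m₂ * (2 * Y + m₁) = m₂ * (m₁ * m₁) := by rw [e2]
  have e4 : m₁ * (2 * X) = m₁ * (m₂ * (m₂ + 1)) := by rw [e1]
  nlinarith

theorem finiteDimensional_stdSpan (hs : s ≠ 0) (k m₁ m₂ : ℕ) :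
    FiniteDimensional ℂ (stdSpan s k m₁ m₂) :=
  have : FiniteDimensional ℂ (Submodule.span ℂ (stdFinset s k m₁ m₂ : Set (TX (Fin 2)))) :=
    FiniteDimensional.span_finset ℂ _
  Submodule.finiteDimensional_of_le (stdSpan_le_span_stdFinset hs k m₁ m₂)

theorem two_mul_finrank_stdSpan_le (hs : s ≠ 0) (k m₁ m₂ : ℕ) :
    2 * Module.finrank ℂ (stdSpan s k m₁ m₂) ≤ m₁ * m₂ * (m₁ + m₂) := by
  have : FiniteDimensional ℂ (Submodule.span ℂ (stdFinset s k m₁ m₂ : Set (TX (Fin 2)))) :=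
    FiniteDimensional.span_finset ℂ _
  have h1 := Submodule.finrank_mono (stdSpan_le_span_stdFinset hs k m₁ m₂)
  have h2 := finrank_span_finset_le_card (R := ℂ) (stdFinset s k m₁ m₂)
  have h3 := two_mul_card_stdFinset_le s k m₁ m₂
  rw [Set.finrank] at h2
  omega

end

end NicholsYD

namespace NicholsYD

noncomputable section

/-! ### Strings of derivatives and dimensions -/

variable {s : ℂ} {p : ℕ}

theorem one_sub_pow_ne_zero (ht : IsPrimitiveRoot (s ^ 2) p) {n : ℕ} (hn : ¬ p ∣ n) :
    1 - (s ^ 2) ^ n ≠ 0 := fun h =>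
  hn ((ht.pow_eq_one_iff_dvd n).mp (sub_eq_zero.mp h).symm)

theorem qInt_ne_zero (ht : IsPrimitiveRoot (s ^ 2) p) (hp : 1 < p) {n : ℕ} (hn : ¬ p ∣ n) :
    qInt (s ^ 2) n ≠ 0 :=
  div_ne_zero (one_sub_pow_ne_zero ht hn) (sub_ne_zero.mpr (ht.ne_one hp).symm)

theorem not_dvd_of_lt {n : ℕ} (h₀ : 0 < n) (h : n < p) : ¬ p ∣ n :=
  fun hd => absurd (Nat.le_of_dvd h₀ hd) (by omega)

theorem qInt_self (ht : IsPrimitiveRoot (s ^ 2) p) : qInt (s ^ 2) p = 0 := by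
  simp [qInt, ht.pow_eq_one]

/-- A derivative either keeps some exponent at least `p` or lowers an exponent equal to `p`, with
coefficient `qInt t p = 0`; the degree-zero coefficient vanishes as well. -/
theorem pbw_eq_zero (ht : IsPrimitiveRoot (s ^ 2) p) (hp : 1 < p) {i l c : ℕ}
    (h : p ≤ i ∨ p ≤ l ∨ p ≤ c) : pbw s i l c = 0 := by
  refine ext_coeff fun w => ?_
  induction w generalizing i l c with
  | nil => rw [pbw_apply_nil, if_neg (by omega)]; rfl
  | cons j w ih =>
    rw [← leftDer_apply]
    have key : ∀ {n : ℕ} {i l c : ℕ}, n = p ∨ p ≤ i ∨ p ≤ l ∨ p ≤ c →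
        qInt (s ^ 2) n * pbw s i l c w = 0 := by
      rintro n i l c (rfl | h)
      · rw [qInt_self ht, zero_mul]
      · rw [ih h, Finsupp.coe_zero, Pi.zero_apply, mul_zero]
    match j with
    | 0 =>
      rw [leftDer_zero_pbw, Finsupp.smul_apply, smul_eq_mul, mul_assoc, key (by omega)]
      simp
    | 1 =>
      rw [leftDer_one_pbw, Finsupp.add_apply, Finsupp.smul_apply, Finsupp.smul_apply, smul_eq_mul,
        smul_eq_mul, mul_assoc, mul_assoc, key (by omega), key (by omega)]
      simp

theorem pbw_zero_ne_zero (hs : s ≠ 0) (ht : IsPrimitiveRoot (s ^ 2) p) (hp : 1 < p) {l c : ℕ}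
    (hl : l < p) (hc : c < p) : pbw s 0 l c ≠ 0 := by
  induction l with
  | zero =>
    induction c with
    | zero =>
      intro h
      have := pbw_apply_nil s 0 0 0
      rw [h] at this
      simp at this
    | succ c ih =>
      intro h
      have h1 := leftDer_one_pbw s 0 0 (c + 1)
      rw [h, map_zero] at h1
      simp only [pow_zero, inv_one, one_mul, qInt_zero, zero_smul, add_zero,
        Nat.add_sub_cancel] at h1
      exact smul_ne_zero (qInt_ne_zero ht hp (not_dvd_of_lt (by omega) hc)) (ih (by omega)) h1.symm
  | succ l ih =>
    intro h
    have h1 := leftDer_one_pbw s 0 (l + 1) c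
    apply_fun leftDer 0 at h1
    rw [h, map_zero, map_zero, map_add, map_smul, map_smul, leftDer_zero_pbw,
      leftDer_zero_pbw] at h1
    simp only [pow_zero, inv_one, one_mul, qInt_zero, mul_zero, zero_smul, smul_zero, zero_add,
      Nat.add_sub_cancel] at h1
    have h2 := qInt_ne_zero ht hp (not_dvd_of_lt one_pos hp)
    exact smul_ne_zero (qInt_ne_zero ht hp (not_dvd_of_lt (by omega) hl))
      (smul_ne_zero (mul_ne_zero (pow_ne_zero _ (inv_ne_zero hs)) h2) (ih (by omega))) h1.symm

/-- If a sum of eigenvectors with distinct eigenvalues lies in a stable subspace, then so does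
each of them. -/
theorem eigenvector_mem_of_sum_mem {V κ : Type*} [AddCommGroup V] [Module ℂ V]
    {f : V →ₗ[ℂ] V} {M : Submodule ℂ V} (hf : ∀ x ∈ M, f x ∈ M) {μ : κ → ℂ} (S : Finset κ)
    (hμ : Set.InjOn μ S) {v : κ → V} (hv : ∀ k ∈ S, f (v k) = μ k • v k)
    (h : ∑ k ∈ S, v k ∈ M) : ∀ k ∈ S, v k ∈ M := by
  classical
  induction S using Finset.induction_on generalizing v with
  | empty => simp
  | insert k₀ S hk₀ ih =>
    have h1 : ∑ k ∈ S, (μ k - μ k₀) • v k ∈ M := by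
      have h2 := sub_mem (hf _ h) (M.smul_mem (μ k₀) h)
      rw [map_sum, Finset.smul_sum, Finset.sum_insert hk₀] at h2
      have h3 : ∀ k ∈ S, f (v k) - μ k₀ • v k = (μ k - μ k₀) • v k := fun k hk => by
        rw [hv k (Finset.mem_insert_of_mem hk), sub_smul]
      rwa [Finset.sum_insert hk₀, add_sub_add_comm, ← Finset.sum_sub_distrib,
        hv _ (Finset.mem_insert_self _ _), sub_self, zero_add, Finset.sum_congr rfl h3] at h2
    have h3 : ∀ k ∈ S, v k ∈ M := by
      intro k hk
      have h4 := ih (hμ.mono (by simp)) (v := fun k => (μ k - μ k₀) • v k)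
        (fun k hk => by
          rw [map_smul, hv k (Finset.mem_insert_of_mem hk), smul_comm]) h1 k hk
      have h5 : μ k - μ k₀ ≠ 0 := by
        intro h6
        have := hμ (by simp [hk]) (by simp) (sub_eq_zero.mp h6)
        exact hk₀ (this ▸ hk)
      exact (M.smul_mem_iff h5).mp h4
    rw [Finset.sum_insert hk₀] at h
    intro k hk
    rcases Finset.mem_insert.mp hk with rfl | hk
    · exact (M.add_mem_iff_left (sum_mem h3)).mp h
    · exact h3 k hk

theorem pbw_mem_of_sum_mem {M : Submodule ℂ (TX (Fin 2))}
    (hM : ∀ θ, ∀ x ∈ M, diag θ x ∈ M) (S : Finset (ℕ × ℕ)) (hS : ∀ σ ∈ S, σ.1 < p) (r : ℕ × ℕ → ℂ)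
    (h : ∑ σ ∈ S, r σ • pbw s 0 σ.1 σ.2 ∈ M) : ∀ σ ∈ S, r σ • pbw s 0 σ.1 σ.2 ∈ M := by
  -- The element `z ^ l y ^ c` has multidegree `(l, l + c)`. For `θ = (2, 2 ^ p)` its eigenvalue is
  -- `2 ^ (l + p * (l + c))`, and since `l < p` this exponent determines both `l` and `c`.
  refine eigenvector_mem_of_sum_mem (hM ![2, 2 ^ p])
    (μ := fun σ => 2 ^ (σ.1 + p * (σ.1 + σ.2))) S ?_ ?_ h
  · intro σ hσ τ hτ h
    have h1 : σ.1 + p * (σ.1 + σ.2) = τ.1 + p * (τ.1 + τ.2) := by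
      have h' : (2 : ℂ) ^ (σ.1 + p * (σ.1 + σ.2)) = 2 ^ (τ.1 + p * (τ.1 + τ.2)) := h
      exact Nat.pow_right_injective le_rfl (by beta_reduce; exact_mod_cast h')
    have h2 := congrArg (· % p) h1
    simp only [Nat.add_mul_mod_self_left, Nat.mod_eq_of_lt (hS σ hσ),
      Nat.mod_eq_of_lt (hS τ hτ)] at h2
    rw [h2, Nat.add_left_cancel_iff] at h1
    have h3 := Nat.eq_of_mul_eq_mul_left ((Nat.zero_le _).trans_lt (hS τ hτ)) h1
    exact Prod.ext h2 (by omega)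
  · intro σ _
    rw [map_smul, diag_pbw, smul_comm]
    congr 2
    simp only [Matrix.cons_val_zero, Matrix.cons_val_one, zero_add]
    rw [← pow_mul, ← pow_add]

/-- `leftDer 0 ^ i x` is a nonzero multiple of `z ^ l y ^ c`, for `σ = (i, l, c)`. -/
def IsString (s : ℂ) (σ : ℕ × ℕ × ℕ) (x : TX (Fin 2)) : Prop :=
  ∃ r : ℂ, r ≠ 0 ∧ (leftDer 0 ^ σ.1) x = r • pbw s 0 σ.2.1 σ.2.2

theorem leftDer_pow_eq_zero {σ : ℕ × ℕ × ℕ} {x : TX (Fin 2)} (h : IsString s σ x) {n : ℕ}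
    (hn : σ.1 < n) : (leftDer 0 ^ n) x = 0 := by
  obtain ⟨r, -, hr⟩ := h
  obtain ⟨j, rfl⟩ := Nat.exists_eq_add_of_lt hn
  rw [show σ.1 + j + 1 = j + (1 + σ.1) by omega, pow_add, Module.End.mul_apply, pow_add,
    Module.End.mul_apply, hr, pow_one, map_smul, leftDer_zero_pbw]
  simp

/-- Combinations of strings that lie in a stable subspace which contains none of the elements at
the ends of the strings are trivial. -/
theorem string_coeff_eq_zero {M : Submodule ℂ (TX (Fin 2))} (hM : ∀ θ, ∀ x ∈ M, diag θ x ∈ M)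
    (hD : ∀ x ∈ M, leftDer 0 x ∈ M) (S : Finset (ℕ × ℕ × ℕ)) (hS : ∀ σ ∈ S, σ.2.1 < p)
    (hg : ∀ σ ∈ S, pbw s 0 σ.2.1 σ.2.2 ∉ M) {x : ℕ × ℕ × ℕ → TX (Fin 2)}
    (hx : ∀ σ ∈ S, IsString s σ (x σ)) (r : ℕ × ℕ × ℕ → ℂ) (h : ∑ σ ∈ S, r σ • x σ ∈ M) :
    ∀ σ ∈ S, r σ = 0 := by
  classical
  by_contra! hne
  obtain ⟨σ₀, hσ₀, hr₀⟩ := hne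
  -- Apply `leftDer 0` as often as the longest string with nonzero coefficient allows: shorter
  -- strings die, and strings of the same length reach their ends, which have distinct multidegrees.
  obtain ⟨τ, hτ, hmax⟩ := Finset.exists_max_image (S.filter fun σ => r σ ≠ 0) (fun σ => σ.1)
    ⟨σ₀, by simp [hσ₀, hr₀]⟩
  rw [Finset.mem_filter] at hτ
  have hpow : ∀ n, ∀ x ∈ M, (leftDer 0 ^ n) x ∈ M := by
    intro n
    induction n with
    | zero => simp
    | succ n ih => intro x hx; rw [pow_succ']; exact hD _ (ih x hx)
  have h1 := hpow τ.1 _ h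
  choose! e he0 he using hx
  have h2 : (leftDer 0 ^ τ.1) (∑ σ ∈ S, r σ • x σ) =
      ∑ υ ∈ (S.filter fun σ => σ.1 = τ.1).image Prod.snd,
        (r (τ.1, υ) * e (τ.1, υ)) • pbw s 0 υ.1 υ.2 := by
    rw [Finset.sum_image, map_sum, Finset.sum_filter]
    · refine Finset.sum_congr rfl fun σ hσ => ?_
      split_ifs with hi
      · rw [map_smul, ← hi, he σ hσ, smul_smul]
      · rw [map_smul]
        by_cases h0 : r σ = 0
        · rw [h0, zero_smul]
        · have := hmax σ (by simp [hσ, h0])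
          rw [leftDer_pow_eq_zero ⟨e σ, he0 σ hσ, he σ hσ⟩ (by omega), smul_zero]
    · intro σ hσ σ' hσ' h
      simp only [Finset.coe_filter, Set.mem_ofPred_eq] at hσ hσ'
      exact Prod.ext (hσ.2.trans hσ'.2.symm) h
  rw [h2] at h1
  have h3 := pbw_mem_of_sum_mem (p := p) hM _ ?_ (fun υ => r (τ.1, υ) * e (τ.1, υ)) h1 τ.2 ?_
  · exact hg τ hτ.1 ((M.smul_mem_iff (mul_ne_zero hτ.2 (he0 τ hτ.1))).mp h3)
  · intro υ hυ
    obtain ⟨σ, hσ, rfl⟩ := Finset.mem_image.mp hυ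
    exact hS σ (Finset.mem_filter.mp hσ).1
  · exact Finset.mem_image_of_mem _ (by simp [hτ.1])

theorem linearIndepOn_of_isString (hs : s ≠ 0) (ht : IsPrimitiveRoot (s ^ 2) p) (hp : 1 < p)
    (S : Finset (ℕ × ℕ × ℕ)) (hS : ∀ σ ∈ S, σ.2.1 < p ∧ σ.2.2 < p)
    {x : ℕ × ℕ × ℕ → TX (Fin 2)} (hx : ∀ σ ∈ S, IsString s σ (x σ)) :
    LinearIndepOn ℂ x (S : Set (ℕ × ℕ × ℕ)) := by
  rw [linearIndepOn_finset_iff]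
  intro r h
  refine string_coeff_eq_zero (M := ⊥) (p := p) (by simp) (by simp) S (fun σ hσ => (hS σ hσ).1)
    (fun σ hσ => ?_) hx r (by simp [h])
  rw [Submodule.mem_bot]
  exact pbw_zero_ne_zero hs ht hp (hS σ hσ).1 (hS σ hσ).2

theorem card_le_finrank_of_isString (hs : s ≠ 0) (ht : IsPrimitiveRoot (s ^ 2) p) (hp : 1 < p)
    (S : Finset (ℕ × ℕ × ℕ)) (hS : ∀ σ ∈ S, σ.2.1 < p ∧ σ.2.2 < p)
    {M : Submodule ℂ (TX (Fin 2))} [FiniteDimensional ℂ M]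
    (hx : ∀ σ ∈ S, ∃ x ∈ M, IsString s σ x) : S.card ≤ Module.finrank ℂ M := by
  choose! x hxM hx using hx
  have h := linearIndepOn_of_isString hs ht hp S hS hx
  have h1 : LinearIndependent ℂ (fun σ : S => (⟨x σ, hxM σ σ.2⟩ : M)) :=
    LinearIndependent.of_comp M.subtype h
  simpa using h1.fintype_card_le_finrank

theorem isString_pbw (hs : s ≠ 0) (ht : IsPrimitiveRoot (s ^ 2) p) (hp : 1 < p) {i l c : ℕ}
    (hi : i < p) : IsString s (i, l, c) (pbw s i l c) := by
  induction i with
  | zero => exact ⟨1, one_ne_zero, by simp⟩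
  | succ i ih =>
    obtain ⟨r, hr, h⟩ := ih (by omega)
    refine ⟨s⁻¹ ^ (l + c) * qInt (s ^ 2) (i + 1) * r, mul_ne_zero (mul_ne_zero
      (pow_ne_zero _ (inv_ne_zero hs)) (qInt_ne_zero ht hp (not_dvd_of_lt (by omega) hi))) hr, ?_⟩
    simp only at h ⊢
    rw [pow_succ, Module.End.mul_apply, leftDer_zero_pbw, map_smul, Nat.add_sub_cancel, h,
      smul_smul]

theorem leftDer_zero_stdMon (hs : s ≠ 0) (ht : s ^ 2 ≠ 1) (d i l c : ℕ) :
    leftDer 0 (stdMon s d i l c) =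
      (s⁻¹ ^ (l + c + d) * qInt (s ^ 2) i) • stdMon s d (i - 1) l c +
        (s⁻¹ ^ (l + c + d) * (s ^ 2) ^ (i + l) * qInt (s ^ 2) d) •
          stdMon s (d - 1) i l (c + 1) := by
  have ht' : 1 - s ^ 2 ≠ 0 := sub_ne_zero.mpr (Ne.symm ht)
  induction d generalizing i l c with
  | zero => simp [stdMon, leftDer_zero_pbw]
  | succ d ih =>
    refine ext_coeff fun w => ?_
    rw [stdMon, map_sub, map_smul, map_smul, ih, ih]
    cases d with
    | zero =>
      cases i with
      | zero => simp [stdMon, qInt]; field_simp; ring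
      | succ i => simp [stdMon, qInt]; field_simp; ring
    | succ d =>
      cases i with
      | zero => simp [stdMon, qInt]; field_simp; ring
      | succ i => simp [stdMon, qInt]; field_simp; ring

end

end NicholsYD

namespace NicholsYD

noncomputable section

variable {s : ℂ} {p : ℕ}

/-! ### Strings of the standard monomials -/

theorem leftDer_zero_mem_stdSpan (hs : s ≠ 0) (ht : s ^ 2 ≠ 1) {k m₁ m₂ : ℕ} :
    stdSpan s k m₁ m₂ ≤ (stdSpan s k m₁ m₂).comap (leftDer 0) := by
  refine stdSpan_le fun d i l n h h₁ h₂ => ?_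
  rw [Submodule.mem_comap, leftDer_zero_stdMon hs ht]
  refine add_mem (Submodule.smul_mem _ _ (stdMon_mem h (by omega) h₂)) ?_
  cases d with
  | zero => simp
  | succ d => exact Submodule.smul_mem _ _ (stdMon_mem h h₁ (by simp; omega))

theorem stdMon_eq_zero (ht : IsPrimitiveRoot (s ^ 2) p) (hp : 1 < p) {d i l c : ℕ} (h : p ≤ i) :
    stdMon s d i l c = 0 := by
  induction d generalizing i l c with
  | zero => exact pbw_eq_zero ht hp (Or.inl h)
  | succ d ih => simp [stdMon, ih h, ih (h.trans (Nat.le_succ i))]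

theorem leftDer_pow_stdMon_eq_zero (hs : s ≠ 0) (ht : s ^ 2 ≠ 1) {n d i l c : ℕ}
    (h : i + d < n) : (leftDer 0 ^ n) (stdMon s d i l c) = 0 := by
  induction n generalizing d i l c with
  | zero => omega
  | succ n ih =>
    rw [pow_succ, Module.End.mul_apply, leftDer_zero_stdMon hs ht, map_add, map_smul, map_smul]
    cases i with
    | zero =>
      cases d with
      | zero => simp
      | succ d => rw [Nat.add_sub_cancel, ih (d := d) (i := 0) (by omega)]; simp
    | succ i =>
      rw [ih (d := d) (i := i + 1 - 1) (by omega)]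
      cases d with
      | zero => simp
      | succ d => rw [Nat.add_sub_cancel, ih (d := d) (i := i + 1) (by omega)]; simp

theorem leftDer_pow_order (hs : s ≠ 0) (ht : IsPrimitiveRoot (s ^ 2) p) (hp : 1 < p)
    (d i l c : ℕ) : (leftDer 0 ^ p) (stdMon s d i l c) = 0 := by
  induction d generalizing i l c with
  | zero =>
    by_cases hi : i < p
    · exact leftDer_pow_eq_zero (isString_pbw hs ht hp hi) hi
    · rw [stdMon_eq_zero ht hp (not_lt.mp hi), map_zero]
  | succ d ih => simp [stdMon, ih]

/-- The string of a monomial without carry. -/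
theorem isString_stdMon (hs : s ≠ 0) (ht : IsPrimitiveRoot (s ^ 2) p) (hp : 1 < p)
    {d i l c : ℕ} (h : i + d < p) : IsString s (i + d, l, c + d) (stdMon s d i l c) := by
  induction d generalizing i l c with
  | zero => exact isString_pbw hs ht hp h
  | succ d ih =>
    obtain ⟨r, hr, h1⟩ := ih (i := i + 1) (l := l) (c := c + 1) (by omega)
    refine ⟨(s ^ 2) ^ l * r, mul_ne_zero (pow_ne_zero _ (pow_ne_zero _ hs)) hr, ?_⟩
    simp only at h1 ⊢
    rw [stdMon, map_sub, map_smul, map_smul, show i + (d + 1) = i + 1 + d by omega, h1,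
      leftDer_pow_stdMon_eq_zero hs (ht.ne_one hp) (d := d) (i := i) (by omega), smul_zero, sub_zero,
      smul_smul,
      show c + 1 + d = c + (d + 1) by omega]

/-- The string of a monomial with carry. -/
theorem isString_stdMon_carry (hs : s ≠ 0) (ht : IsPrimitiveRoot (s ^ 2) p) (hp : 1 < p)
    {d i j l c : ℕ} (hi : i < p) (hd : d < p) (h : i + d = p - 1 + j) (hc : j ≤ c + d) :
    IsString s (p - 1, l + j, c + d - j) (stdMon s d i l c) := by
  obtain ⟨n, hn⟩ : ∃ n, n + i = p - 1 := ⟨p - 1 - i, by omega⟩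
  induction n generalizing d i c with
  | zero =>
    -- For `i = p - 1` the terms with `x ^ p` vanish, so each `z'` turns into a multiple of `z`.
    obtain rfl : d = j := by omega
    obtain rfl : i = p - 1 := by omega
    clear h hd hc hn
    rw [Nat.add_sub_cancel]
    induction d generalizing l with
    | zero => exact isString_pbw hs ht hp hi
    | succ d ih =>
      obtain ⟨r, hr, h1⟩ := ih (l := l + 1)
      refine ⟨-((s ^ 2)⁻¹ * r), by simp [hs, hr], ?_⟩
      simp only at h1 ⊢
      rw [stdMon, stdMon_eq_zero (i := p - 1 + 1) ht hp (by omega), smul_zero, zero_sub, map_neg,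
        map_smul, h1, smul_smul, neg_smul, add_right_comm, add_assoc]
  | succ n ih =>
    obtain ⟨d, rfl⟩ : ∃ e, d = e + 1 := ⟨d - 1, by omega⟩
    obtain ⟨r, hr, h1⟩ := ih (d := d) (i := i + 1) (c := c + 1) (by omega) (by omega) (by omega)
      (by omega) (by omega)
    -- The `p`-th derivative of the monomial with one more `x` is zero. Its first derivative
    -- combines the monomial in question with that of the induction hypothesis, so their `(p -
    -- 1)`-st derivatives are proportional.
    have h2 := leftDer_pow_order hs ht hp (d + 1) (i + 1) l c
    rw [show p = p - 1 + 1 by omega, pow_succ, Module.End.mul_apply,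
      leftDer_zero_stdMon hs (ht.ne_one hp), map_add, map_smul, map_smul, Nat.add_sub_cancel,
      Nat.add_sub_cancel] at h2
    simp only at h1
    rw [h1, smul_smul] at h2
    have q1 := qInt_ne_zero ht hp (not_dvd_of_lt (by omega : 0 < i + 1) (by omega))
    have q2 := qInt_ne_zero ht hp (not_dvd_of_lt (by omega : 0 < d + 1) (by omega))
    set x := s⁻¹ ^ (l + c + (d + 1)) * qInt (s ^ 2) (i + 1) with hx
    set y := s⁻¹ ^ (l + c + (d + 1)) * (s ^ 2) ^ (i + 1 + l) * qInt (s ^ 2) (d + 1) with hy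
    have hx0 : x ≠ 0 := mul_ne_zero (pow_ne_zero _ (inv_ne_zero hs)) q1
    have hy0 : y ≠ 0 := mul_ne_zero (mul_ne_zero (pow_ne_zero _ (inv_ne_zero hs))
      (pow_ne_zero _ (pow_ne_zero _ hs))) q2
    refine ⟨-(x⁻¹ * (y * r)), neg_ne_zero.mpr (mul_ne_zero (inv_ne_zero hx0)
      (mul_ne_zero hy0 hr)), ?_⟩
    simp only
    rw [← inv_smul_smul₀ hx0 ((leftDer 0 ^ (p - 1)) _), eq_neg_of_add_eq_zero_left h2, smul_neg,
      smul_smul, neg_smul, show c + 1 + d - j = c + (d + 1) - j by omega]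

/-- The lengths of the strings in the span of the standard monomials. -/
def stringLength (p m₁ m₂ l c : ℕ) : ℕ :=
  if l + p < m₁ + m₂ ∧ p ≤ m₁ + c then p else m₁ - l + c

theorem exists_isString_of_lt (hs : s ≠ 0) (ht : IsPrimitiveRoot (s ^ 2) p) (hp : 1 < p)
    {k m₁ m₂ i l c : ℕ} (hl : k ≤ l) (hl₁ : l < k + m₁) (hc : c < m₂) (hi : i < p)
    (h : i < k + m₁ - l + c) : ∃ x ∈ stdSpan s k m₁ m₂, IsString s (i, l, c) x := by
  -- Use as many factors `z'` as possible: `d = min i c` keeps `i + l` smallest for the prescribed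
  -- string.
  refine ⟨stdMon s (min i c) (i - min i c) l (c - min i c), stdMon_mem hl (by omega) (by omega), ?_⟩
  have := isString_stdMon (s := s) (l := l) (c := c - min i c) hs ht hp
    (d := min i c) (i := i - min i c) (by omega)
  rwa [Nat.sub_add_cancel (min_le_left _ _), Nat.sub_add_cancel (min_le_right _ _)] at this

theorem exists_isString_of_le {M : Submodule ℂ (TX (Fin 2))} (hM : ∀ x ∈ M, leftDer 0 x ∈ M)
    {i j l c : ℕ} (hij : i ≤ j) (h : ∃ x ∈ M, IsString s (j, l, c) x) :
    ∃ x ∈ M, IsString s (i, l, c) x := by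
  obtain ⟨j, rfl⟩ := Nat.exists_eq_add_of_le hij
  obtain ⟨x, hx, r, hr, h1⟩ := h
  refine ⟨(leftDer 0 ^ j) x, ?_, r, hr, ?_⟩
  · clear h1
    induction j with
    | zero => exact hx
    | succ j ih => rw [pow_succ', Module.End.mul_apply]; exact hM _ (ih (by omega))
  · simp only at h1 ⊢
    rw [← h1, pow_add, Module.End.mul_apply]

theorem exists_isString (hs : s ≠ 0) (ht : IsPrimitiveRoot (s ^ 2) p) (hp : 1 < p)
    {m₁ m₂ i l c : ℕ} (hm₂ : m₂ ≤ p) (hl : l < m₁) (hc : c < m₂)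
    (hi : i < stringLength p m₁ m₂ l c) :
    ∃ x ∈ stdSpan s 0 m₁ m₂, IsString s (i, l, c) x := by
  rw [stringLength] at hi
  split_ifs at hi with h
  · refine exists_isString_of_le (leftDer_zero_mem_stdSpan hs (ht.ne_one hp)) (j := p - 1)
      (by omega) ?_
    by_cases hN : m₁ - l + c < p
    · refine ⟨stdMon s (c + (p - (m₁ - l + c))) (p - 1 - c) (l - (p - (m₁ - l + c))) 0,
        stdMon_mem (by omega) (by omega) (by omega), ?_⟩
      have := isString_stdMon_carry (s := s) hs ht hp (d := c + (p - (m₁ - l + c)))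
        (i := p - 1 - c) (j := p - (m₁ - l + c)) (l := l - (p - (m₁ - l + c))) (c := 0)
        (by omega) (by omega) (by omega) (by omega)
      rwa [show l - (p - (m₁ - l + c)) + (p - (m₁ - l + c)) = l by omega,
        show 0 + (c + (p - (m₁ - l + c))) - (p - (m₁ - l + c)) = c by omega] at this
    · exact exists_isString_of_lt hs ht hp (by omega) (by omega) hc (by omega) (by omega)
  · exact exists_isString_of_lt hs ht hp (by omega) (by omega) hc (by omega) (by omega)

/-- The index set of the strings over the rectangle `k ≤ l < k + m₁`, `c < m₂`. -/
def stringFinset (k m₁ m₂ : ℕ) (N : ℕ → ℕ → ℕ) : Finset (ℕ × ℕ × ℕ) :=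
  (((Finset.range m₁ ×ˢ Finset.range m₂).sigma fun υ => Finset.range (N (k + υ.1) υ.2)).map
    ⟨fun x => (x.2, k + x.1.1, x.1.2), by
      rintro ⟨⟨_, _⟩, _⟩ ⟨⟨_, _⟩, _⟩ h
      simp only [Prod.mk.injEq, add_right_inj] at h
      obtain ⟨rfl, rfl, rfl⟩ := h
      rfl⟩)

theorem mem_stringFinset {k m₁ m₂ : ℕ} {N : ℕ → ℕ → ℕ} {σ : ℕ × ℕ × ℕ}
    (h : σ ∈ stringFinset k m₁ m₂ N) :
    k ≤ σ.2.1 ∧ σ.2.1 < k + m₁ ∧ σ.2.2 < m₂ ∧ σ.1 < N σ.2.1 σ.2.2 := by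
  obtain ⟨x, hx, rfl⟩ := Finset.mem_map.mp h
  simp only [Finset.mem_sigma, Finset.mem_product, Finset.mem_range] at hx
  change k ≤ k + x.1.1 ∧ k + x.1.1 < k + m₁ ∧ x.1.2 < m₂ ∧ x.2 < N (k + x.1.1) x.1.2
  omega

theorem card_stringFinset (k m₁ m₂ : ℕ) (N : ℕ → ℕ → ℕ) : (stringFinset k m₁ m₂ N).card =
    ∑ l ∈ Finset.range m₁, ∑ c ∈ Finset.range m₂, N (k + l) c := by
  rw [stringFinset, Finset.card_map, Finset.card_sigma, Finset.sum_product]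
  simp

/-! ### Counting the strings -/

theorem two_mul_sum_length (m₁ m₂ : ℕ) :
    2 * ∑ l ∈ Finset.range m₁, ∑ c ∈ Finset.range m₂, (m₁ - l + c) = m₁ * m₂ * (m₁ + m₂) := by
  have h1 : ∀ a m : ℕ, 2 * ∑ c ∈ Finset.range m, (a + c) + m = m * (2 * a + m) := by
    intro a m
    induction m with
    | zero => simp
    | succ m ih => rw [Finset.sum_range_succ]; linarith
  induction m₁ with
  | zero => simp
  | succ m ih =>
    rw [Finset.sum_range_succ', mul_add]
    simp only [Nat.add_sub_add_right, ih, Nat.sub_zero]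
    have := h1 (m + 1) m₂
    nlinarith

/-- For `k = m₁ + m₂ - p > 0` the two lengths can differ only on the square `l < k`, `c = p - m₁ +
r`, `r < k`. There `m₁ - l + c = p - l + r`, and the deviations `r - l` sum to zero by symmetry. -/
theorem two_mul_sum_stringLength (p m₁ m₂ : ℕ) (hm₁ : m₁ ≤ p) (hm₂ : m₂ ≤ p) :
    2 * ∑ l ∈ Finset.range m₁, ∑ c ∈ Finset.range m₂, stringLength p m₁ m₂ l c =
      m₁ * m₂ * (m₁ + m₂) := by
  rw [← two_mul_sum_length]
  congr 1
  rcases le_total (m₁ + m₂) p with h | h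
  · refine Finset.sum_congr rfl fun l _ => Finset.sum_congr rfl fun c _ => ?_
    rw [stringLength, if_neg (by omega)]
  · obtain ⟨k, hk⟩ := Nat.exists_eq_add_of_le h
    obtain ⟨u, rfl⟩ : ∃ u, m₁ = k + u := ⟨p - m₂, by omega⟩
    obtain ⟨v, rfl⟩ : ∃ v, m₂ = v + k := ⟨m₂ - k, by omega⟩
    obtain rfl : p = k + u + v := by omega
    rw [Finset.sum_range_add, Finset.sum_range_add]
    congr 1
    · simp only [Finset.sum_range_add]
      rw [Finset.sum_add_distrib, Finset.sum_add_distrib]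
      congr 1
      · refine Finset.sum_congr rfl fun l hl => Finset.sum_congr rfl fun c hc => ?_
        rw [Finset.mem_range] at hl hc
        rw [stringLength, if_neg (by omega)]
      · have h1 : ∀ l ∈ Finset.range k, ∀ r ∈ Finset.range k,
            stringLength (k + u + v) (k + u) (v + k) l (v + r) + r = k + u - l + (v + r) + l := by
          intro l hl r hr
          rw [Finset.mem_range] at hl hr
          rw [stringLength, if_pos (by omega)]
          omega
        have h2 := Finset.sum_congr rfl fun l hl => Finset.sum_congr rfl (h1 l hl)
        have h3 : ∑ l ∈ Finset.range k, ∑ _r ∈ Finset.range k, l =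
            ∑ _l ∈ Finset.range k, ∑ r ∈ Finset.range k, r := Finset.sum_comm
        have h4 : ∀ f g : ℕ → ℕ → ℕ, ∑ l ∈ Finset.range k, ∑ r ∈ Finset.range k, (f l r + g l r) =
            ∑ l ∈ Finset.range k, ∑ r ∈ Finset.range k, f l r +
              ∑ l ∈ Finset.range k, ∑ r ∈ Finset.range k, g l r := fun f g => by
          simp only [Finset.sum_add_distrib]
        rw [h4 (fun l r => stringLength _ _ _ l (v + r)) (fun _ r => r),
          h4 (fun l r => k + u - l + (v + r)) (fun l _ => l), h3] at h2
        exact Nat.add_right_cancel h2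
    · refine Finset.sum_congr rfl fun l hl => Finset.sum_congr rfl fun c hc => ?_
      rw [Finset.mem_range] at hl hc
      rw [stringLength, if_neg (by omega)]

theorem two_mul_finrank_stdSpan (hs : s ≠ 0) (ht : IsPrimitiveRoot (s ^ 2) p) (hp : 1 < p)
    {m₁ m₂ : ℕ} (hm₁ : m₁ ≤ p) (hm₂ : m₂ ≤ p) :
    2 * Module.finrank ℂ (stdSpan s 0 m₁ m₂) = m₁ * m₂ * (m₁ + m₂) := by
  refine le_antisymm (two_mul_finrank_stdSpan_le hs 0 m₁ m₂) ?_
  have := finiteDimensional_stdSpan hs 0 m₁ m₂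
  rw [← two_mul_sum_stringLength p m₁ m₂ hm₁ hm₂]
  have h := card_le_finrank_of_isString hs ht hp
    (stringFinset 0 m₁ m₂ (stringLength p m₁ m₂))
    (fun σ hσ => by have := mem_stringFinset hσ; omega) (M := stdSpan s 0 m₁ m₂) (fun σ hσ => by
      have := mem_stringFinset hσ
      exact exists_isString hs ht hp hm₂ (l := σ.2.1) (c := σ.2.2) (by omega) (by omega) this.2.2.2)
  rw [card_stringFinset] at h
  simp only [zero_add] at h
  omega

/-- The hypothesis keeps every string shorter than `p`, so no carry occurs. -/
theorem two_mul_finrank_stdSpan_shift (hs : s ≠ 0) (ht : IsPrimitiveRoot (s ^ 2) p) (hp : 1 < p)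
    {k m₁ m₂ : ℕ} (h : k + m₁ + m₂ ≤ p) :
    2 * Module.finrank ℂ (stdSpan s k m₁ m₂) = m₁ * m₂ * (m₁ + m₂) := by
  refine le_antisymm (two_mul_finrank_stdSpan_le hs k m₁ m₂) ?_
  have := finiteDimensional_stdSpan hs k m₁ m₂
  rw [← two_mul_sum_length]
  have h := card_le_finrank_of_isString hs ht hp
    (stringFinset k m₁ m₂ fun l c => k + m₁ - l + c)
    (fun σ hσ => by have := mem_stringFinset hσ; omega) (M := stdSpan s k m₁ m₂) (fun σ hσ => by
      have := mem_stringFinset hσ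
      exact exists_isString_of_lt hs ht hp (i := σ.1) (l := σ.2.1) (c := σ.2.2) (by omega)
        (by omega) (by omega) (by omega) (by omega))
  rw [card_stringFinset] at h
  simp only [Nat.add_sub_add_left] at h
  omega

end

end NicholsYD

namespace NicholsYD

noncomputable section

/-! ### The submodule generated by the vertex in type `A₂` -/

variable {s : ℂ} {p : ℕ}

theorem pow_ne_pow (hs : s ≠ 0) (ht : IsPrimitiveRoot (s ^ 2) p) {m n : ℕ} (h : m ≤ n)
    (hd : ¬ p ∣ n - m) : (s ^ 2) ^ m ≠ (s ^ 2) ^ n := by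
  obtain ⟨j, rfl⟩ := Nat.exists_eq_add_of_le h
  rw [Nat.add_sub_cancel_left] at hd
  rw [pow_add]
  intro h1
  have h2 := pow_ne_zero m (pow_ne_zero 2 hs)
  exact one_sub_pow_ne_zero ht hd (mul_left_cancel₀ h2 (by linear_combination h1))

theorem not_dvd_of_lt_two_mul {n : ℕ} (h₀ : p < n) (h : n < 2 * p) : ¬ p ∣ n := by
  rintro ⟨j, rfl⟩
  have h1 : 1 < j := by by_contra! hj; nlinarith
  nlinarith

variable {a b : Fin 2 → ℂ} {M : Submodule ℂ (TX (Fin 2))}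

theorem generated_act_mem (c : Matrix (Fin 2) (Fin 2) ℂ) (i : Fin 2) {x : TX (Fin 2)}
    (hx : x ∈ generatedByVertex c a b) : act c a b (word [i]) x ∈ generatedByVertex c a b :=
  act_mem_generated c a b (letter_mem_nichols c i) hx

theorem pbw_succ_right_mem (hs : s ≠ 0) (ht : s ^ 2 ≠ 1)
    (h₁ : M ≤ M.comap (act (cartanA2 s) a b (word [1]))) {i l c : ℕ}
    (h : pbw s i l c ∈ M) (h' : i ≠ 0 → pbw s (i - 1) (l + 1) c ∈ M)
    (hc : 1 - a 1 * b 1 * (s ^ 2) ^ c ≠ 0) : pbw s i l (c + 1) ∈ M := by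
  have h2 := h₁ h
  rw [Submodule.mem_comap, act_one_pbw a b hs ht, sub_eq_add_neg, M.add_mem_iff_left] at h2
  · exact (M.smul_mem_iff (mul_ne_zero (pow_ne_zero _ (pow_ne_zero _ hs)) hc)).mp h2
  · cases i with
    | zero => simp
    | succ i => exact neg_mem (M.smul_mem _ (h' (by omega)))

/-- The combination of `F₁ F₀` and `F₀ F₁` applied to `z ^ l` is chosen so that the term `x z ^ l y`
cancels; a multiple of `z ^ (l + 1)` remains. -/
theorem pbw_succ_mid_mem (hs : s ≠ 0) (ht : s ^ 2 ≠ 1)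
    (h₀ : M ≤ M.comap (act (cartanA2 s) a b (word [0])))
    (h₁ : M ≤ M.comap (act (cartanA2 s) a b (word [1]))) {l : ℕ} (h : pbw s 0 l 0 ∈ M)
    (hl : 1 - a 0 * b 0 * (s ^ 2) ^ l ≠ 0)
    (hl' : s ^ 2 - a 0 * b 0 * (a 1 * b 1) * (s ^ 2) ^ l ≠ 0) : pbw s 0 (l + 1) 0 ∈ M := by
  have h2 := sub_mem (M.smul_mem (s * (s ^ 2 - a 0 * b 0 * (s ^ 2) ^ l)) (h₁ (h₀ h)))
    (M.smul_mem (s ^ 2 * (1 - a 0 * b 0 * (s ^ 2) ^ l)) (h₀ (h₁ h)))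
  have h3 : s ^ (l + 1) * (1 - s ^ 2) * (s ^ 2)⁻¹ * (1 - a 0 * b 0 * (s ^ 2) ^ l) *
      (s ^ 2 - a 0 * b 0 * (a 1 * b 1) * (s ^ 2) ^ l) ≠ 0 :=
    mul_ne_zero (mul_ne_zero (mul_ne_zero (mul_ne_zero (pow_ne_zero _ hs)
      (sub_ne_zero.mpr ht.symm)) (inv_ne_zero (pow_ne_zero _ hs))) hl) hl'
  rw [← M.smul_mem_iff h3, ← M.neg_mem_iff]
  convert h2 using 1
  refine ext_coeff fun w => ?_
  simp [act_zero_pbw a b hs ht, act_one_pbw a b hs ht]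
  field_simp
  ring

/-- On the top row `F₁` cannot raise the exponent of `y` any further, so `F₁ F₀` maps `z ^ l y ^ c`
directly to a multiple of `z ^ (l + 1) y ^ c`. -/
theorem pbw_succ_mid_top_mem (hs : s ≠ 0) (ht : s ^ 2 ≠ 1)
    (h₀ : M ≤ M.comap (act (cartanA2 s) a b (word [0])))
    (h₁ : M ≤ M.comap (act (cartanA2 s) a b (word [1]))) {l c : ℕ} (h : pbw s 0 l c ∈ M)
    (hc : a 1 * b 1 * (s ^ 2) ^ c = 1)
    (hl : 1 - a 0 * b 0 * (s ^ 2) ^ l ≠ 0) : pbw s 0 (l + 1) c ∈ M := by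
  have h2 := Submodule.mem_comap.mp (h₁ (h₀ h))
  have h3 : s ^ (l + c) * (1 - s ^ 2) * (s ^ 2)⁻¹ * (1 - a 0 * b 0 * (s ^ 2) ^ l) ≠ 0 :=
    mul_ne_zero (mul_ne_zero (mul_ne_zero (pow_ne_zero _ hs)
      (sub_ne_zero.mpr ht.symm)) (inv_ne_zero (pow_ne_zero _ hs))) hl
  rw [← M.smul_mem_iff h3, ← M.neg_mem_iff]
  convert h2 using 1
  have h4 : a 1 * b 1 = ((s ^ 2) ^ c)⁻¹ := eq_inv_of_mul_eq_one_left hc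
  refine ext_coeff fun w => ?_
  cases c with
  | zero =>
    simp [act_zero_pbw a b hs ht, act_one_pbw a b hs ht, h4]
    field_simp
  | succ c =>
    simp [act_zero_pbw a b hs ht, act_one_pbw a b hs ht, h4]
    field_simp
    ring

/-- For a positive `z`-exponent `l + 1`, `leftDer 1` also produces `x z ^ l y ^ (c + 1)`;
subtracting a multiple of `F₀ ▸ leftDer 0 (leftDer 1 _)` removes it. -/
theorem pbw_pred_right_mem (hs : s ≠ 0) (ht : s ^ 2 ≠ 1)
    (h₀ : M ≤ M.comap (act (cartanA2 s) a b (word [0])))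
    (hD : ∀ k, M ≤ M.comap (leftDer k)) {l c : ℕ} (h : pbw s 0 l (c + 1) ∈ M)
    (hc : qInt (s ^ 2) (c + 1) ≠ 0) (hc' : (s ^ 2) ^ (c + 2) - a 0 * b 0 ≠ 0) :
    pbw s 0 l c ∈ M := by
  have ht' : 1 - s ^ 2 ≠ 0 := sub_ne_zero.mpr (Ne.symm ht)
  have h1 := hD 1 h
  cases l with
  | zero =>
    rw [Submodule.mem_comap, leftDer_one_pbw] at h1
    simpa [hc] using (M.smul_mem_iff hc).mp (by simpa using h1)
  | succ l =>
    have h2 := sub_mem (M.smul_mem ((s ^ 2) ^ (c + 2) - a 0 * b 0 * (s ^ 2) ^ (l + 1)) h1)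
      (M.smul_mem ((s ^ 2) ^ (c + 2)) (h₀ (hD 0 h1)))
    rw [← M.smul_mem_iff (mul_ne_zero hc hc')]
    convert h2 using 1
    refine ext_coeff fun w => ?_
    rw [qInt]
    simp [leftDer_one_pbw, leftDer_zero_pbw, act_zero_pbw a b hs ht, qInt]
    field_simp
    ring

theorem pbw_pred_mid_mem (hs : s ≠ 0) (ht : IsPrimitiveRoot (s ^ 2) p) (hp : 1 < p)
    (hD : ∀ k, M ≤ M.comap (leftDer k)) {l c : ℕ} (h : pbw s 0 (l + 1) c ∈ M)
    (hl : l + 1 < p) : pbw s 0 l c ∈ M := by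
  have h1 := Submodule.mem_comap.mp (hD 0 (hD 1 h))
  have h2 := qInt_ne_zero ht hp (not_dvd_of_lt (Nat.succ_pos l) hl)
  have h3 := qInt_ne_zero ht hp (not_dvd_of_lt one_pos hp)
  rw [← M.smul_mem_iff (mul_ne_zero (mul_ne_zero h2 (pow_ne_zero (l + c) (inv_ne_zero hs))) h3)]
  convert h1 using 1
  simp [leftDer_one_pbw, leftDer_zero_pbw, smul_smul, mul_assoc]

/-- A stable subspace that contains all powers of `z` contains all standard monomials. -/
theorem stdSpan_le_of_stable (hs : s ≠ 0) (ht : IsPrimitiveRoot (s ^ 2) p) (hp : 1 < p)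
    {m₁ m₂ : ℕ} (hm₁ : m₁ ≤ p) (hm₂ : m₂ ≤ p)
    (hA₀ : a 0 * b 0 * (s ^ 2) ^ (m₁ - 1) = 1) (hA₁ : a 1 * b 1 * (s ^ 2) ^ (m₂ - 1) = 1)
    (h₀ : M ≤ M.comap (act (cartanA2 s) a b (word [0])))
    (h₁ : M ≤ M.comap (act (cartanA2 s) a b (word [1])))
    (h : ∀ l < m₁, pbw s 0 l 0 ∈ M) : stdSpan s 0 m₁ m₂ ≤ M := by
  have ht1 := ht.ne_one hp
  have hne : ∀ {A : ℂ} {m n : ℕ}, m ≤ p → A * (s ^ 2) ^ (m - 1) = 1 → n + 1 < m →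
      1 - A * (s ^ 2) ^ n ≠ 0 := by
    intro A m n hm hA hn h2
    refine pow_ne_pow hs ht (m := n) (n := m - 1) (by omega)
      (not_dvd_of_lt (by omega) (by omega)) ?_
    linear_combination -(s ^ 2) ^ n * hA - (s ^ 2) ^ (m - 1) * h2
  have e1 : ∀ i l, i + l < m₁ → pbw s i l 0 ∈ M := by
    intro i l hil
    induction i with
    | zero => exact h l (by omega)
    | succ i ih =>
      have h2 := h₀ (ih (by omega))
      rw [Submodule.mem_comap, act_zero_pbw a b hs ht1] at h2
      simp only [pow_zero, inv_one, mul_one, sub_self, zero_mul, zero_smul, add_zero] at h2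
      rw [M.smul_mem_iff (pow_ne_zero _ hs), M.smul_mem_iff (hne hm₁ hA₀ (by omega))] at h2
      exact h2
  have e2 : ∀ c < m₂, ∀ i l, i + l < m₁ → pbw s i l c ∈ M := by
    intro c hc
    induction c with
    | zero => exact e1
    | succ c ih =>
      intro i l hil
      exact pbw_succ_right_mem hs ht1 h₁ (ih (by omega) i l hil)
        (fun hi => ih (by omega) _ _ (by omega)) (hne hm₂ hA₁ hc)
  refine stdSpan_le fun d i l c _ hil hdc => ?_
  rw [zero_add] at hil
  induction d generalizing i l c with
  | zero => exact e2 c hdc i l hil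
  | succ d ih =>
    -- Here `F₀` trades one `y` for a `z'`. Its other term raises `i`: it lies in `M` inside the box
    -- and has coefficient zero on the edge.
    have h2 := h₀ (ih i l (c + 1) (Nat.zero_le _) hil (by omega))
    rw [Submodule.mem_comap, act_zero_stdMon a b hs ht1, M.sub_mem_iff_right,
      Nat.add_sub_cancel] at h2
    · refine (M.smul_mem_iff ?_).mp h2
      have hA : a 0 * b 0 ≠ 0 := left_ne_zero_of_mul_eq_one hA₀
      have := one_sub_pow_ne_zero ht (not_dvd_of_lt (Nat.succ_pos c) (by omega))
      exact mul_ne_zero (pow_ne_zero _ hs) (mul_ne_zero (mul_ne_zero (mul_ne_zero this hA)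
        (pow_ne_zero _ (pow_ne_zero _ hs))) (inv_ne_zero (pow_ne_zero _ (pow_ne_zero _ hs))))
    · by_cases h3 : i + l + 1 < m₁
      · exact M.smul_mem _ (ih (i + 1) l (c + 1) (Nat.zero_le _) (by omega) (by omega))
      · rw [show i + l = m₁ - 1 by omega, hA₀]
        simp

end

end NicholsYD

namespace NicholsYD

noncomputable section

variable {s : ℂ} {p : ℕ} {a b : Fin 2 → ℂ}

/-! ### The elements `z ^ l y ^ c` generated by the vertex -/

/-- Within the range, the step from `z ^ l` to `z ^ (l + 1)` fails only if `p` divides `m₁ + m₂ - 1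
- l`. This never happens for `m₁ + m₂ ≤ p`, and otherwise first at `l = m₁ + m₂ - p - 1`. -/
theorem pbw_zero_mid_mem_generated (hs : s ≠ 0) (ht : IsPrimitiveRoot (s ^ 2) p) (hp : 1 < p)
    {m₁ m₂ : ℕ} (hm₁ : m₁ ≤ p) (hm₂ : m₂ ≤ p) (hm₂' : 1 ≤ m₂)
    (hA₀ : a 0 * b 0 * (s ^ 2) ^ (m₁ - 1) = 1) (hA₁ : a 1 * b 1 * (s ^ 2) ^ (m₂ - 1) = 1)
    {l : ℕ} (hl : l < m₁) (hl' : m₁ + m₂ ≤ p ∨ l + p < m₁ + m₂) :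
    pbw s 0 l 0 ∈ generatedByVertex (cartanA2 s) a b := by
  induction l with
  | zero => rw [pbw_zero]; exact word_nil_mem_generated _ a b
  | succ l ih =>
    have ht0 : s ^ 2 ≠ 0 := pow_ne_zero 2 hs
    refine pbw_succ_mid_mem hs (ht.ne_one hp) (fun x => generated_act_mem _ 0)
      (fun x => generated_act_mem _ 1) (ih (by omega) (by omega)) ?_ ?_
    · intro h
      refine pow_ne_pow hs ht (m := l) (n := m₁ - 1) (by omega)
        (not_dvd_of_lt (by omega) (by omega)) ?_
      linear_combination -(s ^ 2) ^ l * hA₀ - (s ^ 2) ^ (m₁ - 1) * h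
    · intro h
      have hd : ¬ p ∣ m₁ - 1 + (m₂ - 1) + 1 - l := by
        rcases hl' with h | h
        · exact not_dvd_of_lt (by omega) (by omega)
        · exact not_dvd_of_lt_two_mul (by omega) (by omega)
      refine pow_ne_pow hs ht (by omega) hd ?_
      rw [pow_succ, pow_add]
      linear_combination -(a 1 * b 1 * (s ^ 2) ^ (m₂ - 1) * (s ^ 2) ^ l) * hA₀ -
        (s ^ 2) ^ l * hA₁ - (s ^ 2) ^ (m₁ - 1) * (s ^ 2) ^ (m₂ - 1) * h

/-- The obstruction is bypassed along the top row: raise `y` to `m₂ - 1`, then `z` to `l`, then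
lower `y` to `c`. Lowering from `c + 1` fails only if `p` divides `m₁ + c + 1`, a number strictly
between `p` and `2 p`. -/
theorem pbw_zero_mem_generated (hs : s ≠ 0) (ht : IsPrimitiveRoot (s ^ 2) p) (hp : 1 < p)
    {m₁ m₂ : ℕ} (hm₁ : m₁ ≤ p) (hm₂ : m₂ ≤ p) (hm₂' : 1 ≤ m₂)
    (hA₀ : a 0 * b 0 * (s ^ 2) ^ (m₁ - 1) = 1) (hA₁ : a 1 * b 1 * (s ^ 2) ^ (m₂ - 1) = 1)
    {l c : ℕ} (hl : l < m₁) (hc : p ≤ m₁ + c) (hc' : c < m₂) :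
    pbw s 0 l c ∈ generatedByVertex (cartanA2 s) a b := by
  have ht1 := ht.ne_one hp
  have hne : ∀ {A : ℂ} {m n : ℕ}, m ≤ p → A * (s ^ 2) ^ (m - 1) = 1 → n + 1 < m →
      1 - A * (s ^ 2) ^ n ≠ 0 := by
    intro A m n hm hA hn h2
    refine pow_ne_pow hs ht (m := n) (n := m - 1) (by omega)
      (not_dvd_of_lt (by omega) (by omega)) ?_
    linear_combination -(s ^ 2) ^ n * hA - (s ^ 2) ^ (m - 1) * h2
  have e1 : ∀ c < m₂, pbw s 0 0 c ∈ generatedByVertex (cartanA2 s) a b := by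
    intro c hc
    induction c with
    | zero => rw [pbw_zero]; exact word_nil_mem_generated _ a b
    | succ c ih =>
      exact pbw_succ_right_mem hs ht1 (fun x => generated_act_mem _ 1) (ih (by omega))
        (fun h => absurd rfl h) (hne hm₂ hA₁ hc)
  have e2 : ∀ l < m₁, pbw s 0 l (m₂ - 1) ∈ generatedByVertex (cartanA2 s) a b := by
    intro l hl
    induction l with
    | zero => exact e1 _ (by omega)
    | succ l ih =>
      exact pbw_succ_mid_top_mem hs ht1 (fun x => generated_act_mem _ 0)
        (fun x => generated_act_mem _ 1) (ih (by omega)) hA₁ (hne hm₁ hA₀ hl)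
  obtain ⟨n, hn⟩ : ∃ n, c + n = m₂ - 1 := ⟨m₂ - 1 - c, by omega⟩
  induction n generalizing c with
  | zero => rw [show c = m₂ - 1 by omega]; exact e2 l hl
  | succ n ih =>
    refine pbw_pred_right_mem hs ht1 (fun x => generated_act_mem _ 0)
      (fun k x => leftDer_mem_generated _ a b k) (ih (by omega) (by omega) (by omega))
      (qInt_ne_zero ht hp (not_dvd_of_lt (by omega) (by omega))) fun h => ?_
    refine pow_ne_pow hs ht (m := 0) (n := c + 2 + (m₁ - 1)) (by omega)
      (not_dvd_of_lt_two_mul (by omega) (by omega)) ?_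
    rw [pow_zero, pow_add]
    linear_combination -hA₀ - (s ^ 2) ^ (m₁ - 1) * h

/-- A functional with prescribed values on the PBW basis elements of multidegree `(k, k)`. -/
theorem exists_pbw_functional (hs : s ≠ 0) (ht : IsPrimitiveRoot (s ^ 2) p) (hp : 1 < p)
    {k : ℕ} (hk : k < p) (f : ℕ → ℂ) : ∃ φ : TX (Fin 2) →ₗ[ℂ] ℂ, ∀ i l c,
      φ (pbw s i l c) = if i + l = k ∧ l + c = k then f l else 0 := by
  have hli := linearIndepOn_of_isString hs ht hp
    (Finset.range p ×ˢ Finset.range p ×ˢ Finset.range p)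
    (fun σ hσ => by simpa using (by simpa using hσ : _ ∧ _ ∧ _).2)
    (x := fun σ => pbw s σ.1 σ.2.1 σ.2.2)
    (fun σ hσ => isString_pbw hs ht hp (by simpa using (Finset.mem_product.mp hσ).1))
  obtain ⟨φ, hφ⟩ := ((Module.Basis.span hli).constr ℂ fun σ =>
    if σ.1.1 + σ.1.2.1 = k ∧ σ.1.2.1 + σ.1.2.2 = k then f σ.1.2.1 else 0).exists_extend
  refine ⟨φ, fun i l c => ?_⟩
  by_cases h : i < p ∧ l < p ∧ c < p
  · have h1 := Module.Basis.constr_basis (Module.Basis.span hli) ℂ (fun σ =>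
      if σ.1.1 + σ.1.2.1 = k ∧ σ.1.2.1 + σ.1.2.2 = k then f σ.1.2.1 else 0)
      ⟨(i, l, c), by simpa using h⟩
    rw [← hφ, LinearMap.comp_apply, Submodule.subtype_apply] at h1
    exact (congrArg φ (Module.Basis.coe_span_apply hli ⟨(i, l, c), by simpa using h⟩)).symm.trans h1
  · rw [pbw_eq_zero ht hp (by omega), map_zero, if_neg (by omega)]

/-- A functional `φ` supported in multidegree `(k, k)` kills the PBW images of `F₀` and `F₁`, and
kills `V` as `k > 0`; so it kills the generated module, but not `z ^ k`. -/
theorem pbw_zero_mid_notMem_generated (hs : s ≠ 0) (ht : IsPrimitiveRoot (s ^ 2) p) (hp : 1 < p)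
    {k m₁ m₂ : ℕ} (hk : 0 < k) (hm₁ : m₁ < p) (hm₂ : m₂ ≤ p) (h : m₁ + m₂ = k + p)
    (hA₀ : a 0 * b 0 * (s ^ 2) ^ (m₁ - 1) = 1) (hA₁ : a 1 * b 1 * (s ^ 2) ^ (m₂ - 1) = 1) :
    pbw s 0 k 0 ∉ generatedByVertex (cartanA2 s) a b := by
  have ht0 : s ^ 2 ≠ 0 := pow_ne_zero 2 hs
  have ht1 := ht.ne_one hp
  -- The ratio `f (l + 1) / f l` is dictated by `φ (F₀ ▸ x ^ i z ^ l y ^ (i + 1)) = 0` with `i + l +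
  -- 1 = k`. The condition for `F₁` gives the same ratio because `m₁ + m₂ = k + p`.
  set f : ℕ → ℂ := fun l => ∏ j ∈ Finset.range l,
    ((s ^ 2) ^ (j + 1) - (s ^ 2) ^ (m₁ + 1)) / (1 - (s ^ 2) ^ (k - j)) with hf
  have hden : ∀ j < k, 1 - (s ^ 2) ^ (k - j) ≠ 0 := fun j hj =>
    one_sub_pow_ne_zero ht (not_dvd_of_lt (by omega) (by omega))
  have hrec : ∀ l < k, f (l + 1) * (1 - (s ^ 2) ^ (k - l)) =
      ((s ^ 2) ^ (l + 1) - (s ^ 2) ^ (m₁ + 1)) * f l := by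
    intro l hl
    have := hden l hl
    rw [hf]
    simp only [Finset.prod_range_succ]
    field_simp
  have hfk : f k ≠ 0 := Finset.prod_ne_zero_iff.mpr fun j hj => by
    rw [Finset.mem_range] at hj
    exact div_ne_zero (sub_ne_zero.mpr (pow_ne_pow hs ht (by omega)
      (not_dvd_of_lt (by omega) (by omega)))) (hden j hj)
  obtain ⟨φ, hφ⟩ := exists_pbw_functional hs ht hp (show k < p by omega) f
  set P : Submodule ℂ (TX (Fin 2)) := Submodule.span ℂ {x | ∃ i l c, pbw s i l c = x} with hP
  have hPm : ∀ i l c, pbw s i l c ∈ P := fun i l c => Submodule.subset_span ⟨i, l, c, rfl⟩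
  have h₀ : P ≤ (P ⊓ LinearMap.ker φ).comap (act (cartanA2 s) a b (word [0])) := by
    rw [hP, Submodule.span_le]
    rintro _ ⟨i, l, c, rfl⟩
    rw [SetLike.mem_coe, Submodule.mem_comap, act_zero_pbw a b hs ht1]
    refine ⟨Submodule.smul_mem _ _ (add_mem (Submodule.smul_mem _ _ (hPm _ _ _))
      (Submodule.smul_mem _ _ (hPm _ _ _))), ?_⟩
    rw [SetLike.mem_coe, LinearMap.mem_ker]
    simp only [map_smul, map_add, hφ, smul_eq_mul]
    by_cases hw : i + 1 + l = k ∧ l + c = k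
    · obtain rfl : c = i + 1 := by omega
      rw [if_pos hw, if_pos (by omega)]
      have h1 := hrec l (by omega)
      rw [show k - l = i + 1 by omega, pow_succ _ m₁] at h1
      have h2 : a 0 * b 0 * (s ^ 2) ^ m₁ = s ^ 2 := by
        rw [show m₁ = m₁ - 1 + 1 by omega, pow_succ, ← mul_assoc, hA₀, one_mul]
      rw [mul_eq_zero]
      right
      field_simp
      linear_combination (s ^ 2) ^ i * (a 0 * b 0) * h1 - (s ^ 2) ^ (i + 1) * f l * h2
    · rw [if_neg hw]
      cases c with
      | zero => simp
      | succ c => rw [if_neg (by omega)]; simp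
  have h₁ : P ≤ (P ⊓ LinearMap.ker φ).comap (act (cartanA2 s) a b (word [1])) := by
    rw [hP, Submodule.span_le]
    rintro _ ⟨i, l, c, rfl⟩
    rw [SetLike.mem_coe, Submodule.mem_comap, act_one_pbw a b hs ht1]
    refine ⟨sub_mem (Submodule.smul_mem _ _ (hPm _ _ _)) (Submodule.smul_mem _ _ (hPm _ _ _)), ?_⟩
    rw [SetLike.mem_coe, LinearMap.mem_ker]
    simp only [map_smul, map_sub, hφ, smul_eq_mul]
    by_cases hw : i + l = k ∧ l + (c + 1) = k
    · obtain rfl : i = c + 1 := by omega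
      rw [if_pos hw, if_pos (by omega)]
      have h1 := hrec l (by omega)
      rw [show k - l = c + 1 by omega] at h1
      have h2 : (s ^ 2) ^ (m₁ + 1) = a 1 * b 1 * (s ^ 2) ^ (c + l + 1) := by
        have h3 : (s ^ 2) ^ (m₁ + 1) * (s ^ 2) ^ (m₂ - 1) = (s ^ 2) ^ (c + l + 1) := by
          rw [← pow_add, show m₁ + 1 + (m₂ - 1) = c + l + 1 + p by omega, pow_add _ _ p,
            ht.pow_eq_one, mul_one]
        linear_combination (a 1 * b 1) * h3 - (s ^ 2) ^ (m₁ + 1) * hA₁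
      rw [h2] at h1
      field_simp
      linear_combination -h1
    · rw [if_neg hw]
      cases i with
      | zero => simp
      | succ i => rw [if_neg (by omega)]; simp
  have hle : generatedByVertex (cartanA2 s) a b ≤ P ⊓ LinearMap.ker φ := by
    refine generated_le_of_stable a b ?_ (fun x hx => h₀ hx.1) fun x hx => h₁ hx.1
    rw [← pbw_zero s]
    refine ⟨hPm _ _ _, ?_⟩
    rw [SetLike.mem_coe, LinearMap.mem_ker, hφ, if_neg (by omega)]
  intro hmem
  have h1 := (hle hmem).2
  rw [SetLike.mem_coe, LinearMap.mem_ker, hφ, if_pos (by omega)] at h1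
  exact hfk h1

/-- A member `z ^ l y ^ c` could be lowered, first in `c` and then in `l`, down to `z ^ k`. Now the
critical number `m₁ + c + 1` stays below `p`. -/
theorem pbw_zero_notMem_generated (hs : s ≠ 0) (ht : IsPrimitiveRoot (s ^ 2) p) (hp : 1 < p)
    {k m₁ m₂ l c : ℕ} (hk : 0 < k) (hm₂ : m₂ ≤ p) (h : m₁ + m₂ = k + p)
    (hA₀ : a 0 * b 0 * (s ^ 2) ^ (m₁ - 1) = 1) (hA₁ : a 1 * b 1 * (s ^ 2) ^ (m₂ - 1) = 1)
    (hl : k ≤ l) (hl' : l < p) (hc : m₁ + c < p) :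
    pbw s 0 l c ∉ generatedByVertex (cartanA2 s) a b := by
  induction c with
  | zero =>
    induction l, hl using Nat.le_induction with
    | base => exact pbw_zero_mid_notMem_generated hs ht hp hk hc hm₂ h hA₀ hA₁
    | succ l hl ih =>
      exact fun hmem => ih (by omega) (pbw_pred_mid_mem hs ht hp
        (fun k x => leftDer_mem_generated _ a b k) hmem hl')
  | succ c ih =>
    refine fun hmem => ih (by omega) (pbw_pred_right_mem hs (ht.ne_one hp)
      (fun x => generated_act_mem _ 0) (fun k x => leftDer_mem_generated _ a b k) hmem
      (qInt_ne_zero ht hp (not_dvd_of_lt (by omega) (by omega))) fun h1 => ?_)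
    refine pow_ne_pow hs ht (m := 0) (n := c + 2 + (m₁ - 1)) (by omega)
      (not_dvd_of_lt (by omega) (by omega)) ?_
    rw [pow_zero, pow_add]
    linear_combination -hA₀ - (s ^ 2) ^ (m₁ - 1) * h1

theorem stdMon_mem_span_pbw (ht : IsPrimitiveRoot (s ^ 2) p) (hp : 1 < p) {k v d i l c : ℕ}
    (hl : k ≤ l) (hl' : l + d < p) (hc : c + d < v) :
    stdMon s d i l c ∈ Submodule.span ℂ ((fun σ : ℕ × ℕ × ℕ => pbw s σ.1 σ.2.1 σ.2.2) ''
      (Finset.range p ×ˢ Finset.Ico k p ×ˢ Finset.range v : Finset (ℕ × ℕ × ℕ))) := by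
  induction d generalizing i l c with
  | zero =>
    by_cases hi : i < p
    · exact Submodule.subset_span ⟨(i, l, c), by simpa using ⟨hi, ⟨hl, hl'⟩, hc⟩, rfl⟩
    · rw [stdMon, pbw_eq_zero ht hp (Or.inl (not_lt.mp hi))]
      exact zero_mem _
  | succ d ih =>
    exact sub_mem (Submodule.smul_mem _ _ (ih hl (by omega) (by omega)))
      (Submodule.smul_mem _ _ (ih (by omega) (by omega) (by omega)))

/-- The second space lies in the span of the strings `x ^ i z ^ l y ^ c` with `k ≤ l` and `c < p -
m₁`, and no end `z ^ l y ^ c` of such a string is in the generated module. -/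
theorem disjoint_generated_stdSpan (hs : s ≠ 0) (ht : IsPrimitiveRoot (s ^ 2) p) (hp : 1 < p)
    {k m₁ m₂ : ℕ} (hk : 0 < k) (hm₁ : m₁ ≤ p) (hm₂ : m₂ ≤ p) (h : m₁ + m₂ = k + p)
    (hA₀ : a 0 * b 0 * (s ^ 2) ^ (m₁ - 1) = 1) (hA₁ : a 1 * b 1 * (s ^ 2) ^ (m₂ - 1) = 1) :
    generatedByVertex (cartanA2 s) a b ⊓ stdSpan s k (p - m₂) (p - m₁) = ⊥ := by
  rw [eq_bot_iff]
  rintro x ⟨hxU, hxW⟩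
  have h1 := (stdSpan_le fun d i l n h₀ h₁ h₂ =>
    stdMon_mem_span_pbw ht hp h₀ (by omega) h₂) hxW
  obtain ⟨r, rfl⟩ := (Submodule.mem_span_image_finset_iff_exists_fun' ℂ).mp h1
  have h2 := string_coeff_eq_zero (s := s) (p := p) (M := generatedByVertex (cartanA2 s) a b)
    (fun θ x => diag_mem_generated _ a b θ) (fun x => leftDer_mem_generated _ a b 0) _
    (fun σ hσ => ?_) (fun σ hσ => ?_) (fun σ hσ => ?_) r hxU
  · exact (Submodule.mem_bot ℂ).mpr (Finset.sum_eq_zero fun σ hσ => by rw [h2 σ hσ, zero_smul])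
  all_goals
    simp only [Finset.mem_product, Finset.mem_range, Finset.mem_Ico] at hσ
  · omega
  · exact pbw_zero_notMem_generated hs ht hp hk hm₂ h hA₀ hA₁ hσ.2.1.1 (by omega) (by omega)
  · exact isString_pbw hs ht hp hσ.1

end

end NicholsYD

namespace NicholsYD

noncomputable section

/-! ### The complement and the dimension -/

variable {s : ℂ} {p : ℕ} {a b : Fin 2 → ℂ}

/-- For `m₁ + m₂ ≤ p`, the vertex generates the whole span of the standard monomials. -/
theorem generated_eq_stdSpan (hs : s ≠ 0) (ht : IsPrimitiveRoot (s ^ 2) p) (hp : 1 < p)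
    {m₁ m₂ : ℕ} (hm₁ : 1 ≤ m₁) (hm₂ : 1 ≤ m₂) (h : m₁ + m₂ ≤ p)
    (hA₀ : a 0 * b 0 * (s ^ 2) ^ (m₁ - 1) = 1) (hA₁ : a 1 * b 1 * (s ^ 2) ^ (m₂ - 1) = 1) :
    generatedByVertex (cartanA2 s) a b = stdSpan s 0 m₁ m₂ :=
  le_antisymm (generated_le_stdSpan a b hs (ht.ne_one hp) hm₁ hm₂ hA₀ hA₁)
    (stdSpan_le_of_stable hs ht hp (by omega) (by omega) hA₀ hA₁
      (fun _ => generated_act_mem _ 0) (fun _ => generated_act_mem _ 1) fun _ hl =>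
      pbw_zero_mid_mem_generated hs ht hp (by omega) (by omega) hm₂ hA₀ hA₁ hl (Or.inl h))

/-- This is the row just outside the complement. At `i = 0` it lies in the generated module, and
`F₀` raises `i` with an error term in the complement. -/
theorem pbw_mem_sup (hs : s ≠ 0) (ht : IsPrimitiveRoot (s ^ 2) p) (hp : 1 < p)
    {k m₁ m₂ : ℕ} (hk : 0 < k) (hm₁ : m₁ < p) (hm₂ : m₂ ≤ p) (h : m₁ + m₂ = k + p)
    (hA₀ : a 0 * b 0 * (s ^ 2) ^ (m₁ - 1) = 1) (hA₁ : a 1 * b 1 * (s ^ 2) ^ (m₂ - 1) = 1)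
    {i l : ℕ} (hl : k ≤ l) (hil : i + l < m₁)
    (h₀ : generatedByVertex (cartanA2 s) a b ⊔ stdSpan s k (p - m₂) (p - m₁) ≤
      (generatedByVertex (cartanA2 s) a b ⊔ stdSpan s k (p - m₂) (p - m₁)).comap
        (act (cartanA2 s) a b (word [0]))) :
    pbw s i l (p - m₁) ∈
      generatedByVertex (cartanA2 s) a b ⊔ stdSpan s k (p - m₂) (p - m₁) := by
  set T := generatedByVertex (cartanA2 s) a b ⊔ stdSpan s k (p - m₂) (p - m₁)
  have ht0 : s ^ 2 ≠ 0 := pow_ne_zero 2 hs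
  induction i with
  | zero =>
    exact Submodule.mem_sup_left (pbw_zero_mem_generated hs ht hp hm₁.le hm₂ (by omega) hA₀ hA₁
      (by omega) (by omega) (by omega))
  | succ i ih =>
    have h1 := h₀ (ih (by omega))
    rw [Submodule.mem_comap, act_zero_pbw a b hs (ht.ne_one hp),
      T.smul_mem_iff (pow_ne_zero _ hs), T.add_mem_iff_left] at h1
    · refine (T.smul_mem_iff fun h2 => ?_).mp h1
      refine pow_ne_pow hs ht (m := i + l) (n := m₁ - 1 + (p - m₁)) (by omega)
        (not_dvd_of_lt (by omega) (by omega)) ?_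
      rw [pow_add _ (m₁ - 1)]
      rw [sub_eq_zero, eq_mul_inv_iff_mul_eq₀ (pow_ne_zero _ ht0), one_mul] at h2
      linear_combination -(s ^ 2) ^ (i + l) * hA₀ - (s ^ 2) ^ (m₁ - 1) * h2
    · exact T.smul_mem _ (Submodule.mem_sup_right
        (stdMon_mem (d := 0) (by omega) (by omega) (by omega)))

/-- The whole layer `c + d = p - m₁`, into which `F₁` may push elements of the complement, is in the
sum. -/
theorem stdMon_mem_sup (hs : s ≠ 0) (ht : IsPrimitiveRoot (s ^ 2) p) (hp : 1 < p)
    {k m₁ m₂ : ℕ} (hk : 0 < k) (hm₁ : m₁ < p) (hm₂ : m₂ ≤ p) (h : m₁ + m₂ = k + p)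
    (hA₀ : a 0 * b 0 * (s ^ 2) ^ (m₁ - 1) = 1) (hA₁ : a 1 * b 1 * (s ^ 2) ^ (m₂ - 1) = 1)
    {d i l c : ℕ} (hl : k ≤ l) (hil : i + l < m₁) (hc : c + d = p - m₁)
    (h₀ : generatedByVertex (cartanA2 s) a b ⊔ stdSpan s k (p - m₂) (p - m₁) ≤
      (generatedByVertex (cartanA2 s) a b ⊔ stdSpan s k (p - m₂) (p - m₁)).comap
        (act (cartanA2 s) a b (word [0]))) :
    stdMon s d i l c ∈
      generatedByVertex (cartanA2 s) a b ⊔ stdSpan s k (p - m₂) (p - m₁) := by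
  have ht1 := ht.ne_one hp
  set T := generatedByVertex (cartanA2 s) a b ⊔ stdSpan s k (p - m₂) (p - m₁)
  induction d generalizing i c with
  | zero =>
    obtain rfl : c = p - m₁ := by omega
    exact pbw_mem_sup hs ht hp hk hm₁ hm₂ h hA₀ hA₁ hl hil h₀
  | succ d ih =>
    by_cases h3 : i + 1 + l < m₁
    · exact sub_mem (T.smul_mem _ (ih h3 (by omega)))
        (T.smul_mem _ (Submodule.mem_sup_right (stdMon_mem (by omega) (by omega) (by omega))))
    · have h2 := h₀ (ih (i := i) (c := c + 1) hil (by omega))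
      rw [Submodule.mem_comap, act_zero_stdMon a b hs ht1, T.sub_mem_iff_right,
        Nat.add_sub_cancel] at h2
      · refine (T.smul_mem_iff ?_).mp h2
        have hA : a 0 * b 0 ≠ 0 := left_ne_zero_of_mul_eq_one hA₀
        have := one_sub_pow_ne_zero ht (not_dvd_of_lt (Nat.succ_pos c) (by omega))
        exact mul_ne_zero (pow_ne_zero _ hs) (mul_ne_zero (mul_ne_zero (mul_ne_zero this hA)
          (pow_ne_zero _ (pow_ne_zero _ hs))) (inv_ne_zero (pow_ne_zero _ (pow_ne_zero _ hs))))
      · rw [show i + l = m₁ - 1 by omega, hA₀]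
        simp

/-- For `m₁ + m₂ > p`, a complement of the module generated by the vertex. -/
theorem generated_sup_stdSpan (hs : s ≠ 0) (ht : IsPrimitiveRoot (s ^ 2) p) (hp : 1 < p)
    {k m₁ m₂ : ℕ} (hk : 0 < k) (hm₁ : m₁ ≤ p) (hm₂ : m₂ ≤ p) (h : m₁ + m₂ = k + p)
    (hA₀ : a 0 * b 0 * (s ^ 2) ^ (m₁ - 1) = 1) (hA₁ : a 1 * b 1 * (s ^ 2) ^ (m₂ - 1) = 1) :
    generatedByVertex (cartanA2 s) a b ⊔ stdSpan s k (p - m₂) (p - m₁) = stdSpan s 0 m₁ m₂ := by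
  have ht1 := ht.ne_one hp
  have hkm : k + (p - m₂) = m₁ := by omega
  refine le_antisymm (sup_le (generated_le_stdSpan a b hs ht1 (by omega) (by omega) hA₀ hA₁)
    (stdSpan_le fun d i l c _ _ _ => stdMon_mem (Nat.zero_le _) (by omega) (by omega))) ?_
  -- The complement is itself stable under `F₀`, as `k + (p - m₂) = m₁`; for `F₁`, stability is
  -- proved only for the sum.
  have h₀ : generatedByVertex (cartanA2 s) a b ⊔ stdSpan s k (p - m₂) (p - m₁) ≤
      (generatedByVertex (cartanA2 s) a b ⊔ stdSpan s k (p - m₂) (p - m₁)).comap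
        (act (cartanA2 s) a b (word [0])) := by
    refine sup_le (fun x hx => Submodule.mem_sup_left (generated_act_mem _ 0 hx))
      fun x hx => Submodule.mem_sup_right ?_
    exact act_zero_mem_stdSpan a b hs ht1 (by rwa [hkm]) hx
  refine stdSpan_le_of_stable hs ht hp hm₁ hm₂ hA₀ hA₁ h₀ ?_ ?_
  · refine sup_le (fun x hx => Submodule.mem_sup_left (generated_act_mem _ 1 hx)) ?_
    refine stdSpan_le fun d i l c hl hil hc => ?_
    rw [Submodule.mem_comap, act_one_stdMon a b hs ht1]
    refine sub_mem (Submodule.smul_mem _ _ ?_) ?_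
    · by_cases h1 : c + 1 + d < p - m₁
      · exact Submodule.mem_sup_right (stdMon_mem hl hil h1)
      · exact stdMon_mem_sup hs ht hp hk (by omega) hm₂ h hA₀ hA₁ hl (by omega) (by omega) h₀
    · cases i with
      | zero => simp
      | succ i =>
        exact Submodule.smul_mem _ _ (Submodule.mem_sup_right
          (stdMon_mem (by omega) (by omega) hc))
  · intro l hl
    by_cases hlk : l < k
    · exact Submodule.mem_sup_left (pbw_zero_mid_mem_generated hs ht hp hm₁ hm₂ (by omega) hA₀ hA₁
        hl (Or.inr (by omega)))
    -- For `m₁ = p` the complement is zero, and every `z ^ l` already lies in the generated module.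
    · rcases hm₁.eq_or_lt with hm | hm
      · exact Submodule.mem_sup_left (pbw_zero_mem_generated hs ht hp hm₁ hm₂ (by omega) hA₀ hA₁
          hl (by omega) (by omega))
      · exact Submodule.mem_sup_right (stdMon_mem (d := 0) (by omega) (by omega) (by omega))

theorem finrank_generated_add (hs : s ≠ 0) (ht : IsPrimitiveRoot (s ^ 2) p) (hp : 1 < p)
    {m₁ m₂ : ℕ} (hm₁ : m₁ ≤ p) (hm₂ : m₂ ≤ p) (h : p < m₁ + m₂)
    (hA₀ : a 0 * b 0 * (s ^ 2) ^ (m₁ - 1) = 1) (hA₁ : a 1 * b 1 * (s ^ 2) ^ (m₂ - 1) = 1) :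
    2 * Module.finrank ℂ (generatedByVertex (cartanA2 s) a b) +
      (p - m₁) * (p - m₂) * (p - m₁ + (p - m₂)) = m₁ * m₂ * (m₁ + m₂) := by
  obtain ⟨k, hk⟩ := Nat.exists_eq_add_of_lt h
  have hk' : m₁ + m₂ = k + 1 + p := by omega
  have f1 := finiteDimensional_stdSpan hs 0 m₁ m₂
  have f2 := finiteDimensional_stdSpan hs (k + 1) (p - m₂) (p - m₁)
  have hle := generated_le_stdSpan a b hs (ht.ne_one hp) (by omega) (by omega) hA₀ hA₁
  have f3 := Submodule.finiteDimensional_of_le hle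
  have h1 := Submodule.finrank_sup_add_finrank_inf_eq (generatedByVertex (cartanA2 s) a b)
    (stdSpan s (k + 1) (p - m₂) (p - m₁))
  rw [disjoint_generated_stdSpan hs ht hp (Nat.succ_pos k) hm₁ hm₂ hk' hA₀ hA₁,
    generated_sup_stdSpan hs ht hp (Nat.succ_pos k) hm₁ hm₂ hk' hA₀ hA₁, finrank_bot,
    add_zero] at h1
  have h2 := two_mul_finrank_stdSpan hs ht hp hm₁ hm₂
  have h3 := two_mul_finrank_stdSpan_shift hs ht hp (k := k + 1) (m₁ := p - m₂) (m₂ := p - m₁)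
    (by omega)
  rw [← h2, h1, mul_add _ (Module.finrank _ _), h3]
  ring

/-! ### The parameters of the one-vertex modules -/

theorem q_ne_zero (p : ℕ) : q p ≠ 0 := Complex.exp_ne_zero _

theorem isPrimitiveRoot_q_sq (hp : 2 ≤ p) : IsPrimitiveRoot (q p ^ 2) p := by
  have h := Complex.isPrimitiveRoot_exp p (by omega)
  rw [q, ← Complex.exp_nat_mul]
  convert h using 2
  push_cast
  ring

theorem res_spec (hp : 2 ≤ p) (x : ℤ) : ∃ m : ℕ, res p x = m ∧ 1 ≤ m ∧ m ≤ p ∧ (p : ℤ) ∣ m - x := by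
  have h0 : (p : ℤ) ≠ 0 := by omega
  have h1 := Int.emod_nonneg x h0
  have h2 := Int.emod_lt_of_pos x (by omega : (0 : ℤ) < p)
  rw [res]
  split_ifs with h
  · exact ⟨p, rfl, by omega, le_rfl, dvd_sub_self_left.mpr (Int.dvd_of_emod_eq_zero h)⟩
  · refine ⟨(x % p).toNat, by omega, by omega, by omega, ?_⟩
    rw [Int.toNat_of_nonneg h1]
    exact (Int.mod_modEq x p).symm.dvd

theorem vertexBraiding_mul (hp : 2 ≤ p) {n : ℤ} {m : ℕ} (hm : 1 ≤ m) (h : (p : ℤ) ∣ m - n) :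
    q p ^ (1 - n) * q p ^ (1 - n) * (q p ^ 2) ^ (m - 1) = 1 := by
  have hq := q_ne_zero p
  have h1 : q p ^ (1 - n) * q p ^ (1 - n) * (q p ^ 2) ^ (m - 1) = (q p ^ 2) ^ ((m : ℤ) - n) := by
    rw [← zpow_natCast (q p ^ 2) (m - 1), ← zpow_natCast (q p) 2, ← zpow_mul, ← zpow_mul,
      ← zpow_add₀ hq, ← zpow_add₀ hq]
    congr 1
    push_cast [Nat.cast_sub hm]
    ring
  rw [h1, ((isPrimitiveRoot_q_sq hp).zpow_eq_one_iff_dvd _).mpr h]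

theorem finrank_generated (hp : 2 ≤ p) (n₁ n₂ : ℤ) :
    FiniteDimensional ℂ (generatedByVertex (cartanA2 (q p))
        (vertexBraiding p n₁ n₂) (vertexBraiding p n₁ n₂)) ∧
      (Module.finrank ℂ (generatedByVertex (cartanA2 (q p))
        (vertexBraiding p n₁ n₂) (vertexBraiding p n₁ n₂)) : ℚ) = dimFormula p n₁ n₂ := by
  obtain ⟨m₁, e₁, hm₁, hm₁', hd₁⟩ := res_spec hp n₁
  obtain ⟨m₂, e₂, hm₂, hm₂', hd₂⟩ := res_spec hp n₂
  have hA₀ : vertexBraiding p n₁ n₂ 0 * vertexBraiding p n₁ n₂ 0 * (q p ^ 2) ^ (m₁ - 1) = 1 :=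
    vertexBraiding_mul hp hm₁ hd₁
  have hA₁ : vertexBraiding p n₁ n₂ 1 * vertexBraiding p n₁ n₂ 1 * (q p ^ 2) ^ (m₂ - 1) = 1 :=
    vertexBraiding_mul hp hm₂ hd₂
  have hs := q_ne_zero p
  have ht := isPrimitiveRoot_q_sq hp
  have f1 := finiteDimensional_stdSpan hs 0 m₁ m₂
  refine ⟨Submodule.finiteDimensional_of_le
    (generated_le_stdSpan _ _ hs (ht.ne_one hp) hm₁ hm₂ hA₀ hA₁), ?_⟩
  rw [dimFormula, e₁, e₂]
  split_ifs with h
  · rw [generated_eq_stdSpan hs ht hp hm₁ hm₂ (by omega) hA₀ hA₁, d]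
    have h1 : ((2 * Module.finrank ℂ (stdSpan (q p) 0 m₁ m₂) : ℕ) : ℚ) =
      (m₁ * m₂ * (m₁ + m₂) : ℕ) := by rw [two_mul_finrank_stdSpan hs ht hp hm₁' hm₂']
    push_cast at h1 ⊢
    linarith
  · have h1 := congrArg (Nat.cast : ℕ → ℚ)
      (finrank_generated_add hs ht hp hm₁' hm₂' (by omega) hA₀ hA₁)
    push_cast [Nat.cast_sub hm₁', Nat.cast_sub hm₂'] at h1
    rw [d, d]
    push_cast
    linarith

end

end NicholsYD

theorem mainTheorem5 (p : ℕ) (hp : 2 ≤ p) (n₁ n₂ : ℤ) :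
    NicholsYD.IsSimpleYetterDrinfeld (NicholsYD.qMatrix p)
        (NicholsYD.vertexBraiding p n₁ n₂) (NicholsYD.vertexBraiding p n₁ n₂)
        (NicholsYD.generatedByVertex (NicholsYD.qMatrix p)
          (NicholsYD.vertexBraiding p n₁ n₂) (NicholsYD.vertexBraiding p n₁ n₂)) ∧
      FiniteDimensional ℂ
        (NicholsYD.generatedByVertex (NicholsYD.qMatrix p)
          (NicholsYD.vertexBraiding p n₁ n₂) (NicholsYD.vertexBraiding p n₁ n₂)) ∧
      (Module.finrank ℂ
        (NicholsYD.generatedByVertex (NicholsYD.qMatrix p)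
          (NicholsYD.vertexBraiding p n₁ n₂) (NicholsYD.vertexBraiding p n₁ n₂)) : ℚ) =
        NicholsYD.dimFormula p n₁ n₂ :=
  -- `qMatrix p` unfolds to `cartanA2 (q p)`, so the results on type `A₂` apply by definitional
  -- equality.
  ⟨NicholsYD.isSimpleYetterDrinfeld_generated _ _ _, NicholsYD.finrank_generated hp n₁ n₂⟩
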